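/- **Setting.** Let $M$ be a closed 3-manifold with a (finite, simplicial) triangulation $\mathcal T$, with vertex set $\mathcal T_0$ and set of tetrahedra $\mathcal T_3$. The tetra-degree $d_i$ of a vertex $i$ is the number of tetrahedra incident to $i$. A *ball packing* is a vector $r=(r_i)_{i\in\mathcal T_0}$ of positive real numbers. A tetrahedron $\{ijkl\}\in\mathcal T_3$ is *real* for $r$ if there is a non-degenerate tetrahedron in hyperbolic space $\mathbb H^3$ (curvature $-1$) with edge lengths $l_{ab}=r_a+r_b$ for distinct $a,b\in\{i,j,k,l\}$ (it is then unique up to isometry), and *virtual* otherwise. The packing $r$ is *real* if all tetrahedra of $\mathcal T$ are real for $r$, and *virtual* otherwise. The extended solid angle $\widetilde\alpha_{ijkl}(r)$ of $\{ijkl\}$ at $i$ is the following number. If the tetrahedron is real, it is the solid angle at the vertex $i$ of the hyperbolic tetrahedron, i.e. the sum of the three dihedral angles at the edges through $i$ minus $\pi$. If the tetrahedron is virtual, it is $2\pi$ when, with $y=\coth r$, $$y_i\ \ge\ y_j+y_k+y_l+2\sqrt{y_jy_k+y_ky_l+y_ly_j+1},$$ and $0$ otherwise. The extended combinatorial scalar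 curvature at the vertex $i$ is $$\widetilde K_i(r)=4\pi-\sum_{\{ijkl\}\in\mathcal T_3}\widetilde\alpha_{ijkl}(r),$$ the sum being over all tetrahedra incident to $i$. The extended combinatorial Yamabe flow is the system $$\frac{dr_i}{dt}=-\widetilde K_i(r)\,\sinh r_i,\qquad i\in\mathcal T_0,$$ for curves $r(t)$ of ball packings. **Theorem 1.2.** Suppose that $d_i\ge 23$ for every vertex $i$. Then there is a ball packing $r$, real or virtual, with $\widetilde K_i(r)=0$ for all $i\in\mathcal T_0$. If moreover $\bar r$ is a real ball packing with $\widetilde K_i(\bar r)=0$ for all $i$, then for every initial ball packing $r_0$ the extended combinatorial Yamabe flow has a solution $r(t)$ with $r(0)=r_0$ defined for all $t\in[0,\infty)$, and every such solution converges exponentially fast to $\bar r$: there are constants $C,c>0$ with $$|r_i(t)-\bar r_i|\le C e^{-ct}\qquad\text{for all } t\ge 0 \text{ and all } i\in\mathcal T_0.$$ -/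

import Mathlib

/-! ### Hyperbolic 3-space (hyperboloid model) -/

/-- The Lorentzian inner product of signature `(3,1)` on `ℝ⁴`. -/
def lorentz (x y : Fin 4 → ℝ) : ℝ := -(x 0 * y 0) + x 1 * y 1 + x 2 * y 2 + x 3 * y 3

/-- Hyperbolic 3-space of curvature `-1`: the upper sheet of the hyperboloid `⟨x, x⟩ = -1`. -/
def HypSpace : Type := {x : Fin 4 → ℝ // lorentz x x = -1 ∧ 0 < x 0}

/-- The hyperbolic distance, `cosh (dist x y) = -⟨x, y⟩`. -/
noncomputable def hypDist (x y : HypSpace) : ℝ := Real.arcosh (-lorentz x.1 y.1)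

/-- The initial direction at `a` of the geodesic from `a` to `x` (a positive multiple of it):
the component of `x` in the tangent space `a^⊥` of the hyperboloid at `a`. -/
def tangentTo (a x : HypSpace) : Fin 4 → ℝ := x.1 + lorentz a.1 x.1 • a.1

/-- The component of the tangent vector `u` orthogonal to the tangent vector `w`. -/
noncomputable def orthPart (w u : Fin 4 → ℝ) : Fin 4 → ℝ := u - (lorentz u w / lorentz w w) • w

/-- The angle between two tangent vectors at a point of the hyperboloid (the Lorentzian product
is positive definite on tangent spaces). -/
noncomputable def tangentAngle (u v : Fin 4 → ℝ) : ℝ :=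
  Real.arccos (lorentz u v / (Real.sqrt (lorentz u u) * Real.sqrt (lorentz v v)))

/-- The dihedral angle at the edge `ab` of the tetrahedron `abcd`, measured at `a`: the angle
between the half-planes through `c` and `d` bounded by the line `ab`, that is, between the
directions at `a` that are orthogonal to the edge and point into the faces `abc` and `abd`. -/
noncomputable def dihedralAngle (a b c d : HypSpace) : ℝ :=
  tangentAngle (orthPart (tangentTo a b) (tangentTo a c)) (orthPart (tangentTo a b) (tangentTo a d))

/-- The solid angle at the vertex `p i` of the tetrahedron with vertices `p 0, …, p 3`, that is, the
area of its spherical link triangle: the sum of the three dihedral angles at the edges through `p i`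
minus `π`. (`i.succAbove 0`, `i.succAbove 1`, `i.succAbove 2` are the three other indices.) -/
noncomputable def solidAngle (p : Fin 4 → HypSpace) (i : Fin 4) : ℝ :=
  dihedralAngle (p i) (p (i.succAbove 0)) (p (i.succAbove 1)) (p (i.succAbove 2)) +
  dihedralAngle (p i) (p (i.succAbove 1)) (p (i.succAbove 2)) (p (i.succAbove 0)) +
  dihedralAngle (p i) (p (i.succAbove 2)) (p (i.succAbove 0)) (p (i.succAbove 1)) - Real.pi

/-! ### Real and virtual tetrahedra -/

/-- `p` is a non-degenerate hyperbolic tetrahedron (its vertices lie on no common hyperbolic plane)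
whose edges have the lengths `r i + r j`. -/
def IsTetrahedronOf (r : Fin 4 → ℝ) (p : Fin 4 → HypSpace) : Prop :=
  LinearIndependent ℝ (fun i => (p i).1) ∧ ∀ i j, i ≠ j → hypDist (p i) (p j) = r i + r j

/-- The radii `r` span a real (non-degenerate) tetrahedron; otherwise the tetrahedron is virtual. -/
def IsRealTetrahedron (r : Fin 4 → ℝ) : Prop := ∃ p, IsTetrahedronOf r p

/-- The hyperbolic cotangent. -/
noncomputable def hypCot (x : ℝ) : ℝ := Real.cosh x / Real.sinh x

/-- The `i`-th virtual tetrahedron space `D_i`: with `y = coth r`,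
`y_i ≥ y_j + y_k + y_l + 2 √(y_j y_k + y_k y_l + y_l y_j + 1)`. -/
def InVirtualSpace (r : Fin 4 → ℝ) (i : Fin 4) : Prop :=
  hypCot (r (i.succAbove 0)) + hypCot (r (i.succAbove 1)) + hypCot (r (i.succAbove 2)) +
    2 * Real.sqrt (hypCot (r (i.succAbove 0)) * hypCot (r (i.succAbove 1)) +
      hypCot (r (i.succAbove 1)) * hypCot (r (i.succAbove 2)) +
      hypCot (r (i.succAbove 2)) * hypCot (r (i.succAbove 0)) + 1) ≤ hypCot (r i)

open Classical in
/-- The extended solid angle at the `i`-th vertex of the tetrahedron with radii `r`: the solid angle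
if the tetrahedron is real (it does not depend on the chosen position of the tetrahedron, which is
unique up to isometry), `2π` on `D_i`, and `0` on the other virtual tetrahedra. -/
noncomputable def extSolidAngle (r : Fin 4 → ℝ) (i : Fin 4) : ℝ :=
  if h : IsRealTetrahedron r then solidAngle h.choose i
  else if InVirtualSpace r i then 2 * Real.pi
  else 0

/-! ### Triangulations and ball packings -/

/-- A (finite) triangulation of the space `M`: a finite geometric simplicial complex in some
Euclidean space together with a homeomorphism from its underlying space onto `M`. -/
structure Triangulation (M : Type*) [TopologicalSpace M] where
  ambientDim : ℕ
  complex : Geometry.SimplicialComplex ℝ (EuclideanSpace ℝ (Fin ambientDim))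
  finite_faces : complex.faces.Finite
  homeo : complex.space ≃ₜ M

namespace Triangulation

/-- The vertices of the triangulation. -/
def Vertex {M : Type*} [TopologicalSpace M] (T : Triangulation M) : Type :=
  {v : EuclideanSpace ℝ (Fin T.ambientDim) // v ∈ T.complex.vertices}

/-- The tetrahedra of the triangulation, each given by the set of its four vertices. -/
def Tetra {M : Type*} [TopologicalSpace M] (T : Triangulation M) : Type :=
  {s : Finset (EuclideanSpace ℝ (Fin T.ambientDim)) // s ∈ T.complex.faces ∧ s.card = 4}

noncomputable instance {M : Type*} [TopologicalSpace M] (T : Triangulation M) : Fintype T.Tetra :=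
  (T.finite_faces.subset (fun _ hs => hs.1 :
    {s | s ∈ T.complex.faces ∧ s.card = 4} ⊆ T.complex.faces)).fintype

/-- The tetra-degree of a vertex: the number of tetrahedra incident to it. -/
noncomputable def tetraDegree {M : Type*} [TopologicalSpace M] (T : Triangulation M)
    (i : T.Vertex) : ℕ :=
  Nat.card {s : T.Tetra // i.1 ∈ s.1}

/-- An (arbitrary) enumeration without repetition of the four vertices of the tetrahedron `s`. -/
noncomputable def corner {M : Type*} [TopologicalSpace M] (T : Triangulation M) (s : T.Tetra)
    (m : Fin 4) : T.Vertex :=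
  ⟨((s.1.equivFinOfCardEq s.2.2).symm m).1,
    T.complex.down_closed s.2.1
      (Finset.singleton_subset_iff.2 ((s.1.equivFinOfCardEq s.2.2).symm m).2)
      (Finset.singleton_nonempty _)⟩

/-- A ball packing (real or virtual): a positive radius at each vertex. -/
def IsBallPacking {M : Type*} [TopologicalSpace M] (T : Triangulation M)
    (r : T.Vertex → ℝ) : Prop :=
  ∀ i, 0 < r i

/-- A real ball packing: one for which all the tetrahedra are non-degenerate. -/
def IsRealBallPacking {M : Type*} [TopologicalSpace M] (T : Triangulation M)
    (r : T.Vertex → ℝ) : Prop :=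
  T.IsBallPacking r ∧ ∀ s, IsRealTetrahedron (fun m => r (T.corner s m))

open Classical in
/-- The extended combinatorial scalar curvature at the vertex `i`: `4π` minus the sum of the
extended solid angles at `i` of all the tetrahedra incident to `i`. The sum is over the pairs
`(s, m)` such that the `m`-th vertex of `s` is `i`, one pair for each tetrahedron incident to `i`. -/
noncomputable def extCurvature {M : Type*} [TopologicalSpace M] (T : Triangulation M)
    (r : T.Vertex → ℝ) (i : T.Vertex) : ℝ :=
  4 * Real.pi - ∑ c : T.Tetra × Fin 4 with T.corner c.1 c.2 = i,
    extSolidAngle (fun m => r (T.corner c.1 m)) c.2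

/-- `r` is a solution on `[0, ∞)` of the extended combinatorial Yamabe flow
`dr_i/dt = -K̃_i sinh r_i` in the space of ball packings, with initial data `r₀`. -/
structure IsExtYamabeFlow {M : Type*} [TopologicalSpace M] (T : Triangulation M)
    (r₀ : T.Vertex → ℝ) (r : ℝ → T.Vertex → ℝ) : Prop where
  initial : r 0 = r₀
  isBallPacking : ∀ t, 0 ≤ t → T.IsBallPacking (r t)
  hasDeriv : ∀ t, 0 ≤ t → ∀ i, HasDerivWithinAt (fun τ => r τ i)
    (-T.extCurvature (r t) i * Real.sinh (r t i)) (Set.Ici 0) t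

end Triangulation

/-! Put y = coth r and Q = `disc y`. A tetrahedron is real exactly when Q > 0, since the Gram
determinant of its vertices is a negative multiple of Q (`isRealTetrahedron_iff`). Its dihedral
angle at the edge ab is π - ψ_c - ψ_d, where ψ_f = `midAngle y f` is the arccosine of an explicit
quotient, so the solid angle at i is 2π - 2 Σ_{f ≠ i} ψ_f. As `Real.arccos` is constant beyond ±1,
the same formula yields 2π or 0 on virtual tetrahedra: the extended angle is one continuous
function, `ballAngle` (`extSolidAngle_eq`).

The heart is monotonicity. Where Q > 0, the Jacobian of the angles in r is -1/(2√Q) times a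
symmetric form, which is positive definite (`hessForm_pos`). Where Q ≤ 0, the angles only take the
values 0 and 2π. A continuous function that is nonincreasing except where its value lies in a finite
set is nonincreasing, so the negated angles form a monotone operator on all positive radii
(`sum_ballAngle_antitone`), strongly monotone relative to a real tetrahedron on bounded sets
(`sum_ballAngle_strict`). Summation over the tetrahedra carries both facts to the curvature K.

On a suitable box [a, b]^V the field K points outwards. A smallest ball has angles at least those of
the regular tetrahedron of its radius; these tend to 3 arccos(1/3) - π > 4π/23 as the radius
shrinks, so degree 23 forces K < 0 there. At a large ball the angles are nearly 0 and K > 0. A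
continuous monotone field pointing outwards has a zero (`exists_zero_of_monotone`), which gives
existence. The box is invariant under the flow, and Peano's theorem gives solutions, with no
Lipschitz bound required. Near a real zero z the Lyapunov function Σ ∫ (x - z_i)/sinh x dx has
derivative -Σ K_i (r_i - z_i) along the flow, and strong monotonicity makes it decay exponentially
(`flow_exp_convergence`). -/

section

open Finset Filter Topology

/-! ### Solid angles in the coordinates y = coth r -/

namespace TetraPacking

/-- `y_j + y_k + y_l - y_i`. -/
noncomputable def defect (y : Fin 4 → ℝ) (i : Fin 4) : ℝ := ∑ m, y m - 2 * y i

/-- The discriminant: a tetrahedron with `coth` of the radii equal to `y` is real iff it is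
positive. -/
noncomputable def disc (y : Fin 4 → ℝ) : ℝ := (∑ m, y m) ^ 2 - 2 * ∑ m, y m ^ 2 + 4

/-- `y_j y_k + y_k y_l + y_l y_j + 1`, see `faceProd_eq`. -/
noncomputable def faceProd (y : Fin 4 → ℝ) (i : Fin 4) : ℝ := (defect y i ^ 2 + disc y) / 4

/-- The angle, at an edge of the face opposite to `i`, between that face and the direction
tangent to the sphere touching all edges. -/
noncomputable def midAngle (y : Fin 4 → ℝ) (i : Fin 4) : ℝ :=
  Real.arccos (defect y i / (2 * √(faceProd y i)))

/-- The extended solid angle in terms of `y = coth r`. -/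
noncomputable def linkArea (y : Fin 4 → ℝ) (i : Fin 4) : ℝ :=
  2 * Real.pi - 2 * (∑ f, midAngle y f - midAngle y i)

theorem faceProd_eq (y : Fin 4 → ℝ) (i : Fin 4) :
    faceProd y i = y (i.succAbove 0) * y (i.succAbove 1) + y (i.succAbove 1) * y (i.succAbove 2) +
      y (i.succAbove 2) * y (i.succAbove 0) + 1 := by
  simp only [faceProd, defect, disc, Fin.sum_univ_succAbove _ i, Fin.sum_univ_three]
  ring

theorem four_mul_faceProd (y : Fin 4 → ℝ) (i : Fin 4) :
    4 * faceProd y i = defect y i ^ 2 + disc y := by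
  simp only [faceProd]; ring

theorem faceProd_pos {y : Fin 4 → ℝ} (hy : ∀ i, 1 < y i) (i : Fin 4) : 4 < faceProd y i := by
  rw [faceProd_eq]
  have h0 := hy (i.succAbove 0)
  have h1 := hy (i.succAbove 1)
  have h2 := hy (i.succAbove 2)
  nlinarith

/-- The coefficient `4√Q · ∂ψ_f/∂t` of the derivative of the angles `midAngle`. -/
noncomputable def midRate (y x : Fin 4 → ℝ) (f : Fin 4) : ℝ :=
  (defect y f * ∑ k, defect y k * x k - disc y * defect x f) / faceProd y f

/-- The weight of the edge of the tetrahedron opposite to `il`. -/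
noncomputable def edgeCoeff (y : Fin 4 → ℝ) (i l : Fin 4) : ℝ :=
  (defect y i * defect y l + disc y) / (faceProd y i * faceProd y l)

/-- The contribution of the edge `jk`, opposite to `il`, to `hessForm`. -/
noncomputable def edgeForm (y d e : Fin 4 → ℝ) (j k i l : Fin 4) : ℝ :=
  edgeCoeff y i l *
    ((y j * y k + 1) * ((y j ^ 2 - 1) * d j * e j + (y k ^ 2 - 1) * d k * e k) -
      (y j ^ 2 - 1) * (y k ^ 2 - 1) * (d j * e k + d k * e j))

/-- The (negated, rescaled) Hessian form of a tetrahedron. -/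
noncomputable def hessForm (y d e : Fin 4 → ℝ) : ℝ :=
  edgeForm y d e 0 1 2 3 + edgeForm y d e 0 2 1 3 + edgeForm y d e 0 3 1 2 +
  edgeForm y d e 1 2 0 3 + edgeForm y d e 1 3 0 2 + edgeForm y d e 2 3 0 1

/-- `x_k = -(y_k² - 1) d_k` is the variation of `y = coth r` for the variation `d` of `r`. -/
def cothRate (y d : Fin 4 → ℝ) (k : Fin 4) : ℝ := -(y k ^ 2 - 1) * d k

/-! ### The Jacobian of the angles as a sum over edges -/

theorem offdiag_aux (a b c d : ℝ) (S Q Ac Ad : ℝ) (hS : S = a + b + c + d)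
    (hQ : Q = S ^ 2 - 2 * (a ^ 2 + b ^ 2 + c ^ 2 + d ^ 2) + 4)
    (hc : Ac = ((S - 2 * c) ^ 2 + Q) / 4) (hd : Ad = ((S - 2 * d) ^ 2 + Q) / 4)
    (hc0 : Ac ≠ 0) (hd0 : Ad ≠ 0) :
    4 + ((S - 2 * c) * (S - 2 * b) - Q) / Ac + ((S - 2 * d) * (S - 2 * b) - Q) / Ad =
      (a ^ 2 - 1) * ((S - 2 * c) * (S - 2 * d) + Q) / (Ac * Ad) := by
  field_simp
  subst hc hd hQ hS
  ring

theorem diag_aux (a b c d : ℝ) (S Q Ab Ac Ad : ℝ) (hS : S = a + b + c + d)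
    (hQ : Q = S ^ 2 - 2 * (a ^ 2 + b ^ 2 + c ^ 2 + d ^ 2) + 4)
    (hb : Ab = ((S - 2 * b) ^ 2 + Q) / 4)
    (hc : Ac = ((S - 2 * c) ^ 2 + Q) / 4) (hd : Ad = ((S - 2 * d) ^ 2 + Q) / 4)
    (hb0 : Ab ≠ 0) (hc0 : Ac ≠ 0) (hd0 : Ad ≠ 0) :
    ((S - 2 * b) * (S - 2 * a) - Q) / Ab + ((S - 2 * c) * (S - 2 * a) - Q) / Ac +
      ((S - 2 * d) * (S - 2 * a) - Q) / Ad =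
      -((a * b + 1) * (((S - 2 * c) * (S - 2 * d) + Q) / (Ac * Ad)) +
        (a * c + 1) * (((S - 2 * b) * (S - 2 * d) + Q) / (Ab * Ad)) +
        (a * d + 1) * (((S - 2 * b) * (S - 2 * c) + Q) / (Ab * Ac))) := by
  field_simp
  subst hb hc hd hQ hS
  ring

/-- The coefficient of `x k` in `midRate y x f` for k ≠ f. For k = f the coefficient is 4, because
defect² + disc = 4 · faceProd; this is the correction term in `midRate_eq`. -/
noncomputable def rateCoeff (y : Fin 4 → ℝ) (f k : Fin 4) : ℝ :=
  (defect y f * defect y k - disc y) / faceProd y f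

theorem midRate_eq (y x : Fin 4 → ℝ) (f : Fin 4) (hA : faceProd y f ≠ 0) :
    midRate y x f = ∑ k, rateCoeff y f k * x k + (4 - rateCoeff y f f) * x f := by
  have h4 : (4 - rateCoeff y f f) = 2 * disc y / faceProd y f := by
    simp only [rateCoeff]
    field_simp
    linear_combination four_mul_faceProd y f
  rw [h4]
  simp only [midRate, rateCoeff, Fin.sum_univ_four, defect]
  field_simp
  ring

/-- Symmetry of the Jacobian: the left side is the derivative in y_{p 1} of the sum of the rates
over the faces other than p 0. The substitution `cothRate` supplies the factor y_{p 1}² - 1, and the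
product with the right side is symmetric in p 0 and p 1. -/
theorem rateCoeff_off (y : Fin 4 → ℝ) (hA : ∀ i, faceProd y i ≠ 0) (p : Equiv.Perm (Fin 4)) :
    4 + rateCoeff y (p 2) (p 1) + rateCoeff y (p 3) (p 1) =
      (y (p 0) ^ 2 - 1) * edgeCoeff y (p 2) (p 3) := by
  have hS : ∑ m, y m = y (p 0) + y (p 1) + y (p 2) + y (p 3) := by
    rw [← Equiv.sum_comp p, Fin.sum_univ_four]
  have hQ : ∑ m, y m ^ 2 = y (p 0) ^ 2 + y (p 1) ^ 2 + y (p 2) ^ 2 + y (p 3) ^ 2 := by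
    rw [← Equiv.sum_comp p, Fin.sum_univ_four]
  have := offdiag_aux (y (p 0)) (y (p 1)) (y (p 2)) (y (p 3)) (∑ m, y m) (disc y)
    (faceProd y (p 2)) (faceProd y (p 3)) hS (by rw [disc, hQ]) rfl rfl (hA _) (hA _)
  simp only [rateCoeff, edgeCoeff]
  rw [mul_div_assoc] at this
  exact this

theorem rateCoeff_diag (y : Fin 4 → ℝ) (hA : ∀ i, faceProd y i ≠ 0) (p : Equiv.Perm (Fin 4)) :
    rateCoeff y (p 1) (p 0) + rateCoeff y (p 2) (p 0) + rateCoeff y (p 3) (p 0) =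
      -((y (p 0) * y (p 1) + 1) * edgeCoeff y (p 2) (p 3) +
        (y (p 0) * y (p 2) + 1) * edgeCoeff y (p 1) (p 3) +
        (y (p 0) * y (p 3) + 1) * edgeCoeff y (p 1) (p 2)) := by
  have hS : ∑ m, y m = y (p 0) + y (p 1) + y (p 2) + y (p 3) := by
    rw [← Equiv.sum_comp p, Fin.sum_univ_four]
  have hQ : ∑ m, y m ^ 2 = y (p 0) ^ 2 + y (p 1) ^ 2 + y (p 2) ^ 2 + y (p 3) ^ 2 := by
    rw [← Equiv.sum_comp p, Fin.sum_univ_four]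
  exact diag_aux (y (p 0)) (y (p 1)) (y (p 2)) (y (p 3)) (∑ m, y m) (disc y)
    (faceProd y (p 1)) (faceProd y (p 2)) (faceProd y (p 3)) hS (by rw [disc, hQ]) rfl rfl rfl
    (hA _) (hA _) (hA _)

theorem rateCoeff_off' (y : Fin 4 → ℝ) (hA : ∀ i, faceProd y i ≠ 0) {j k i l : Fin 4}
    (h : Function.Injective ![j, k, i, l]) :
    4 + rateCoeff y i k + rateCoeff y l k = (y j ^ 2 - 1) * edgeCoeff y i l :=
  rateCoeff_off y hA (Equiv.ofBijective _ (Finite.injective_iff_bijective.1 h))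

theorem rateCoeff_diag' (y : Fin 4 → ℝ) (hA : ∀ i, faceProd y i ≠ 0) {j k i l : Fin 4}
    (h : Function.Injective ![j, k, i, l]) :
    rateCoeff y k j + rateCoeff y i j + rateCoeff y l j =
      -((y j * y k + 1) * edgeCoeff y i l + (y j * y i + 1) * edgeCoeff y k l +
        (y j * y l + 1) * edgeCoeff y k i) :=
  rateCoeff_diag y hA (Equiv.ofBijective _ (Finite.injective_iff_bijective.1 h))

theorem sum_midRate (y d e : Fin 4 → ℝ) (hA : ∀ i, faceProd y i ≠ 0) :
    ∑ f, midRate y (cothRate y d) f * (∑ m, e m - e f) = hessForm y d e := by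
  have o01 := rateCoeff_off' y hA (j := 0) (k := 1) (i := 2) (l := 3) (by decide)
  have o02 := rateCoeff_off' y hA (j := 0) (k := 2) (i := 1) (l := 3) (by decide)
  have o03 := rateCoeff_off' y hA (j := 0) (k := 3) (i := 1) (l := 2) (by decide)
  have o10 := rateCoeff_off' y hA (j := 1) (k := 0) (i := 2) (l := 3) (by decide)
  have o12 := rateCoeff_off' y hA (j := 1) (k := 2) (i := 0) (l := 3) (by decide)
  have o13 := rateCoeff_off' y hA (j := 1) (k := 3) (i := 0) (l := 2) (by decide)
  have o20 := rateCoeff_off' y hA (j := 2) (k := 0) (i := 1) (l := 3) (by decide)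
  have o21 := rateCoeff_off' y hA (j := 2) (k := 1) (i := 0) (l := 3) (by decide)
  have o23 := rateCoeff_off' y hA (j := 2) (k := 3) (i := 0) (l := 1) (by decide)
  have o30 := rateCoeff_off' y hA (j := 3) (k := 0) (i := 1) (l := 2) (by decide)
  have o31 := rateCoeff_off' y hA (j := 3) (k := 1) (i := 0) (l := 2) (by decide)
  have o32 := rateCoeff_off' y hA (j := 3) (k := 2) (i := 0) (l := 1) (by decide)
  have d0 := rateCoeff_diag' y hA (j := 0) (k := 1) (i := 2) (l := 3) (by decide)
  have d1 := rateCoeff_diag' y hA (j := 1) (k := 0) (i := 2) (l := 3) (by decide)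
  have d2 := rateCoeff_diag' y hA (j := 2) (k := 0) (i := 1) (l := 3) (by decide)
  have d3 := rateCoeff_diag' y hA (j := 3) (k := 0) (i := 1) (l := 2) (by decide)
  have hm := fun f => midRate_eq y (cothRate y d) f (hA f)
  simp only [hm, hessForm, edgeForm, Fin.sum_univ_four, cothRate]
  linear_combination (-(y 1 ^ 2 - 1) * d 1 * e 0) * o01 + (-(y 2 ^ 2 - 1) * d 2 * e 0) * o02 +
    (-(y 3 ^ 2 - 1) * d 3 * e 0) * o03 + (-(y 0 ^ 2 - 1) * d 0 * e 1) * o10 +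
    (-(y 2 ^ 2 - 1) * d 2 * e 1) * o12 + (-(y 3 ^ 2 - 1) * d 3 * e 1) * o13 +
    (-(y 0 ^ 2 - 1) * d 0 * e 2) * o20 + (-(y 1 ^ 2 - 1) * d 1 * e 2) * o21 +
    (-(y 3 ^ 2 - 1) * d 3 * e 2) * o23 + (-(y 0 ^ 2 - 1) * d 0 * e 3) * o30 +
    (-(y 1 ^ 2 - 1) * d 1 * e 3) * o31 + (-(y 2 ^ 2 - 1) * d 2 * e 3) * o32 +
    (-(y 0 ^ 2 - 1) * d 0 * e 0) * d0 + (-(y 1 ^ 2 - 1) * d 1 * e 1) * d1 +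
    (-(y 2 ^ 2 - 1) * d 2 * e 2) * d2 + (-(y 3 ^ 2 - 1) * d 3 * e 3) * d3

/-! ### Positive definiteness of the Hessian form -/

theorem hessForm_add_smul (y d e : Fin 4 → ℝ) (s : ℝ) :
    hessForm y (d + s • e) (d + s • e) =
      hessForm y d d + 2 * s * hessForm y d e + s ^ 2 * hessForm y e e := by
  simp only [hessForm, edgeForm, Pi.add_apply, Pi.smul_apply, smul_eq_mul]; ring

theorem hessForm_smul (y d : Fin 4 → ℝ) (s : ℝ) :
    hessForm y (s • d) (s • d) = s ^ 2 * hessForm y d d := by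
  simp only [hessForm, edgeForm, Pi.smul_apply, smul_eq_mul]; ring

/-- A vector in the radical leaves all four angles stationary, so the variation x of y satisfies
defect x = λ · defect y, hence x = λ y. Then λ Q = Σ defect_k x_k = λ (Q - 4), because Q is a
homogeneous quadratic plus 4; so λ = 0. -/
theorem eq_zero_of_hessForm_eq_zero {y d : Fin 4 → ℝ} (hy : ∀ i, 1 < y i) (hQ : 0 < disc y)
    (h : ∀ e, hessForm y d e = 0) : d = 0 := by
  have hA : ∀ i, faceProd y i ≠ 0 := fun i => by linarith [faceProd_pos hy i] |> ne_of_gt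
  set x := cothRate y d with hx
  have h0 := h ![1, 0, 0, 0]
  have h1 := h ![0, 1, 0, 0]
  have h2 := h ![0, 0, 1, 0]
  have h3 := h ![0, 0, 0, 1]
  rw [← sum_midRate y d _ hA] at h0 h1 h2 h3
  simp only [Fin.sum_univ_four, ← hx] at h0 h1 h2 h3
  simp at h0 h1 h2 h3
  have hm : ∀ f, midRate y x f = 0 := by
    intro f
    fin_cases f <;> simp <;> linarith
  set lam := (∑ k, defect y k * x k) / disc y with hlam
  have hd : ∀ f, defect x f = lam * defect y f := by
    intro f
    have := hm f
    simp only [midRate, div_eq_zero_iff, hA f, or_false] at this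
    rw [hlam]
    field_simp
    linarith
  have hX : ∑ m, x m = lam * ∑ m, y m := by
    have h0 := hd 0
    have h1 := hd 1
    have h2 := hd 2
    have h3 := hd 3
    simp only [defect, Fin.sum_univ_four] at h0 h1 h2 h3 ⊢
    linarith
  have hxy : ∀ k, x k = lam * y k := by
    intro k
    have := hd k
    simp only [defect] at this
    linarith
  have hl : lam * disc y = lam * (disc y - 4) := by
    have : lam * disc y = ∑ k, defect y k * x k := by
      rw [hlam]; field_simp
    rw [this]
    simp only [hxy, disc, defect, Fin.sum_univ_four]
    ring
  have hl0 : lam = 0 := by linarith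
  funext k
  have := hxy k
  rw [hl0, zero_mul, hx, cothRate] at this
  have hk := hy k
  rcases mul_eq_zero.1 this with h | h
  · nlinarith
  · simpa using h

/-- A binary form whose determinant is (a² - 1)(b² - 1)(a + b)², by (ab + 1)² - (a² - 1)(b² - 1) =
(a + b)². Completing the square in p shows definiteness. -/
theorem bracket_aux {a b p q : ℝ} (ha : 1 < a) (hb : 1 < b) (h : p ≠ 0 ∨ q ≠ 0) :
    0 < (a * b + 1) * ((a ^ 2 - 1) * p * p + (b ^ 2 - 1) * q * q) -
      (a ^ 2 - 1) * (b ^ 2 - 1) * (p * q + q * p) := by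
  have hwa : 0 < a ^ 2 - 1 := by nlinarith
  have hwb : 0 < b ^ 2 - 1 := by nlinarith
  have hab : 0 < a * b + 1 := by positivity
  have key : (a * b + 1) * (a ^ 2 - 1) * ((a * b + 1) * ((a ^ 2 - 1) * p * p +
      (b ^ 2 - 1) * q * q) - (a ^ 2 - 1) * (b ^ 2 - 1) * (p * q + q * p)) =
      ((a * b + 1) * (a ^ 2 - 1) * p - (a ^ 2 - 1) * (b ^ 2 - 1) * q) ^ 2 +
        q ^ 2 * ((a ^ 2 - 1) * (b ^ 2 - 1) * (a + b) ^ 2) := by ring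
  have hc : 0 < (a * b + 1) * (a ^ 2 - 1) := by positivity
  refine (mul_pos_iff_of_pos_left hc).1 ?_
  rw [key]
  by_cases hq : q = 0
  · have hp : p ≠ 0 := by tauto
    subst hq
    have : (a * b + 1) * (a ^ 2 - 1) * p ≠ 0 := mul_ne_zero hc.ne' hp
    have := sq_pos_of_ne_zero this
    simpa using this
  · have : 0 < q ^ 2 := by positivity
    have : 0 < a + b := by linarith
    positivity

theorem bracket_nonneg {a b : ℝ} (ha : 1 < a) (hb : 1 < b) (p q : ℝ) :
    0 ≤ (a * b + 1) * ((a ^ 2 - 1) * p * p + (b ^ 2 - 1) * q * q) -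
      (a ^ 2 - 1) * (b ^ 2 - 1) * (p * q + q * p) := by
  by_cases h : p ≠ 0 ∨ q ≠ 0
  · exact (bracket_aux ha hb h).le
  · push Not at h
    simp [h.1, h.2]

theorem edgeCoeff_pos {y : Fin 4 → ℝ} (hy : ∀ i, 1 < y i) (hQ : 0 < disc y)
    {i l : Fin 4} (h : 0 ≤ defect y i * defect y l) : 0 < edgeCoeff y i l := by
  have h1 := faceProd_pos hy i
  have h2 := faceProd_pos hy l
  unfold edgeCoeff
  have : 0 < defect y i * defect y l + disc y := by linarith
  have : 0 < faceProd y i * faceProd y l := by nlinarith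
  positivity

theorem hessForm_pos_of_defect_nonneg {y d : Fin 4 → ℝ} (hy : ∀ i, 1 < y i) (hQ : 0 < disc y)
    (hv : ∀ i, 0 ≤ defect y i) (hd : d ≠ 0) : 0 < hessForm y d d := by
  have hn : ∀ j k i l, 0 ≤ edgeForm y d d j k i l := fun j k i l =>
    mul_nonneg (edgeCoeff_pos hy hQ (mul_nonneg (hv i) (hv l))).le (bracket_nonneg (hy j) (hy k) _ _)
  have hp : ∀ j k i l, d j ≠ 0 ∨ d k ≠ 0 → 0 < edgeForm y d d j k i l := fun j k i l h =>
    mul_pos (edgeCoeff_pos hy hQ (mul_nonneg (hv i) (hv l))) (bracket_aux (hy j) (hy k) h)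
  have n1 := hn 0 1 2 3
  have n2 := hn 0 2 1 3
  have n3 := hn 0 3 1 2
  have n4 := hn 1 2 0 3
  have n5 := hn 1 3 0 2
  have n6 := hn 2 3 0 1
  unfold hessForm
  by_cases h : d 0 ≠ 0 ∨ d 1 ≠ 0
  · have := hp 0 1 2 3 h
    linarith
  · have : d 2 ≠ 0 ∨ d 3 ≠ 0 := by
      by_contra h'
      push Not at h h'
      apply hd
      funext k
      fin_cases k
      exacts [h.1, h.2, h'.1, h'.2]
    have := hp 2 3 0 1 this
    linarith

theorem continuous_defect (i : Fin 4) : Continuous fun y => defect y i := by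
  unfold defect; fun_prop

theorem continuous_disc : Continuous disc := by
  unfold disc; fun_prop

theorem continuous_faceProd (i : Fin 4) : Continuous fun y => faceProd y i := by
  unfold faceProd
  have := continuous_defect i
  have := continuous_disc
  fun_prop

theorem continuousOn_hessForm :
    ContinuousOn (fun p : (Fin 4 → ℝ) × (Fin 4 → ℝ) => hessForm p.1 p.2 p.2)
      {p | ∀ i, 1 < p.1 i} := by
  have he : ∀ i l, ContinuousOn (fun p : (Fin 4 → ℝ) × (Fin 4 → ℝ) => edgeCoeff p.1 i l)
      {p | ∀ i, 1 < p.1 i} := by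
    intro i l
    unfold edgeCoeff
    refine ContinuousOn.div ?_ ?_ ?_
    · exact ((((continuous_defect i).comp continuous_fst).mul
        ((continuous_defect l).comp continuous_fst)).add
        (continuous_disc.comp continuous_fst)).continuousOn
    · exact (((continuous_faceProd i).comp continuous_fst).mul
        ((continuous_faceProd l).comp continuous_fst)).continuousOn
    · intro p hp
      have h1 := faceProd_pos hp i
      have h2 := faceProd_pos hp l
      positivity
  have hf : ∀ j k i l, ContinuousOn
      (fun p : (Fin 4 → ℝ) × (Fin 4 → ℝ) => edgeForm p.1 p.2 p.2 j k i l)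
      {p | ∀ i, 1 < p.1 i} := by
    intro j k i l
    exact (he i l).mul (Continuous.continuousOn (by fun_prop))
  exact (((((hf _ _ _ _).add (hf _ _ _ _)).add (hf _ _ _ _)).add (hf _ _ _ _)).add
    (hf _ _ _ _)).add (hf _ _ _ _)

/-- If `y i` exceeds the sum of the other coordinates, lowering it down to that sum preserves the
positivity of the discriminant. -/
theorem disc_update_pos {y : Fin 4 → ℝ} (hQ : 0 < disc y) {i : Fin 4} {t : ℝ}
    (ht : ∑ m, y m - y i ≤ t) (ht' : t ≤ y i) :
    0 < disc (Function.update y i t) := by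
  have hA : faceProd (Function.update y i t) i = faceProd y i := by
    -- `faceProd y i` does not involve y_i, so disc = 4 · faceProd - defect² depends on y_i only
    -- through the defect, whose absolute value shrinks as y_i is lowered.
    simp [faceProd_eq, Fin.succAbove_ne]
  have hv : defect (Function.update y i t) i = ∑ m, y m - y i - t := by
    simp only [defect, Fin.sum_univ_succAbove _ i, Function.update_self,
      Function.update_of_ne (Fin.succAbove_ne i _)]
    ring
  have h1 := four_mul_faceProd (Function.update y i t) i
  have h2 := four_mul_faceProd y i
  rw [hA, hv] at h1
  have : defect y i = ∑ m, y m - y i - y i := by simp only [defect]; ring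
  rw [this] at h2
  nlinarith

/-- An isotropic vector of a semidefinite form is in its radical. The test vector d - b/(c + 1) · g
uses c + 1 rather than c, which may vanish. -/
theorem hessForm_eq_zero_of_nonneg {y d : Fin 4 → ℝ} (hn : ∀ e, 0 ≤ hessForm y e e)
    (h0 : hessForm y d d = 0) (g : Fin 4 → ℝ) : hessForm y d g = 0 := by
  by_contra hg
  generalize hb : hessForm y d g = b at hg
  have hc : 0 ≤ hessForm y g g := hn g
  have := hn (d + (-(b / (hessForm y g g + 1))) • g)
  rw [hessForm_add_smul, h0, hb] at this
  generalize hessForm y g g = c at this hc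
  have h1 : 0 < b ^ 2 := by positivity
  have h2 : 0 + 2 * -(b / (c + 1)) * b + (-(b / (c + 1))) ^ 2 * c =
      -(b ^ 2 * (c + 2)) / (c + 1) ^ 2 := by
    field_simp; ring
  have h3 : -(b ^ 2 * (c + 2)) / (c + 1) ^ 2 < 0 := by
    apply div_neg_of_neg_of_pos
    · nlinarith
    · positivity
  linarith

theorem defect_update_nonneg {y : Fin 4 → ℝ} (hy : ∀ i, 1 < y i) {i : Fin 4}
    (hi : ∑ m, y m - y i ≤ y i) (f : Fin 4) :
    0 ≤ defect (Function.update y i (∑ m, y m - y i)) f := by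
  have hs := Fin.sum_univ_succAbove y i
  have hsum : ∑ m, Function.update y i (∑ m, y m - y i) m = 2 * (∑ m, y m - y i) := by
    rw [Fin.sum_univ_succAbove _ i]
    simp only [Function.update_self, Function.update_of_ne (Fin.succAbove_ne i _)]
    linarith
  rw [defect, hsum]
  by_cases hf : f = i
  · subst hf; simp
  · rw [Function.update_of_ne hf]
    have h1 := Finset.add_sum_erase Finset.univ y (Finset.mem_univ i)
    have h2 : y f ≤ ∑ m ∈ Finset.univ.erase i, y m :=
      Finset.single_le_sum (fun k _ => (zero_lt_one.trans (hy k)).le) (by simp [hf])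
    linarith

/-- A continuous family of quadratic forms, given by `q`, that is positive definite at the left end
of an interval and never degenerate where it is positive semidefinite, is positive definite. -/
theorem posDef_of_path {q : ℝ → (Fin 4 → ℝ) → ℝ} {s b : ℝ} (hsb : s ≤ b)
    (hq : ContinuousOn (fun p : ℝ × (Fin 4 → ℝ) => q p.1 p.2) (Set.Icc s b ×ˢ Set.univ))
    (hsmul : ∀ t e (c : ℝ), q t (c • e) = c ^ 2 * q t e) (hs : ∀ e, e ≠ 0 → 0 < q s e)
    (hnd : ∀ t ∈ Set.Icc s b, (∀ e, 0 ≤ q t e) → ∀ e, q t e = 0 → e = 0)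
    {d : Fin 4 → ℝ} (hd : d ≠ 0) : 0 < q b d := by
  by_contra hneg
  push Not at hneg
  have hsphere : ∀ e : Fin 4 → ℝ, e ≠ 0 → ‖e‖⁻¹ • e ∈ Metric.sphere (0 : Fin 4 → ℝ) 1 := by
    intro e he
    simp [norm_smul, norm_ne_zero_iff.2 he]
  have hKc : IsCompact (Set.Icc s b ×ˢ Metric.sphere (0 : Fin 4 → ℝ) 1) :=
    isCompact_Icc.prod (isCompact_sphere 0 1)
  have hcont := hq.mono (Set.prod_mono_right (s := Set.Icc s b)
    (Set.subset_univ (Metric.sphere (0 : Fin 4 → ℝ) 1)))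
  have hZc := hKc.of_isClosed_subset
    (hcont.preimage_isClosed_of_isClosed hKc.isClosed (isClosed_Iic (a := (0 : ℝ))))
    Set.inter_subset_left
  -- The smallest parameter t at which some unit vector has nonpositive value exists by compactness.
  obtain ⟨⟨t, e⟩, ⟨⟨ht, he⟩, hte⟩, hmin⟩ := hZc.exists_isMinOn
    ⟨(b, ‖d‖⁻¹ • d), ⟨⟨⟨hsb, le_rfl⟩, hsphere d hd⟩, by
      simp only [Set.mem_preimage, hsmul, Set.mem_Iic]
      exact mul_nonpos_of_nonneg_of_nonpos (by positivity) hneg⟩⟩ continuous_fst.continuousOn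
  simp only [Set.mem_preimage, Set.mem_Iic] at hte ht he
  have he0 : e ≠ 0 := by
    rintro rfl
    simp at he
  rcases eq_or_lt_of_le ht.1 with hst | hst
  · exact absurd (hst ▸ hs e he0) (not_lt.2 hte)
  -- The form is still semidefinite at t: a negative direction would persist at slightly earlier
  -- parameters, against minimality. So e is isotropic and nondegeneracy is contradicted.
  have hnn : ∀ e : Fin 4 → ℝ, 0 ≤ q t e := by
    intro e
    by_contra hlt
    push Not at hlt
    have he0 : e ≠ 0 := by
      rintro rfl
      have := hsmul t 0 0
      simp at this
      linarith
    have hc : ContinuousWithinAt (fun u => q u e) (Set.Icc s b) t :=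
      ContinuousOn.comp (g := fun p : ℝ × (Fin 4 → ℝ) => q p.1 p.2) (f := fun u : ℝ => (u, e))
        hq (by fun_prop) (fun u hu => Set.mk_mem_prod hu (Set.mem_univ _)) t ht
    have hev2 : ∀ᶠ u in nhdsWithin t (Set.Ioo s t), q u e < 0 :=
      (hc.eventually_lt_const hlt).filter_mono
        (nhdsWithin_mono t (Set.Ioo_subset_Icc_self.trans (Set.Icc_subset_Icc_right ht.2)))
    have hne : (nhdsWithin t (Set.Ioo s t)).NeBot := right_nhdsWithin_Ioo_neBot hst
    obtain ⟨u, hu, hu'⟩ := (hev2.and self_mem_nhdsWithin).exists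
    have hle : q u (‖e‖⁻¹ • e) ≤ 0 := by
      rw [hsmul]
      exact mul_nonpos_of_nonneg_of_nonpos (by positivity) hu.le
    have hmem := isMinOn_iff.1 hmin (u, ‖e‖⁻¹ • e)
      (Set.mem_inter (Set.mk_mem_prod ⟨hu'.1.le, hu'.2.le.trans ht.2⟩ (hsphere e he0)) hle)
    exact not_lt.2 hmem hu'.2
  exact he0 (hnd t ht hnn e (le_antisymm hte (hnn e)))

theorem continuousOn_hessForm_update {y : Fin 4 → ℝ} {i : Fin 4} {s : Set ℝ}
    (h : ∀ t ∈ s, ∀ k, 1 < Function.update y i t k) :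
    ContinuousOn (fun p : ℝ × (Fin 4 → ℝ) => hessForm (Function.update y i p.1) p.2 p.2)
      (s ×ˢ Set.univ) := by
  have hupd : Continuous fun p : ℝ × (Fin 4 → ℝ) => (Function.update y i p.1, p.2) := by
    refine Continuous.prodMk ?_ continuous_snd
    exact continuous_const.update i continuous_fst
  have hm : Set.MapsTo (fun p : ℝ × (Fin 4 → ℝ) => (Function.update y i p.1, p.2))
      (s ×ˢ Set.univ) {p | ∀ i, 1 < p.1 i} := by
    rintro ⟨t, e⟩ ⟨ht, -⟩
    exact h t ht
  have := continuousOn_hessForm.comp hupd.continuousOn hm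
  simpa only [Function.comp_def] using this

/-- The Hessian form of a real tetrahedron is positive definite. -/
theorem hessForm_pos {y d : Fin 4 → ℝ} (hy : ∀ i, 1 < y i) (hQ : 0 < disc y) (hd : d ≠ 0) :
    0 < hessForm y d d := by
  by_cases hv : ∀ i, 0 ≤ defect y i
  · exact hessForm_pos_of_defect_nonneg hy hQ hv hd
  push Not at hv
  obtain ⟨i, hi⟩ := hv
  have hsy : ∑ m, y m - y i ≤ y i := by
    simp only [defect] at hi; linarith
  have hs1 : 1 < ∑ m, y m - y i := by
    have h0 := hy (i.succAbove 0)
    have h1 := hy (i.succAbove 1)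
    have h2 := hy (i.succAbove 2)
    rw [Fin.sum_univ_succAbove _ i, Fin.sum_univ_three]
    linarith
  have hyt : ∀ t, ∑ m, y m - y i ≤ t → ∀ k, 1 < Function.update y i t k := by
    intro t ht k
    by_cases hk : k = i
    · subst hk; rw [Function.update_self]; linarith
    · rw [Function.update_of_ne hk]; exact hy k
  -- Only y_i moves, from the sum of the other three coordinates, where all defects are nonnegative,
  -- up to its actual value; disc stays positive on the way.
  have hpath := posDef_of_path (q := fun t e => hessForm (Function.update y i t) e e) hsy
    (continuousOn_hessForm_update fun t ht => hyt t ht.1)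
    (fun t e c => hessForm_smul _ e c)
    (fun e he => hessForm_pos_of_defect_nonneg (hyt _ le_rfl) (disc_update_pos hQ le_rfl hsy)
      (defect_update_nonneg hy hsy) he)
    (fun t ht hn e he => eq_zero_of_hessForm_eq_zero (hyt t ht.1) (disc_update_pos hQ ht.1 ht.2)
      (hessForm_eq_zero_of_nonneg hn he)) hd
  rwa [Function.update_eq_self] at hpath

/-! ### Continuity and derivatives of the angles -/

theorem midAngle_eq {y : Fin 4 → ℝ} (hQ : 0 < disc y) (f : Fin 4) :
    midAngle y f = Real.pi / 2 - Real.arctan (defect y f / √(disc y)) := by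
  have hq : 0 < √(disc y) := Real.sqrt_pos.2 hQ
  rw [midAngle, Real.arccos_eq_pi_div_two_sub_arcsin, Real.arctan_eq_arcsin]
  congr 2
  have h1 : 1 + (defect y f / √(disc y)) ^ 2 = 2 ^ 2 * faceProd y f / disc y := by
    rw [div_pow, Real.sq_sqrt hQ.le]
    field_simp
    linarith [four_mul_faceProd y f]
  rw [h1, Real.sqrt_div' _ hQ.le, Real.sqrt_mul (by norm_num), Real.sqrt_sq (by norm_num)]
  field_simp

theorem cos_midAngle {y : Fin 4 → ℝ} (hQ : 0 < disc y) (f : Fin 4) :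
    Real.cos (midAngle y f) = defect y f / (2 * √(faceProd y f)) := by
  have hA := four_mul_faceProd y f
  have hA0 : 0 < faceProd y f := by nlinarith [sq_nonneg (defect y f)]
  have hle : |defect y f| ≤ 2 * √(faceProd y f) := by
    apply abs_le_of_sq_le_sq _ (by positivity)
    rw [mul_pow, Real.sq_sqrt hA0.le]
    linarith
  have h0 : 0 < 2 * √(faceProd y f) := by positivity
  rw [abs_le] at hle
  exact Real.cos_arccos (by rw [le_div_iff₀ h0]; linarith) (by rw [div_le_iff₀ h0]; linarith)

theorem sin_midAngle {y : Fin 4 → ℝ} (hQ : 0 < disc y) (f : Fin 4) :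
    Real.sin (midAngle y f) = √(disc y) / (2 * √(faceProd y f)) := by
  have hA := four_mul_faceProd y f
  have hA0 : 0 < faceProd y f := by nlinarith [sq_nonneg (defect y f)]
  rw [midAngle, Real.sin_arccos]
  have : 1 - (defect y f / (2 * √(faceProd y f))) ^ 2 = disc y / (2 ^ 2 * faceProd y f) := by
    rw [div_pow, mul_pow, Real.sq_sqrt hA0.le]
    field_simp
    linarith
  rw [this, Real.sqrt_div hQ.le, Real.sqrt_mul (by norm_num), Real.sqrt_sq (by norm_num)]

/-- No sign of disc is needed: faceProd stays away from 0 and `Real.arccos` is continuous on the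
whole line. This is what glues the real and virtual regions. -/
theorem continuousAt_midAngle {y : Fin 4 → ℝ} (hy : ∀ i, 1 < y i) (f : Fin 4) :
    ContinuousAt (fun y => midAngle y f) y := by
  have h := faceProd_pos hy f
  have h' : 0 < √(faceProd y f) := Real.sqrt_pos.2 (by linarith)
  unfold midAngle
  refine Real.continuous_arccos.continuousAt.comp (ContinuousAt.div ?_ ?_ (by positivity))
  · exact (continuous_defect f).continuousAt
  · exact (continuous_const.mul (Real.continuous_sqrt.comp (continuous_faceProd f))).continuousAt

theorem continuousAt_linkArea {y : Fin 4 → ℝ} (hy : ∀ i, 1 < y i) (j : Fin 4) :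
    ContinuousAt (fun y => linkArea y j) y := by
  have := fun f => continuousAt_midAngle hy f
  unfold linkArea
  simp only [Fin.sum_univ_four]
  fun_prop

theorem hasDerivAt_midAngle {y : ℝ → Fin 4 → ℝ} {x : Fin 4 → ℝ} {t : ℝ}
    (hy : ∀ k, HasDerivAt (fun s => y s k) (x k) t) (hQ : 0 < disc (y t)) (f : Fin 4) :
    HasDerivAt (fun s => midAngle (y s) f) (midRate (y t) x f / (4 * √(disc (y t)))) t := by
  have hq : 0 < √(disc (y t)) := Real.sqrt_pos.2 hQ
  have hA := four_mul_faceProd (y t) f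
  have hA0 : 0 < faceProd (y t) f := by nlinarith [sq_nonneg (defect (y t) f)]
  have hv : HasDerivAt (fun s => defect (y s) f) (defect x f) t :=
    (HasDerivAt.fun_sum fun k _ => hy k).sub ((hy f).const_mul 2)
  have hdisc : HasDerivAt (fun s => disc (y s)) (2 * ∑ k, defect (y t) k * x k) t := by
    have h1 : HasDerivAt (fun s => ∑ k, y s k) (∑ k, x k) t := HasDerivAt.fun_sum fun k _ => hy k
    have h2 : HasDerivAt (fun s => ∑ k, y s k ^ 2) (∑ k, 2 * y t k ^ 1 * x k) t :=
      HasDerivAt.fun_sum fun k _ => (hy k).fun_pow 2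
    refine (((h1.fun_pow 2).fun_sub (h2.const_mul 2)).add_const (4 : ℝ)).congr_deriv ?_
    simp only [defect, Fin.sum_univ_four]
    push_cast
    ring
  have hcont : ContinuousAt (fun s => disc (y s)) t := hdisc.continuousAt
  -- The arctangent form, valid where disc > 0, is the one to differentiate.
  have hev : (fun s => midAngle (y s) f) =ᶠ[nhds t]
      fun s => Real.pi / 2 - Real.arctan (defect (y s) f / √(disc (y s))) := by
    filter_upwards [hcont.eventually_const_lt hQ] with s hs using midAngle_eq hs f
  refine HasDerivAt.congr_of_eventuallyEq ?_ hev
  refine (((hv.fun_div (hdisc.sqrt hQ.ne') hq.ne').arctan).const_sub (Real.pi / 2)).congr_deriv ?_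
  have hsq : √(disc (y t)) ^ 2 = disc (y t) := Real.sq_sqrt hQ.le
  simp only [midRate, div_pow, hsq]
  have h1 : 1 + defect (y t) f ^ 2 / disc (y t) = 4 * faceProd (y t) f / disc (y t) := by
    field_simp; linarith
  rw [h1]
  generalize √(disc (y t)) = q at *
  rw [← hsq]
  field_simp
  ring

theorem hasDerivAt_linkArea {y : ℝ → Fin 4 → ℝ} {x : Fin 4 → ℝ} {t : ℝ}
    (hy : ∀ k, HasDerivAt (fun s => y s k) (x k) t) (hQ : 0 < disc (y t)) (j : Fin 4) :
    HasDerivAt (fun s => linkArea (y s) j)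
      (-(∑ f, midRate (y t) x f - midRate (y t) x j) / (2 * √(disc (y t)))) t := by
  have h := fun f => hasDerivAt_midAngle hy hQ f
  have hs : HasDerivAt (fun s => ∑ f, midAngle (y s) f)
      (∑ f, midRate (y t) x f / (4 * √(disc (y t)))) t := HasDerivAt.fun_sum fun f _ => h f
  have hq : 0 < √(disc (y t)) := Real.sqrt_pos.2 hQ
  refine (((hs.fun_sub (h j)).const_mul 2).const_sub (2 * Real.pi)).congr_deriv ?_
  rw [← Finset.sum_div]
  field_simp
  ring

theorem hypCot_gt_one {r : ℝ} (hr : 0 < r) : 1 < hypCot r := by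
  have h := Real.sinh_pos_iff.2 hr
  rw [hypCot, lt_div_iff₀ h]
  have := Real.cosh_sub_sinh r
  have := Real.exp_pos (-r)
  linarith

theorem hasDerivAt_hypCot {r : ℝ} (hr : 0 < r) : HasDerivAt hypCot (-(hypCot r ^ 2 - 1)) r := by
  have h := Real.sinh_pos_iff.2 hr
  unfold hypCot
  refine ((Real.hasDerivAt_cosh r).fun_div (Real.hasDerivAt_sinh r) h.ne').congr_deriv ?_
  field_simp
  ring

theorem hypCot_antitone {r s : ℝ} (hr : 0 < r) (hrs : r ≤ s) : hypCot s ≤ hypCot r := by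
  have h1 := Real.sinh_pos_iff.2 hr
  have h2 := Real.sinh_pos_iff.2 (hr.trans_le hrs)
  rw [hypCot, hypCot, div_le_div_iff₀ h2 h1]
  have := Real.sinh_sub s r
  have := Real.sinh_nonneg_iff.2 (sub_nonneg.2 hrs)
  linarith

theorem one_div_sinh_sq {r : ℝ} (hr : 0 < r) : hypCot r ^ 2 - 1 = 1 / Real.sinh r ^ 2 := by
  have h := Real.sinh_pos_iff.2 hr
  rw [hypCot]
  field_simp
  linarith [Real.cosh_sq r]

/-- The extended solid angle in terms of the radii. -/
noncomputable def ballAngle (r : Fin 4 → ℝ) (j : Fin 4) : ℝ := linkArea (fun k => hypCot (r k)) j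

theorem continuousAt_ballAngle {r : Fin 4 → ℝ} (hr : ∀ i, 0 < r i) (j : Fin 4) :
    ContinuousAt (fun r => ballAngle r j) r := by
  have h : ContinuousAt (fun (r : Fin 4 → ℝ) k => hypCot (r k)) r := by
    refine continuousAt_pi.2 fun k => ?_
    exact ContinuousAt.comp (g := hypCot) (f := fun r : Fin 4 → ℝ => r k)
      (hasDerivAt_hypCot (hr k)).continuousAt (continuous_apply k).continuousAt
  have h' := continuousAt_linkArea (y := fun k => hypCot (r k)) (fun i => hypCot_gt_one (hr i)) j
  have := ContinuousAt.comp (x := r) (f := fun (r : Fin 4 → ℝ) k => hypCot (r k)) h' h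
  simpa only [Function.comp_def, ballAngle] using this

end TetraPacking

/-! ### Barrier arguments on an interval -/

theorem forall_nonpos_of_barrier {ι : Type*} [Finite ι] {g : ℝ → ι → ℝ} {a b : ℝ}
    (hc : ∀ i, ContinuousOn (fun t => g t i) (Set.Icc a b)) (h0 : ∀ i, g a i ≤ 0)
    (hd : ∀ t ∈ Set.Ico a b, (∀ j, g t j ≤ 0) → ∀ i, g t i = 0 →
      ∃ g' < 0, HasDerivWithinAt (fun s => g s i) g' (Set.Ici t) t) :
    ∀ t ∈ Set.Icc a b, ∀ i, g t i ≤ 0 := by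
  have key : Set.Icc a b ⊆ {t | ∀ i, g t i ≤ 0} := by
    refine IsClosed.Icc_subset_of_forall_exists_gt ?_ h0 ?_
    · have : {t | ∀ i, g t i ≤ 0} ∩ Set.Icc a b =
          Set.Icc a b ∩ ⋂ i, Set.Icc a b ∩ (fun t => g t i) ⁻¹' Set.Iic 0 := by
        ext t
        simp only [Set.mem_inter_iff, Set.mem_iInter, Set.mem_preimage, Set.mem_Iic]
        constructor
        · rintro ⟨h, ht⟩
          exact ⟨ht, fun i => ⟨ht, h i⟩⟩
        · rintro ⟨ht, h⟩
          exact ⟨fun i => (h i).2, ht⟩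
      rw [this]
      exact isClosed_Icc.inter (isClosed_iInter fun i =>
        (hc i).preimage_isClosed_of_isClosed isClosed_Icc isClosed_Iic)
    · rintro t ⟨ht, hab⟩ z hz
      -- Components that are negative at t stay so for a short time by continuity; those that vanish
      -- at t become negative because their right derivative is negative.
      have hev : ∀ i, ∀ᶠ u in nhdsWithin t (Set.Ioi t), g u i ≤ 0 := by
        intro i
        rcases lt_or_eq_of_le (ht i) with hlt | heq
        · have h1 : ∀ᶠ u in nhdsWithin t (Set.Icc a b), g u i < 0 :=
            (hc i t ⟨hab.1, hab.2.le⟩).eventually_lt_const hlt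
          have h2 : nhdsWithin t (Set.Ioo t b) ≤ nhdsWithin t (Set.Icc a b) :=
            nhdsWithin_mono t fun u hu => ⟨hab.1.trans hu.1.le, hu.2.le⟩
          rw [nhdsWithin_Ioo_eq_nhdsGT hab.2] at h2
          exact Filter.Eventually.mono (Filter.Eventually.filter_mono h2 h1) fun u hu => le_of_lt hu
        · obtain ⟨g', hg', hder⟩ := hd t hab ht i heq
          have hs := (hasDerivWithinAt_iff_tendsto_slope' (by simp)).1 hder.Ioi_of_Ici
          filter_upwards [hs.eventually_lt_const hg', self_mem_nhdsWithin] with u hu hu'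
          rw [slope_def_field, heq, sub_zero] at hu
          have : 0 < u - t := sub_pos.2 hu'
          by_contra hcon
          push Not at hcon
          exact absurd hu (not_lt.2 (div_nonneg hcon.le this.le))
      have hall := Filter.eventually_all.2 hev
      obtain ⟨u, hu, hu'⟩ := (hall.and (Ioc_mem_nhdsGT hz)).exists
      exact ⟨u, hu, hu'⟩
  exact fun t ht => key ht

/-- A continuous function whose derivative is nonpositive except where its value belongs to a
finite set does not increase. -/
theorem le_of_deriv_nonpos_or_mem_finite {f : ℝ → ℝ} {a b : ℝ} (hab : a < b) {S : Set ℝ}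
    (hS : S.Finite) (hf : ContinuousOn f (Set.Icc a b))
    (hd : ∀ t ∈ Set.Ico a b, f t ∈ S ∨ ∃ f' ≤ 0, HasDerivAt f f' t) : f b ≤ f a := by
  by_contra hlt
  push Not at hlt
  obtain ⟨c, ⟨hc1, hc2⟩, hcS⟩ := ((Set.Ioo_infinite hlt).sdiff hS).nonempty
  obtain ⟨η, hη, hball⟩ := Metric.isOpen_iff.1 (hS.isClosed.isOpen_compl.inter isOpen_Iio) c
    (⟨hcS, hc2⟩ : c ∈ Sᶜ ∩ Set.Iio (f b))
  have hba : 0 < b - a := sub_pos.2 hab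
  -- The line c + k(t - a) starts above f a at a value outside S and rises so slowly that it avoids
  -- S and stays below f b. Where f meets it, the derivative of f is at most 0 < k, so f cannot
  -- cross.
  set k := η / 2 / (b - a) with hk
  have hk0 : 0 < k := by positivity
  have hkb : k * (b - a) = η / 2 := by rw [hk]; field_simp
  have hmem : ∀ t ∈ Set.Icc a b, c + k * (t - a) ∈ Sᶜ ∩ Set.Iio (f b) := by
    intro t ht
    apply hball
    have h1 : 0 ≤ k * (t - a) := mul_nonneg hk0.le (sub_nonneg.2 ht.1)
    have h2 : k * (t - a) ≤ k * (b - a) := by gcongr; exact ht.2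
    rw [Metric.mem_ball, Real.dist_eq, add_sub_cancel_left, abs_of_nonneg h1]
    linarith
  have := forall_nonpos_of_barrier (ι := Unit) (g := fun t _ => f t - (c + k * (t - a)))
    (a := a) (b := b) (fun _ => hf.sub (by fun_prop)) (fun _ => by simp; linarith)
    (fun t ht _ _ h0 => by
      rcases hd t ht with h | ⟨f', hf', hder⟩
      · refine absurd h ?_
        rw [sub_eq_zero.1 h0]
        exact (hmem t ⟨ht.1, ht.2.le⟩).1
      · refine ⟨f' - k, by linarith, ?_⟩
        have h1 : HasDerivAt (fun s => c + k * (s - a)) k t := by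
          simpa using (((hasDerivAt_id t).sub_const a).const_mul k).const_add c
        exact (hder.fun_sub h1).hasDerivWithinAt)
    b ⟨hab.le, le_rfl⟩ ()
  have h2 := (hmem b ⟨hab.le, le_rfl⟩).2
  simp only [Set.mem_Iio] at h2
  linarith

/-! ### Virtual tetrahedra and monotonicity of the angles -/

namespace TetraPacking

/-- The arccosine is clamped at every index: the quotient is at most -1 at k, and disc ≤ 0 together
with nonnegative defects makes it at least 1 at the others. -/
theorem midAngle_of_dominant {y : Fin 4 → ℝ} (hy : ∀ i, 1 < y i) {k : Fin 4}
    (hk : defect y k ≤ -(2 * √(faceProd y k))) :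
    midAngle y k = Real.pi ∧ ∀ j, j ≠ k → midAngle y j = 0 := by
  have hpos : ∀ j, 0 < 2 * √(faceProd y j) := fun j => by
    have := faceProd_pos hy j
    have : 0 < √(faceProd y j) := Real.sqrt_pos.2 (by linarith)
    positivity
  constructor
  · exact Real.arccos_of_le_neg_one (by rw [div_le_iff₀ (hpos k)]; linarith)
  · intro j hj
    have hQ : disc y ≤ 0 := by
      have h1 := four_mul_faceProd y k
      have h2 := hpos k
      have h3 : (2 * √(faceProd y k)) ^ 2 = 4 * faceProd y k := by
        rw [mul_pow, Real.sq_sqrt (by linarith [faceProd_pos hy k])]; norm_num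
      nlinarith
    have hv : 0 ≤ defect y j := by
      have h2 := hpos k
      have h3 : defect y k < 0 := by linarith
      have h4 := Finset.add_sum_erase Finset.univ y (Finset.mem_univ k)
      have h5 := Finset.add_sum_erase (Finset.univ.erase k) y (a := j) (by simp [hj])
      have h6 : 0 ≤ ∑ m ∈ (Finset.univ.erase k).erase j, y m :=
        Finset.sum_nonneg fun m _ => (zero_lt_one.trans (hy m)).le
      simp only [defect] at h3 ⊢
      linarith
    refine Real.arccos_of_one_le ?_
    rw [le_div_iff₀ (hpos j), one_mul]
    refine (le_abs_self _).trans (abs_le_of_sq_le_sq ?_ hv)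
    rw [mul_pow, Real.sq_sqrt (by linarith [faceProd_pos hy j])]
    linarith [four_mul_faceProd y j]

theorem linkArea_of_dominant {y : Fin 4 → ℝ} (hy : ∀ i, 1 < y i) {k : Fin 4}
    (hk : defect y k ≤ -(2 * √(faceProd y k))) :
    linkArea y k = 2 * Real.pi ∧ ∀ j, j ≠ k → linkArea y j = 0 := by
  obtain ⟨h1, h2⟩ := midAngle_of_dominant hy hk
  have hs : ∑ f, midAngle y f = Real.pi := by
    rw [Finset.sum_eq_single k (fun j _ hj => h2 j hj) (by simp), h1]
  refine ⟨by rw [linkArea, hs, h1]; ring, fun j hj => ?_⟩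
  rw [linkArea, hs, h2 j hj]; ring

/-- If disc ≤ 0 then defect² ≥ 4 · faceProd at every index. At a largest y_k the defect cannot be
nonnegative, since then it would be at most each pairwise sum of the other three coordinates, giving
defect² ≤ 2 · faceProd. -/
theorem exists_dominant {y : Fin 4 → ℝ} (hy : ∀ i, 1 < y i) (hQ : disc y ≤ 0) :
    ∃ k, defect y k ≤ -(2 * √(faceProd y k)) ∧ ∀ j, y j ≤ y k := by
  obtain ⟨k, -, hk⟩ := Finset.exists_max_image Finset.univ y Finset.univ_nonempty
  refine ⟨k, ?_, fun j => hk j (Finset.mem_univ j)⟩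
  have hA := four_mul_faceProd y k
  have hA0 := faceProd_pos hy k
  have hsq : (2 * √(faceProd y k)) ^ 2 = 4 * faceProd y k := by
    rw [mul_pow, Real.sq_sqrt (by linarith)]; norm_num
  have hge : (2 * √(faceProd y k)) ^ 2 ≤ defect y k ^ 2 := by linarith
  have hneg : defect y k < 0 := by
    by_contra hcon
    push Not at hcon
    have h0 := hk (k.succAbove 0) (Finset.mem_univ _)
    have h1 := hk (k.succAbove 1) (Finset.mem_univ _)
    have h2 := hk (k.succAbove 2) (Finset.mem_univ _)
    have g0 := hy (k.succAbove 0)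
    have g1 := hy (k.succAbove 1)
    have g2 := hy (k.succAbove 2)
    have hv : defect y k = y (k.succAbove 0) + y (k.succAbove 1) + y (k.succAbove 2) - y k := by
      rw [defect, Fin.sum_univ_succAbove _ k, Fin.sum_univ_three]; ring
    rw [faceProd_eq] at hA hA0
    have hle : defect y k ^ 2 ≤ 2 * (y (k.succAbove 0) * y (k.succAbove 1) +
        y (k.succAbove 1) * y (k.succAbove 2) + y (k.succAbove 2) * y (k.succAbove 0) + 1) := by
      generalize y (k.succAbove 0) = a at *
      generalize y (k.succAbove 1) = b at *
      generalize y (k.succAbove 2) = c at *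
      have e1 : defect y k ≤ a + b := by linarith
      have e2 : defect y k ≤ a + c := by linarith
      have e3 : defect y k ≤ b + c := by linarith
      rcases le_total a b with h | h
      · have := mul_le_mul e1 e2 hcon (by linarith)
        nlinarith
      · have := mul_le_mul e1 e3 hcon (by linarith)
        nlinarith
    linarith
  have := (le_abs_self _).trans (abs_le_of_sq_le_sq (hge.trans_eq (neg_sq _).symm) (by linarith))
  linarith

theorem hasDerivAt_sum_ballAngle {r d : Fin 4 → ℝ} {t : ℝ} (hr : ∀ k, 0 < r k + t * d k)
    (hQ : 0 < disc fun k => hypCot (r k + t * d k)) (e : Fin 4 → ℝ) :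
    HasDerivAt (fun s => ∑ j, ballAngle (fun k => r k + s * d k) j * e j)
      (-(hessForm (fun k => hypCot (r k + t * d k)) d e) /
        (2 * √(disc fun k => hypCot (r k + t * d k)))) t := by
  have hA : ∀ i, faceProd (fun k => hypCot (r k + t * d k)) i ≠ 0 := fun i => by
    have := faceProd_pos (fun k => hypCot_gt_one (hr k)) i
    linarith
  have hy : ∀ k, HasDerivAt (fun s => hypCot (r k + s * d k))
      (cothRate (fun k => hypCot (r k + t * d k)) d k) t := by
    intro k
    have h1 : HasDerivAt (fun s => r k + s * d k) (d k) t := by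
      simpa using ((hasDerivAt_id t).mul_const (d k)).const_add (r k)
    exact (hasDerivAt_hypCot (hr k)).comp t h1
  have h := fun j => (hasDerivAt_linkArea (y := fun s k => hypCot (r k + s * d k)) hy hQ j).mul_const
    (e j)
  refine (HasDerivAt.fun_sum fun j _ => h j).congr_deriv ?_
  rw [← sum_midRate _ _ _ hA]
  simp only [Fin.sum_univ_four]
  ring

theorem continuousAt_sum_ballAngle {r d : Fin 4 → ℝ} {t : ℝ} (hr : ∀ k, 0 < r k + t * d k)
    (e : Fin 4 → ℝ) :
    ContinuousAt (fun s => ∑ j, ballAngle (fun k => r k + s * d k) j * e j) t := by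
  refine tendsto_finsetSum _ fun j _ => ?_
  refine Filter.Tendsto.mul_const (e j) ?_
  have h1 : ContinuousAt (fun s k => r k + s * d k) t := by fun_prop
  have h2 := continuousAt_ballAngle (r := fun k => r k + t * d k) hr j
  have := ContinuousAt.comp (x := t) (f := fun s k => r k + s * d k) h2 h1
  exact this

/-- Along the segment from r to s the pairing of the angles with d = s - r is nonincreasing: its
derivative is -hessForm/(2√Q) where Q > 0, and elsewhere its value is 2π d_k for the dominant k. How
the segment meets the virtual region need not be known. -/
theorem sum_ballAngle_antitone {r s : Fin 4 → ℝ} (hr : ∀ i, 0 < r i) (hs : ∀ i, 0 < s i) :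
    ∑ j, (ballAngle s j - ballAngle r j) * (s j - r j) ≤ 0 := by
  set d : Fin 4 → ℝ := fun k => s k - r k with hd
  have hpos : ∀ t ∈ Set.Icc (0 : ℝ) 1, ∀ k, 0 < r k + t * d k := by
    intro t ht k
    have : r k + t * d k = (1 - t) * r k + t * s k := by simp only [hd]; ring
    rw [this]
    rcases eq_or_lt_of_le ht.1 with h | h
    · subst h; simpa using hr k
    · have := mul_pos h (hs k)
      have := mul_nonneg (sub_nonneg.2 ht.2) (hr k).le
      linarith
  have key := le_of_deriv_nonpos_or_mem_finite (a := 0) (b := 1)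
    (f := fun t => ∑ j, ballAngle (fun k => r k + t * d k) j * d j)
    one_pos (Set.finite_range fun k => 2 * Real.pi * d k)
    (fun t ht => (continuousAt_sum_ballAngle (hpos t ht) d).continuousWithinAt)
    (fun t ht => by
      have hp := hpos t ⟨ht.1, ht.2.le⟩
      have hy : ∀ k, 1 < hypCot (r k + t * d k) := fun k => hypCot_gt_one (hp k)
      rcases le_or_gt (disc fun k => hypCot (r k + t * d k)) 0 with hQ | hQ
      · left
        obtain ⟨k, hk, -⟩ := exists_dominant hy hQ
        obtain ⟨h1, h2⟩ := linkArea_of_dominant hy hk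
        refine ⟨k, ?_⟩
        simp only [ballAngle]
        rw [Finset.sum_eq_single k (fun j _ hj => by rw [h2 j hj, zero_mul]) (by simp), h1]
      · right
        refine ⟨_, ?_, hasDerivAt_sum_ballAngle hp hQ d⟩
        refine div_nonpos_of_nonpos_of_nonneg (neg_nonpos.2 ?_) (by positivity)
        by_cases hd0 : d = 0
        · simp [hd0, hessForm, edgeForm]
        · exact (hessForm_pos hy hQ hd0).le)
  simp only [hd, zero_mul, add_zero, one_mul, add_sub_cancel] at key
  simp only [sub_mul, Finset.sum_sub_distrib] at key ⊢
  linarith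

theorem disc_continuousAt_radii {r : Fin 4 → ℝ} (hr : ∀ i, 0 < r i) :
    ContinuousAt (fun (r : Fin 4 → ℝ) => disc fun k => hypCot (r k)) r := by
  have h : ContinuousAt (fun (r : Fin 4 → ℝ) k => hypCot (r k)) r := by
    refine continuousAt_pi.2 fun k => ?_
    exact ContinuousAt.comp (g := hypCot) (f := fun r : Fin 4 → ℝ => r k)
      (hasDerivAt_hypCot (hr k)).continuousAt (continuous_apply k).continuousAt
  exact ContinuousAt.comp (x := r) (f := fun (r : Fin 4 → ℝ) k => hypCot (r k))
    continuous_disc.continuousAt h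

/-- Uniform negativity of the derivative of the angles near a real tetrahedron. -/
theorem exists_hessForm_lower_bound {r : Fin 4 → ℝ} (hr : ∀ i, 0 < r i)
    (hQ : 0 < disc fun k => hypCot (r k)) :
    ∃ δ > 0, ∃ c > 0, ∀ s ∈ Metric.closedBall r δ, (∀ i, 0 < s i) ∧
      0 < disc (fun k => hypCot (s k)) ∧ ∀ d : Fin 4 → ℝ, ‖d‖ = 1 →
        c ≤ hessForm (fun k => hypCot (s k)) d d / (2 * √(disc fun k => hypCot (s k))) := by
  have hev : ∀ᶠ s in nhds r, (∀ i, 0 < s i) ∧ 0 < disc (fun k => hypCot (s k)) :=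
    (Filter.eventually_all.2 fun i =>
      (continuous_apply i).continuousAt.eventually_const_lt (hr i)).and
      ((disc_continuousAt_radii hr).eventually_const_lt hQ)
  obtain ⟨δ, hδ, hball⟩ := Metric.nhds_basis_closedBall.eventually_iff.1 hev
  have hK : IsCompact (Metric.closedBall r δ ×ˢ Metric.sphere (0 : Fin 4 → ℝ) 1) :=
    (isCompact_closedBall r δ).prod (isCompact_sphere 0 1)
  have hne : (Metric.closedBall r δ ×ˢ Metric.sphere (0 : Fin 4 → ℝ) 1).Nonempty :=
    (Metric.nonempty_closedBall.2 hδ.le).prod (NormedSpace.sphere_nonempty.2 zero_le_one)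
  have hcot : ContinuousOn (fun p : (Fin 4 → ℝ) × (Fin 4 → ℝ) => ((fun k => hypCot (p.1 k)), p.2))
      (Metric.closedBall r δ ×ˢ Metric.sphere (0 : Fin 4 → ℝ) 1) := by
    refine ContinuousOn.prodMk (continuousOn_pi.2 fun k => ?_) continuousOn_snd
    intro p hp
    refine ContinuousAt.continuousWithinAt ?_
    exact ContinuousAt.comp (g := hypCot) (f := fun p : (Fin 4 → ℝ) × (Fin 4 → ℝ) => p.1 k)
      (hasDerivAt_hypCot ((hball hp.1).1 k)).continuousAt (by fun_prop)
  have hmaps : Set.MapsTo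
      (fun p : (Fin 4 → ℝ) × (Fin 4 → ℝ) => ((fun k => hypCot (p.1 k)), p.2))
      (Metric.closedBall r δ ×ˢ Metric.sphere (0 : Fin 4 → ℝ) 1) {p | ∀ i, 1 < p.1 i} :=
    fun p hp k => hypCot_gt_one ((hball hp.1).1 k)
  have h1 := continuousOn_hessForm.comp hcot hmaps
  have h2 : ContinuousOn (fun p : (Fin 4 → ℝ) × (Fin 4 → ℝ) =>
      2 * √(disc fun k => hypCot (p.1 k)))
      (Metric.closedBall r δ ×ˢ Metric.sphere (0 : Fin 4 → ℝ) 1) := by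
    refine continuousOn_const.mul (Real.continuous_sqrt.comp_continuousOn ?_)
    intro p hp
    exact (ContinuousAt.comp (g := fun r : Fin 4 → ℝ => disc fun k => hypCot (r k))
      (f := Prod.fst) (disc_continuousAt_radii (hball hp.1).1)
      continuousAt_fst).continuousWithinAt
  have h3 := h1.div h2 fun p hp => by
    have := Real.sqrt_pos.2 (hball hp.1).2
    positivity
  obtain ⟨⟨s, d⟩, ⟨hs, hd⟩, hmin⟩ := hK.exists_isMinOn hne h3
  have hd0 : d ≠ 0 := by
    rintro rfl
    simp at hd
  have hpos : 0 < hessForm (fun k => hypCot (s k)) d d / (2 * √(disc fun k => hypCot (s k))) :=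
    div_pos (hessForm_pos (fun k => hypCot_gt_one ((hball hs).1 k)) (hball hs).2 hd0)
      (mul_pos two_pos (Real.sqrt_pos.2 (hball hs).2))
  refine ⟨δ, hδ, _, hpos, fun s' hs' => ⟨(hball hs').1, (hball hs').2, fun d' hd' => ?_⟩⟩
  exact isMinOn_iff.1 hmin (s', d') (Set.mk_mem_prod hs' (by simpa using hd'))

/-- Moving from r along a unit vector, the pairing drops at rate at least c up to distance δ, and
never rises afterwards. -/
theorem sum_ballAngle_strict {r : Fin 4 → ℝ} (hr : ∀ i, 0 < r i)
    (hQ : 0 < disc fun k => hypCot (r k)) {D : ℝ} (hD : 0 < D) :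
    ∃ c > 0, ∀ s : Fin 4 → ℝ, (∀ i, 0 < s i) → ‖s - r‖ ≤ D →
      ∑ j, (ballAngle s j - ballAngle r j) * (s j - r j) ≤ -c * ‖s - r‖ ^ 2 := by
  obtain ⟨δ, hδ, c, hc, hbd⟩ := exists_hessForm_lower_bound hr hQ
  have hray : ∀ d : Fin 4 → ℝ, ‖d‖ = 1 → ∀ t ∈ Set.Icc 0 δ,
      ∑ j, ballAngle (fun k => r k + t * d k) j * d j - ∑ j, ballAngle r j * d j ≤ -c * t := by
    intro d hd t ht
    have hmem : ∀ u ∈ Set.Icc 0 δ, (fun k => r k + u * d k) ∈ Metric.closedBall r δ := by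
      intro u hu
      have : (fun k => r k + u * d k) = r + u • d := rfl
      rw [this, Metric.mem_closedBall, dist_eq_norm, add_sub_cancel_left, norm_smul, hd, mul_one,
        Real.norm_of_nonneg hu.1]
      exact hu.2
    have hderiv : ∀ u ∈ Set.Icc 0 δ, HasDerivAt
        (fun s => ∑ j, ballAngle (fun k => r k + s * d k) j * d j) _ u := fun u hu =>
      hasDerivAt_sum_ballAngle (hbd _ (hmem u hu)).1 (hbd _ (hmem u hu)).2.1 d
    have := Convex.image_sub_le_mul_sub_of_deriv_le (convex_Icc 0 δ)
      (f := fun s => ∑ j, ballAngle (fun k => r k + s * d k) j * d j) (C := -c)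
      (fun u hu => (hderiv u hu).continuousAt.continuousWithinAt)
      (fun u hu => (hderiv u (interior_subset hu)).differentiableAt.differentiableWithinAt)
      (fun u hu => by
        rw [(hderiv u (interior_subset hu)).deriv, neg_div]
        exact neg_le_neg ((hbd _ (hmem u (interior_subset hu))).2.2 d hd))
      0 ⟨le_rfl, hδ.le⟩ t ht ht.1
    simpa using this
  -- Beyond distance δ the total drop is at least cδ, which is at least (cδ/D) ‖s - r‖ as long as ‖s
  -- - r‖ ≤ D.
  refine ⟨min c (c * δ / D), lt_min hc (by positivity), fun s hs hsD => ?_⟩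
  rcases eq_or_ne s r with rfl | hsr
  · simp
  set ρ := ‖s - r‖ with hρ
  have hρ0 : 0 < ρ := norm_pos_iff.2 (sub_ne_zero.2 hsr)
  set d : Fin 4 → ℝ := ρ⁻¹ • (s - r) with hd
  have hd1 : ‖d‖ = 1 := by
    rw [hd, norm_smul, ← hρ, norm_inv, Real.norm_of_nonneg hρ0.le, inv_mul_cancel₀ hρ0.ne']
  have hsd : ∀ k, s k = r k + ρ * d k := by
    intro k
    simp only [hd, Pi.smul_apply, Pi.sub_apply, smul_eq_mul]
    field_simp
    ring
  have hmain : ∑ j, (ballAngle s j - ballAngle r j) * (s j - r j) =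
      ρ * (∑ j, ballAngle s j * d j - ∑ j, ballAngle r j * d j) := by
    rw [← Finset.sum_sub_distrib, Finset.mul_sum]
    refine Finset.sum_congr rfl fun j _ => ?_
    rw [hsd j]; ring
  have hs' : s = fun k => r k + ρ * d k := funext hsd
  have hkey : ∑ j, ballAngle s j * d j - ∑ j, ballAngle r j * d j ≤
      -(min c (c * δ / D)) * ρ := by
    rcases le_total ρ δ with h | h
    · have := hray d hd1 ρ ⟨hρ0.le, h⟩
      rw [← hs'] at this
      have h2 : min c (c * δ / D) * ρ ≤ c * ρ := by gcongr; exact min_le_left _ _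
      linarith
    · have h1 := hray d hd1 δ ⟨hδ.le, le_rfl⟩
      have hpos : ∀ i, 0 < r i + δ * d i := by
        refine (hbd (fun k => r k + δ * d k) ?_).1
        have : (fun k => r k + δ * d k) = r + δ • d := rfl
        rw [this, Metric.mem_closedBall, dist_eq_norm, add_sub_cancel_left, norm_smul, hd1,
          mul_one, Real.norm_of_nonneg hδ.le]
      have h2 : ∑ j, ballAngle s j * d j ≤ ∑ j, ballAngle (fun k => r k + δ * d k) j * d j := by
        rcases eq_or_lt_of_le h with heq | hlt
        · rw [heq, ← hs']
        have hm := sum_ballAngle_antitone hpos hs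
        have hm2 : ∑ j, (ballAngle s j - ballAngle (fun k => r k + δ * d k) j) *
            (s j - (r j + δ * d j)) = (ρ - δ) * (∑ j, ballAngle s j * d j -
              ∑ j, ballAngle (fun k => r k + δ * d k) j * d j) := by
          rw [← Finset.sum_sub_distrib, Finset.mul_sum]
          refine Finset.sum_congr rfl fun j _ => ?_
          linear_combination
            (ballAngle s j - ballAngle (fun k => r k + δ * d k) j) * hsd j
        rw [hm2] at hm
        have := nonpos_of_mul_nonpos_right hm (sub_pos.2 hlt)
        linarith
      have h3 : min c (c * δ / D) * ρ ≤ c * δ := by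
        calc min c (c * δ / D) * ρ ≤ c * δ / D * D := by
              gcongr
              exact min_le_right _ _
          _ = c * δ := by field_simp
      linarith
  rw [hmain]
  calc _ ≤ ρ * (-(min c (c * δ / D)) * ρ) := by gcongr
    _ = _ := by ring

/-! ### Small angles at large balls -/

theorem cos_half_linkArea {y : Fin 4 → ℝ} (hQ : 0 < disc y) (i : Fin 4) :
    Real.cos (linkArea y i / 2) =
      (8 * ((y i + y (i.succAbove 0)) * (y i + y (i.succAbove 1)) * (y i + y (i.succAbove 2))) -
        4 * (y i ^ 2 - 1) * (3 * y i + y (i.succAbove 0) + y (i.succAbove 1) +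
          y (i.succAbove 2))) /
      (8 * (√(faceProd y (i.succAbove 0)) * √(faceProd y (i.succAbove 1)) *
        √(faceProd y (i.succAbove 2)))) := by
  have h : linkArea y i / 2 = Real.pi - (midAngle y (i.succAbove 0) + midAngle y (i.succAbove 1) +
      midAngle y (i.succAbove 2)) := by
    rw [linkArea, Fin.sum_univ_succAbove _ i, Fin.sum_univ_three]; ring
  have hsq : √(disc y) ^ 2 = disc y := Real.sq_sqrt hQ.le
  have hs : ∀ f, 0 < √(faceProd y f) := fun f => Real.sqrt_pos.2 (by
    have := four_mul_faceProd y f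
    nlinarith [sq_nonneg (defect y f)])
  have h0 := hs (i.succAbove 0)
  have h1 := hs (i.succAbove 1)
  have h2 := hs (i.succAbove 2)
  rw [h, Real.cos_pi_sub, Real.cos_add, Real.cos_add, Real.sin_add]
  simp only [cos_midAngle hQ, sin_midAngle hQ]
  -- Only even powers of √disc occur in the expanded cosine of the sum of the three angles, so the
  -- numerator is a polynomial in y.
  have hnum : disc y * (defect y (i.succAbove 0) + defect y (i.succAbove 1) +
      defect y (i.succAbove 2)) - defect y (i.succAbove 0) * defect y (i.succAbove 1) *
      defect y (i.succAbove 2) =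
      8 * ((y i + y (i.succAbove 0)) * (y i + y (i.succAbove 1)) * (y i + y (i.succAbove 2))) -
        4 * (y i ^ 2 - 1) * (3 * y i + y (i.succAbove 0) + y (i.succAbove 1) +
          y (i.succAbove 2)) := by
    simp only [defect, disc, Fin.sum_univ_succAbove _ i, Fin.sum_univ_three]
    ring
  rw [← hnum]
  generalize √(disc y) = q at *
  rw [← hsq]
  field_simp
  ring

theorem faceProd_add (y : Fin 4 → ℝ) (i : Fin 4) :
    faceProd y (i.succAbove 0) + (y i ^ 2 - 1) =
        (y i + y (i.succAbove 1)) * (y i + y (i.succAbove 2)) ∧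
      faceProd y (i.succAbove 1) + (y i ^ 2 - 1) =
        (y i + y (i.succAbove 0)) * (y i + y (i.succAbove 2)) ∧
      faceProd y (i.succAbove 2) + (y i ^ 2 - 1) =
        (y i + y (i.succAbove 0)) * (y i + y (i.succAbove 1)) := by
  simp only [faceProd, defect, disc, Fin.sum_univ_succAbove _ i, Fin.sum_univ_three]
  refine ⟨?_, ?_, ?_⟩ <;> ring

/-- With w = y_i² - 1 and a, b, c the sums of y_i with the other coordinates, each relevant faceProd
plus w is a product of two of a, b, c, so the root in the denominator is at most abc. As a, b, c >
2, also a + b + c ≤ (3/4) abc. The bound 8/3 keeps 8 - 3w nonnegative. -/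
theorem cos_half_linkArea_ge {y : Fin 4 → ℝ} (hy : ∀ i, 1 < y i) (hQ : 0 < disc y) {i : Fin 4}
    (hw : y i ^ 2 - 1 ≤ 8 / 3) :
    1 - 3 / 8 * (y i ^ 2 - 1) ≤ Real.cos (linkArea y i / 2) := by
  rw [cos_half_linkArea hQ]
  obtain ⟨e0, e1, e2⟩ := faceProd_add y i
  have p0 := faceProd_pos hy (i.succAbove 0)
  have p1 := faceProd_pos hy (i.succAbove 1)
  have p2 := faceProd_pos hy (i.succAbove 2)
  have hi := hy i
  have g0 := hy (i.succAbove 0)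
  have g1 := hy (i.succAbove 1)
  have g2 := hy (i.succAbove 2)
  have hw0 : 0 < y i ^ 2 - 1 := by nlinarith
  generalize faceProd y (i.succAbove 0) = A0 at *
  generalize faceProd y (i.succAbove 1) = A1 at *
  generalize faceProd y (i.succAbove 2) = A2 at *
  rw [← Real.sqrt_mul (by linarith), ← Real.sqrt_mul (by positivity)]
  have hA : 0 < A0 * A1 * A2 := by
    have : 0 < A0 * A1 := mul_pos (by linarith) (by linarith)
    exact mul_pos this (by linarith)
  obtain ⟨a, ha⟩ : ∃ a, a = y i + y (i.succAbove 0) := ⟨_, rfl⟩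
  obtain ⟨b, hb⟩ : ∃ b, b = y i + y (i.succAbove 1) := ⟨_, rfl⟩
  obtain ⟨c, hc⟩ : ∃ c, c = y i + y (i.succAbove 2) := ⟨_, rfl⟩
  have hsum : 3 * y i + y (i.succAbove 0) + y (i.succAbove 1) + y (i.succAbove 2) = a + b + c := by
    rw [ha, hb, hc]; ring
  rw [hsum]
  rw [← hb, ← hc] at e0
  rw [← ha, ← hc] at e1
  rw [← ha, ← hb] at e2
  rw [← ha, ← hb, ← hc]
  have ha2 : 2 < a := by linarith
  have hb2 : 2 < b := by linarith
  have hc2 : 2 < c := by linarith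
  generalize y i ^ 2 - 1 = w at *
  have hab : 4 < a * b := by nlinarith
  have hac : 4 < a * c := by nlinarith
  have hbc : 4 < b * c := by nlinarith
  have hP : √(A0 * A1 * A2) ≤ a * b * c := by
    apply Real.sqrt_le_iff.2 ⟨by positivity, ?_⟩
    have : (a * b * c) ^ 2 = (A0 + w) * (A1 + w) * (A2 + w) := by rw [e0, e1, e2]; ring
    rw [this]
    have : A0 * A1 ≤ (A0 + w) * (A1 + w) := by
      apply mul_le_mul <;> linarith
    apply mul_le_mul this <;> first | linarith | positivity
  have hs : 0 < √(A0 * A1 * A2) := Real.sqrt_pos.2 hA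
  rw [le_div_iff₀ (by positivity)]
  have h3 : a + b + c ≤ 3 / 4 * (a * b * c) := by nlinarith
  have h4 : (8 - 3 * w) * √(A0 * A1 * A2) ≤ (8 - 3 * w) * (a * b * c) :=
    mul_le_mul_of_nonneg_left hP (by linarith)
  have h5 := mul_le_mul_of_nonneg_left h3 hw0.le
  linarith

/-- The extended solid angle at a large ball is small. -/
theorem exists_ballAngle_le {ε : ℝ} (hε : 0 < ε) :
    ∃ R > 0, ∀ r : Fin 4 → ℝ, (∀ i, 0 < r i) → ∀ i, R ≤ r i → ballAngle r i ≤ ε := by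
  set ε' := min (ε / 2) Real.pi with hε'
  have hε0 : 0 < ε' := lt_min (by linarith) Real.pi_pos
  have hcos : Real.cos ε' < 1 := by
    have := Real.cos_lt_cos_of_nonneg_of_le_pi le_rfl (min_le_right _ _) hε0
    rwa [Real.cos_zero] at this
  -- Chosen so that 1 - (3/8) η ≥ cos ε', with η ≤ 8/3.
  set η := min (8 / 3 * (1 - Real.cos ε')) (8 / 3) with hη
  have hη0 : 0 < η := lt_min (by linarith) (by norm_num)
  refine ⟨1 / √η, by positivity, fun r hr i hi => ?_⟩
  have hy : ∀ k, 1 < hypCot (r k) := fun k => hypCot_gt_one (hr k)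
  have hw : hypCot (r i) ^ 2 - 1 ≤ η := by
    rw [one_div_sinh_sq (hr i)]
    have h1 : 1 / √η ≤ Real.sinh (r i) := hi.trans (Real.self_le_sinh_iff.2 (hr i).le)
    have h2 : (1 / √η) ^ 2 ≤ Real.sinh (r i) ^ 2 := by gcongr
    rw [div_pow, Real.sq_sqrt hη0.le, one_pow] at h2
    rw [div_le_iff₀ (by have := Real.sinh_pos_iff.2 (hr i); positivity)]
    rw [div_le_iff₀ hη0] at h2
    linarith
  have hw1 := hw.trans (min_le_left _ _)
  have hw2 := hw.trans (min_le_right _ _)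
  rcases le_or_gt (disc fun k => hypCot (r k)) 0 with hQ | hQ
  · obtain ⟨k, hk, -⟩ := exists_dominant hy hQ
    -- A dominant index needs y_i larger than the sum of three numbers exceeding 1, but y_i² ≤ 11/3.
    have hki : i ≠ k := by
      rintro rfl
      have h0 : defect (fun k => hypCot (r k)) i < 0 := by
        have := faceProd_pos hy i
        have : 0 < √(faceProd (fun k => hypCot (r k)) i) := Real.sqrt_pos.2 (by linarith)
        linarith
      rw [defect, Fin.sum_univ_succAbove _ i, Fin.sum_univ_three] at h0
      have g0 := hy (i.succAbove 0)
      have g1 := hy (i.succAbove 1)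
      have g2 := hy (i.succAbove 2)
      nlinarith
    rw [ballAngle, (linkArea_of_dominant hy hk).2 i hki]
    exact hε.le
  · have hc := cos_half_linkArea_ge hy hQ hw2
    have hle : linkArea (fun k => hypCot (r k)) i / 2 ≤ Real.pi := by
      have : 0 ≤ ∑ f, midAngle (fun k => hypCot (r k)) f - midAngle (fun k => hypCot (r k)) i := by
        rw [sub_nonneg]
        exact Finset.single_le_sum (f := midAngle fun k => hypCot (r k))
          (fun f _ => Real.arccos_nonneg _) (Finset.mem_univ i)
      rw [linkArea]
      linarith
    by_contra hcon
    push Not at hcon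
    have h1 : ε' < linkArea (fun k => hypCot (r k)) i / 2 := by
      have := min_le_left (ε / 2) Real.pi
      rw [ballAngle] at hcon
      linarith
    have h2 := Real.cos_lt_cos_of_nonneg_of_le_pi hε0.le hle h1
    linarith

/-! ### Large angles at small balls -/

theorem edgeCoeff_nonneg_of_le {y : Fin 4 → ℝ} (hy : ∀ i, 1 < y i) {i k j l : Fin 4}
    (h : Function.Injective ![i, k, j, l]) (hj : y j ≤ y i) (hl : y l ≤ y i) :
    0 ≤ edgeCoeff y j l := by
  have h1 := faceProd_pos hy j
  have h2 := faceProd_pos hy l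
  refine div_nonneg ?_ (by positivity)
  set p := Equiv.ofBijective _ (Finite.injective_iff_bijective.1 h) with hp
  have hS : ∑ m, y m = y i + y k + y j + y l := by
    rw [← Equiv.sum_comp p, Fin.sum_univ_four]; rfl
  have hQ : ∑ m, y m ^ 2 = y i ^ 2 + y k ^ 2 + y j ^ 2 + y l ^ 2 := by
    rw [← Equiv.sum_comp p, Fin.sum_univ_four]; rfl
  simp only [disc, defect, hS, hQ]
  have g0 := hy i
  have g1 := hy k
  have g2 := hy j
  have g3 := hy l
  -- The numerator is 4 y_i y_k + 2 (y_i + y_k)(y_j + y_l) - 2 (y_j - y_l)² + 4, and y_i (y_j + y_l)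
  -- ≥ y_j² + y_l².
  nlinarith [mul_nonneg (sub_nonneg.2 hj) (by linarith : 0 ≤ y j + y l),
    mul_nonneg (sub_nonneg.2 hl) (by linarith : 0 ≤ y j + y l), mul_pos (zero_lt_one.trans g0)
    (zero_lt_one.trans g1), mul_pos (zero_lt_one.trans g2) (zero_lt_one.trans g3),
    mul_pos (zero_lt_one.trans g1) (add_pos (zero_lt_one.trans g2) (zero_lt_one.trans g3))]

/-- Since d_i = 0, only the mixed terms at i survive, and their edge weights are nonnegative because
y_i is maximal. Geometrically, the angle at the smallest ball grows when the other balls grow. -/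
theorem hessForm_single_nonpos {y d : Fin 4 → ℝ} (hy : ∀ i, 1 < y i) {i : Fin 4}
    (hi : ∀ j, y j ≤ y i) (hd : ∀ j, 0 ≤ d j) (hdi : d i = 0) :
    hessForm y d (Pi.single i 1) ≤ 0 := by
  have hw : ∀ k, 0 ≤ y k ^ 2 - 1 := fun k => by nlinarith [hy k]
  have key : ∀ k j l, Function.Injective ![i, k, j, l] →
      0 ≤ edgeCoeff y j l * ((y i ^ 2 - 1) * (y k ^ 2 - 1) * d k) := fun k j l h =>
    mul_nonneg (edgeCoeff_nonneg_of_le hy h (hi j) (hi l))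
      (mul_nonneg (mul_nonneg (hw i) (hw k)) (hd k))
  fin_cases i
  · have h1 := key 1 2 3 (by decide)
    have h2 := key 2 1 3 (by decide)
    have h3 := key 3 1 2 (by decide)
    simp [hessForm, edgeForm] at hdi h1 h2 h3 ⊢
    rw [hdi]
    linarith
  · have h1 := key 0 2 3 (by decide)
    have h2 := key 2 0 3 (by decide)
    have h3 := key 3 0 2 (by decide)
    simp [hessForm, edgeForm] at hdi h1 h2 h3 ⊢
    rw [hdi]
    linarith
  · have h1 := key 0 1 3 (by decide)
    have h2 := key 1 0 3 (by decide)
    have h3 := key 3 0 1 (by decide)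
    simp [hessForm, edgeForm] at hdi h1 h2 h3 ⊢
    rw [hdi]
    linarith
  · have h1 := key 0 1 2 (by decide)
    have h2 := key 1 0 2 (by decide)
    have h3 := key 2 0 1 (by decide)
    simp [hessForm, edgeForm] at hdi h1 h2 h3 ⊢
    rw [hdi]
    linarith

/-- The extended solid angle at the smallest ball is at least that of the regular tetrahedron. -/
theorem linkArea_const_le {y : Fin 4 → ℝ} (hy : ∀ i, 1 < y i) {i : Fin 4}
    (hi : ∀ j, y j ≤ y i) : linkArea (fun _ => y i) i ≤ linkArea y i := by
  set p : ℝ → Fin 4 → ℝ := fun t k => y i + t * (y k - y i) with hp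
  have hbd : ∀ t ∈ Set.Icc (0 : ℝ) 1, ∀ k, y k ≤ p t k ∧ p t k ≤ y i := by
    intro t ht k
    have h1 : 0 ≤ y i - y k := sub_nonneg.2 (hi k)
    have h2 := mul_nonneg ht.1 h1
    have h3 := mul_nonneg (sub_nonneg.2 ht.2) h1
    simp only [hp]
    constructor <;> linarith
  have hpi : ∀ t, p t i = y i := fun t => by simp [hp]
  have hgt : ∀ t ∈ Set.Icc (0 : ℝ) 1, ∀ k, 1 < p t k := fun t ht k =>
    (hy k).trans_le (hbd t ht k).1
  have hder : ∀ t k, HasDerivAt (fun s => p s k) (y k - y i) t := fun t k => by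
    have := ((hasDerivAt_id t).mul_const (y k - y i)).const_add (y i)
    rw [one_mul] at this
    exact this
  -- On virtual stretches of the path the angle is 0 or 2π, hence the exceptional set.
  have key := le_of_deriv_nonpos_or_mem_finite (a := 0) (b := 1) (f := fun t => -linkArea (p t) i)
    one_pos (S := {0, -(2 * Real.pi)}) (by simp)
    (fun t ht => by
      have h1 : ContinuousAt p t := continuousAt_pi.2 fun k => (hder t k).continuousAt
      exact (ContinuousAt.comp (x := t) (f := p) (continuousAt_linkArea (hgt t ht) i)
        h1).neg.continuousWithinAt)
    (fun t ht => by
      have hgt := hgt t ⟨ht.1, ht.2.le⟩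
      rcases le_or_gt (disc (p t)) 0 with hQ | hQ
      · left
        obtain ⟨k, hk, -⟩ := exists_dominant hgt hQ
        obtain ⟨h1, h2⟩ := linkArea_of_dominant hgt hk
        by_cases hik : i = k
        · subst hik; simp [h1]
        · simp [h2 i hik]
      · right
        have hA : ∀ i, faceProd (p t) i ≠ 0 := fun i => by
          have := faceProd_pos hgt i
          linarith
        have hwk : ∀ k, 0 < p t k ^ 2 - 1 := fun k => by nlinarith [hgt k]
        -- Lowering y_k below y_i is an increase of the radius r_k, by the nonnegative rate d_k
        -- displayed here.
        have hx : (fun k => y k - y i) =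
            cothRate (p t) (fun k => (y i - y k) / (p t k ^ 2 - 1)) := by
          funext k
          have := (hwk k).ne'
          rw [cothRate]
          field_simp
          ring
        refine ⟨_, ?_, (hasDerivAt_linkArea (hder t) hQ i).neg⟩
        have hs := sum_midRate (p t) (fun k => (y i - y k) / (p t k ^ 2 - 1)) (Pi.single i 1) hA
        rw [← hx] at hs
        have hs2 : ∑ f, midRate (p t) (fun k => y k - y i) f *
            (∑ m, (Pi.single i 1 : Fin 4 → ℝ) m - (Pi.single i 1 : Fin 4 → ℝ) f) =
            ∑ f, midRate (p t) (fun k => y k - y i) f - midRate (p t) (fun k => y k - y i) i := by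
          simp [mul_sub, Pi.single_apply, Finset.sum_sub_distrib]
        rw [← hs2, hs, neg_div, neg_neg]
        refine div_nonpos_of_nonpos_of_nonneg (hessForm_single_nonpos hgt ?_ ?_ ?_) (by positivity)
        · intro j
          rw [hpi]
          exact (hbd t ⟨ht.1, ht.2.le⟩ j).2
        · exact fun j => div_nonneg (sub_nonneg.2 (hi j)) (hwk j).le
        · simp)
  have h1 : p 1 = y := by funext k; simp [hp]
  have h0 : p 0 = fun _ => y i := by funext k; simp [hp]
  simp only [h1, h0] at key
  linarith

/-- When all y are equal to Y, the angle is 2π - 6ψ with cos ψ = Y/√(3Y² + 1), which tends to 1/√3.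
It exceeds 4π/23 iff ψ < 7π/23, so the limit case requires exactly this inequality. The margin is
small; it amounts to sin(5π/46) > 1/3. -/
theorem cos_sq_lt_third : Real.cos (7 * Real.pi / 23) ^ 2 < 1 / 3 := by
  have h1 : Real.cos (7 * Real.pi / 23) ^ 2 = 1 / 2 - Real.sin (5 * Real.pi / 46) / 2 := by
    rw [Real.cos_sq, show 2 * (7 * Real.pi / 23) = 5 * Real.pi / 46 + Real.pi / 2 by ring,
      Real.cos_add_pi_div_two]
    ring
  have h2 : 1 / 3 < Real.sin (5 * Real.pi / 46) := by
    have hl := Real.pi_gt_d4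
    have hu := Real.pi_lt_d4
    set x := 5 * Real.pi / 46 with hx
    have x1 : 0.3414 < x := by rw [hx]; norm_num at hl ⊢; linarith
    have x2 : x < 0.3415 := by rw [hx]; norm_num at hu ⊢; linarith
    have hb := Real.sin_bound (x := x) (by rw [abs_le]; constructor <;> linarith)
    rw [abs_of_pos (by linarith : 0 < x), abs_le] at hb
    have x3 : x ^ 3 ≤ 0.3415 ^ 3 := by gcongr
    have x4 : x ^ 5 ≤ 0.3415 ^ 5 := by gcongr
    norm_num at x3 x4 x1
    linarith [hb.1]
  rw [h1]
  linarith

/-- At a sufficiently small ball which is the smallest of its tetrahedron, the extended solid angle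
exceeds `4π/23`. -/
theorem exists_lt_ballAngle :
    ∃ ε > 0, ∀ r : Fin 4 → ℝ, (∀ i, 0 < r i) → ∀ i, r i ≤ ε → (∀ j, r i ≤ r j) →
      4 * Real.pi / 23 < ballAngle r i := by
  have hκ := cos_sq_lt_third
  set κ := Real.cos (7 * Real.pi / 23) with hκd
  have hκ0 : 0 ≤ κ := Real.cos_nonneg_of_neg_pi_div_two_le_of_le
    (by linarith [Real.pi_pos]) (by linarith [Real.pi_pos])
  -- For Y ≥ Y0 and Y > 1, Y² (1 - 3κ²) ≥ Y > κ², that is, κ √(3Y² + 1) < Y.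
  set Y0 := 1 / (1 - 3 * κ ^ 2) with hY0
  have h13 : 0 < 1 - 3 * κ ^ 2 := by linarith
  have hY00 : 0 < Y0 := by positivity
  refine ⟨Real.arsinh (1 / Y0), by rw [gt_iff_lt, Real.arsinh_pos_iff]; positivity,
    fun r hr i hi hmin => ?_⟩
  have hy : ∀ k, 1 < hypCot (r k) := fun k => hypCot_gt_one (hr k)
  have hmax : ∀ j, hypCot (r j) ≤ hypCot (r i) := fun j => hypCot_antitone (hr i) (hmin j)
  refine lt_of_lt_of_le ?_ (linkArea_const_le (y := fun k => hypCot (r k)) hy hmax)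
  have hY : Y0 ≤ hypCot (r i) := by
    have hs := Real.sinh_pos_iff.2 (hr i)
    have h1 : Real.sinh (r i) ≤ 1 / Y0 := by
      rw [← Real.sinh_arsinh (1 / Y0)]
      exact Real.sinh_le_sinh.2 hi
    rw [hypCot, le_div_iff₀ hs]
    have h2 : Y0 * Real.sinh (r i) ≤ 1 := by
      calc _ ≤ Y0 * (1 / Y0) := by gcongr
        _ = 1 := by field_simp
    linarith [Real.one_le_cosh (r i)]
  have hY1 := hy i
  generalize hypCot (r i) = Y at *
  have hm : ∀ f, midAngle (fun _ => Y) f < 7 * Real.pi / 23 := by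
    intro f
    have hv : defect (fun _ => Y) f = 2 * Y := by
      simp only [defect, Fin.sum_univ_four]; ring
    have hA : faceProd (fun _ => Y) f = 3 * Y ^ 2 + 1 := by
      rw [faceProd_eq]; ring
    have hr7 : Real.arccos κ = 7 * Real.pi / 23 :=
      Real.arccos_cos (by positivity) (by linarith [Real.pi_pos])
    have hsq : √(3 * Y ^ 2 + 1) ^ 2 = 3 * Y ^ 2 + 1 := Real.sq_sqrt (by positivity)
    have hs0 : 0 < √(3 * Y ^ 2 + 1) := by positivity
    rw [midAngle, hv, hA, ← hr7]
    refine Real.arccos_lt_arccos (by linarith) ?_ ?_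
    · rw [lt_div_iff₀ (by positivity)]
      have : κ * √(3 * Y ^ 2 + 1) < Y := by
        apply lt_of_pow_lt_pow_left₀ 2 (by linarith)
        rw [mul_pow, hsq]
        have h1 : 1 ≤ Y * (1 - 3 * κ ^ 2) := by
          rw [hY0, div_le_iff₀ h13] at hY
          exact hY
        nlinarith
      linarith
    · rw [div_le_one (by positivity)]
      have : Y ≤ √(3 * Y ^ 2 + 1) := Real.le_sqrt_of_sq_le (by nlinarith)
      linarith
  have h0 := hm (i.succAbove 0)
  have h1 := hm (i.succAbove 1)
  have h2 := hm (i.succAbove 2)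
  rw [linkArea, Fin.sum_univ_succAbove _ i, Fin.sum_univ_three]
  linarith [Real.pi_pos]

/-! ### Hyperbolic trigonometry: the solid angle of a real tetrahedron -/

theorem one_le_neg_lorentz (x y : HypSpace) : 1 ≤ -lorentz x.1 y.1 := by
  obtain ⟨x, hx, hx0⟩ := x
  obtain ⟨y, hy, hy0⟩ := y
  simp only [lorentz] at hx hy ⊢
  have h1 : (x 1 * y 1 + x 2 * y 2 + x 3 * y 3 + 1) ^ 2 ≤ (x 0 * y 0) ^ 2 := by
    have e : (x 0 * y 0) ^ 2 = (1 + (x 1 ^ 2 + x 2 ^ 2 + x 3 ^ 2)) *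
        (1 + (y 1 ^ 2 + y 2 ^ 2 + y 3 ^ 2)) := by
      rw [mul_pow]
      congr 1 <;> linarith
    rw [e]
    -- For the spatial parts, (1 + |x|²)(1 + |y|²) - (x·y + 1)² = |x - y|² + |x × y|².
    nlinarith [sq_nonneg (x 1 - y 1), sq_nonneg (x 2 - y 2), sq_nonneg (x 3 - y 3),
      sq_nonneg (x 1 * y 2 - x 2 * y 1), sq_nonneg (x 1 * y 3 - x 3 * y 1),
      sq_nonneg (x 2 * y 3 - x 3 * y 2)]
  have h2 := (le_abs_self _).trans (abs_le_of_sq_le_sq h1 (by positivity))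
  linarith

theorem lorentz_eq_of_hypDist {x y : HypSpace} {l : ℝ} (h : hypDist x y = l) :
    lorentz x.1 y.1 = -Real.cosh l := by
  rw [← h, hypDist, Real.cosh_arcosh (one_le_neg_lorentz x y), neg_neg]

theorem lorentz_tangentTo (a x y : HypSpace) :
    lorentz (tangentTo a x) (tangentTo a y) =
      lorentz x.1 y.1 + lorentz a.1 x.1 * lorentz a.1 y.1 := by
  have h := a.2.1
  have e : lorentz (tangentTo a x) (tangentTo a y) = lorentz x.1 y.1 +
      2 * (lorentz a.1 x.1 * lorentz a.1 y.1) +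
      lorentz a.1 x.1 * lorentz a.1 y.1 * lorentz a.1 a.1 := by
    simp only [tangentTo, lorentz, Pi.add_apply, Pi.smul_apply, smul_eq_mul]
    ring
  rw [e, h]; ring

theorem lorentz_orthPart {w : Fin 4 → ℝ} (hw : lorentz w w ≠ 0) (u v : Fin 4 → ℝ) :
    lorentz (orthPart w u) (orthPart w v) =
      lorentz u v - lorentz u w * lorentz v w / lorentz w w := by
  have e : lorentz (orthPart w u) (orthPart w v) = lorentz u v -
      (lorentz v w / lorentz w w) * lorentz u w - (lorentz u w / lorentz w w) * lorentz v w +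
      (lorentz u w / lorentz w w) * (lorentz v w / lorentz w w) * lorentz w w := by
    simp only [orthPart]
    generalize lorentz u w / lorentz w w = α
    generalize lorentz v w / lorentz w w = β
    simp only [lorentz, Pi.sub_apply, Pi.smul_apply, smul_eq_mul]
    ring
  rw [e]
  field_simp
  ring

theorem cosh_add_eq {r s : ℝ} (hr : 0 < r) (hs : 0 < s) :
    Real.cosh (r + s) = Real.sinh r * Real.sinh s * (hypCot r * hypCot s + 1) := by
  have h1 := (Real.sinh_pos_iff.2 hr).ne'
  have h2 := (Real.sinh_pos_iff.2 hs).ne'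
  rw [hypCot, hypCot, Real.cosh_add]
  field_simp

theorem sinh_sq_mul {r : ℝ} (hr : 0 < r) : Real.sinh r ^ 2 * (hypCot r ^ 2 - 1) = 1 := by
  have h1 := (Real.sinh_pos_iff.2 hr).ne'
  rw [one_div_sinh_sq hr]
  field_simp

theorem lorentz_tangent_ne {r : Fin 4 → ℝ} {p : Fin 4 → HypSpace} (hr : ∀ i, 0 < r i)
    (hp : ∀ i j, i ≠ j → hypDist (p i) (p j) = r i + r j) {a x y : Fin 4}
    (hax : a ≠ x) (hay : a ≠ y) (hxy : x ≠ y) :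
    lorentz (tangentTo (p a) (p x)) (tangentTo (p a) (p y)) =
      Real.sinh (r a) ^ 2 * Real.sinh (r x) * Real.sinh (r y) *
        (hypCot (r a) * hypCot (r x) + hypCot (r a) * hypCot (r y) + hypCot (r x) * hypCot (r y) + 1
          - (hypCot (r a) ^ 2 - 1)) := by
  rw [lorentz_tangentTo, lorentz_eq_of_hypDist (hp x y hxy), lorentz_eq_of_hypDist (hp a x hax),
    lorentz_eq_of_hypDist (hp a y hay), cosh_add_eq (hr x) (hr y), cosh_add_eq (hr a) (hr x),
    cosh_add_eq (hr a) (hr y)]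
  linear_combination (Real.sinh (r x) * Real.sinh (r y) * (hypCot (r x) * hypCot (r y) + 1)) *
    sinh_sq_mul (hr a)

theorem lorentz_tangent_self {r : Fin 4 → ℝ} {p : Fin 4 → HypSpace} (hr : ∀ i, 0 < r i)
    (hp : ∀ i j, i ≠ j → hypDist (p i) (p j) = r i + r j) {a x : Fin 4} (hax : a ≠ x) :
    lorentz (tangentTo (p a) (p x)) (tangentTo (p a) (p x)) =
      Real.sinh (r a) ^ 2 * Real.sinh (r x) ^ 2 * (hypCot (r a) + hypCot (r x)) ^ 2 := by
  rw [lorentz_tangentTo, (p x).2.1, lorentz_eq_of_hypDist (hp a x hax), cosh_add_eq (hr a) (hr x)]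
  have h1 := sinh_sq_mul (hr a)
  have h2 := sinh_sq_mul (hr x)
  linear_combination Real.sinh (r x) ^ 2 * (hypCot (r x) ^ 2 - 1) * h1 + h2

theorem orthPart_aux_ne {A B C D Sa Sb Sc Sd : ℝ} (hS : Sa ^ 2 * (A ^ 2 - 1) = 1)
    (_ha : Sa ≠ 0) (hb : Sb ≠ 0) (hAB : A + B ≠ 0) :
    Sa ^ 2 * Sc * Sd * (A * C + A * D + C * D + 1 - (A ^ 2 - 1)) -
      Sa ^ 2 * Sc * Sb * (A * C + A * B + C * B + 1 - (A ^ 2 - 1)) *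
        (Sa ^ 2 * Sd * Sb * (A * D + A * B + D * B + 1 - (A ^ 2 - 1))) /
        (Sa ^ 2 * Sb ^ 2 * (A + B) ^ 2) =
      2 * Sc * Sd * ((A + B) * (C + D) - A ^ 2 - B ^ 2 + 2) / (A + B) ^ 2 := by
  field_simp
  linear_combination Sc * Sd * 2 * ((A + B) * (C + D) - A ^ 2 - B ^ 2 + 2) * hS

theorem orthPart_aux_self {A B C Sa Sb Sc : ℝ} (hS : Sa ^ 2 * (A ^ 2 - 1) = 1)
    (_ha : Sa ≠ 0) (hb : Sb ≠ 0) (hAB : A + B ≠ 0) :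
    Sa ^ 2 * Sc ^ 2 * (A + C) ^ 2 -
      Sa ^ 2 * Sc * Sb * (A * C + A * B + C * B + 1 - (A ^ 2 - 1)) *
        (Sa ^ 2 * Sc * Sb * (A * C + A * B + C * B + 1 - (A ^ 2 - 1))) /
        (Sa ^ 2 * Sb ^ 2 * (A + B) ^ 2) =
      (2 * Sc / (A + B)) ^ 2 * (A * B + B * C + C * A + 1) := by
  field_simp
  linear_combination Sc ^ 2 * 4 * (A * B + B * C + C * A + 1) * hS

/-- The sine of the sum is a positive multiple of √disc times the sum of the defects, hence
nonnegative; the sum is below 2π because sin ψ_k > 0 excludes ψ_k = π. -/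
theorem midAngle_add_le_pi {y : Fin 4 → ℝ} (hQ : 0 < disc y) {k l : Fin 4}
    (h : 0 ≤ defect y k + defect y l) : midAngle y k + midAngle y l ≤ Real.pi := by
  by_contra hcon
  push Not at hcon
  have hk : midAngle y k ≤ Real.pi := Real.arccos_le_pi _
  have hl : midAngle y l ≤ Real.pi := Real.arccos_le_pi _
  have hpos : ∀ f, 0 < √(faceProd y f) := fun f => Real.sqrt_pos.2 (by
    have := four_mul_faceProd y f
    nlinarith [sq_nonneg (defect y f)])
  have pk := hpos k
  have pl := hpos l
  have hq := Real.sqrt_pos.2 hQ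
  have hlt : midAngle y k + midAngle y l < 2 * Real.pi := by
    rcases eq_or_lt_of_le hk with he | h1
    · have := sin_midAngle hQ k
      rw [he, Real.sin_pi] at this
      have : 0 < √(disc y) / (2 * √(faceProd y k)) := by positivity
      linarith
    · linarith
  have hs : Real.sin (midAngle y k + midAngle y l) < 0 := by
    have := Real.sin_pos_of_pos_of_lt_pi (x := midAngle y k + midAngle y l - Real.pi)
      (by linarith) (by linarith)
    rw [Real.sin_sub_pi] at this
    linarith
  rw [Real.sin_add, cos_midAngle hQ, cos_midAngle hQ, sin_midAngle hQ, sin_midAngle hQ] at hs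
  have e : √(disc y) / (2 * √(faceProd y k)) * (defect y l / (2 * √(faceProd y l))) +
      defect y k / (2 * √(faceProd y k)) * (√(disc y) / (2 * √(faceProd y l))) =
      √(disc y) * (defect y k + defect y l) / (4 * √(faceProd y k) * √(faceProd y l)) := by
    field_simp; ring
  rw [e] at hs
  exact absurd hs (not_lt.2 (by positivity))

theorem arccos_eq_midAngle {y : Fin 4 → ℝ} (hQ : 0 < disc y) {k l : Fin 4}
    (h : 0 ≤ defect y k + defect y l) :
    Real.arccos ((disc y - defect y k * defect y l) / (4 * √(faceProd y k) * √(faceProd y l))) =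
      Real.pi - midAngle y k - midAngle y l := by
  have hpos : ∀ f, 0 < √(faceProd y f) := fun f => Real.sqrt_pos.2 (by
    have := four_mul_faceProd y f
    nlinarith [sq_nonneg (defect y f)])
  have pk := hpos k
  have pl := hpos l
  have hsq : √(disc y) ^ 2 = disc y := Real.sq_sqrt hQ.le
  rw [← Real.arccos_cos (x := Real.pi - midAngle y k - midAngle y l)]
  · congr 1
    rw [sub_sub, Real.cos_pi_sub, Real.cos_add, cos_midAngle hQ, cos_midAngle hQ, sin_midAngle hQ,
      sin_midAngle hQ]
    generalize √(disc y) = q at *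
    rw [← hsq]
    field_simp
    ring
  · linarith [midAngle_add_le_pi hQ h]
  · have h1 : 0 ≤ midAngle y k := Real.arccos_nonneg _
    have h2 : 0 ≤ midAngle y l := Real.arccos_nonneg _
    linarith

/-- Projecting orthogonally to the edge, the cosine becomes (Q - v_c v_d)/(4 √A_c √A_d) = -cos(ψ_c +
ψ_d), where v is the defect and A is faceProd. The sum v_c + v_d = 2 (y_a + y_b) is positive, which
puts ψ_c + ψ_d in [0, π]. -/
theorem dihedralAngle_eq {r : Fin 4 → ℝ} {p : Fin 4 → HypSpace} (hr : ∀ i, 0 < r i)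
    (hp : ∀ i j, i ≠ j → hypDist (p i) (p j) = r i + r j)
    (hQ : 0 < disc fun k => hypCot (r k)) {a b c d : Fin 4}
    (h : Function.Injective ![a, b, c, d]) :
    dihedralAngle (p a) (p b) (p c) (p d) =
      Real.pi - midAngle (fun k => hypCot (r k)) c - midAngle (fun k => hypCot (r k)) d := by
  have hab : a ≠ b := fun e => by simpa using h (a₁ := 0) (a₂ := 1) (by simpa using e)
  have hac : a ≠ c := fun e => by simpa using h (a₁ := 0) (a₂ := 2) (by simpa using e)
  have had : a ≠ d := fun e => by simpa using h (a₁ := 0) (a₂ := 3) (by simpa using e)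
  have hbc : b ≠ c := fun e => by simpa using h (a₁ := 1) (a₂ := 2) (by simpa using e)
  have hbd : b ≠ d := fun e => by simpa using h (a₁ := 1) (a₂ := 3) (by simpa using e)
  have hcd : c ≠ d := fun e => by simpa using h (a₁ := 2) (a₂ := 3) (by simpa using e)
  have hsp : ∀ k, 0 < Real.sinh (r k) := fun k => Real.sinh_pos_iff.2 (hr k)
  have hy : ∀ k, 1 < hypCot (r k) := fun k => hypCot_gt_one (hr k)
  have e := fun f : Fin 4 → ℝ => Equiv.sum_comp (Equiv.ofBijective _ (Finite.injective_iff_bijective.1 h)) f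
  have hS := e fun k => hypCot (r k)
  have hS2 := e fun k => hypCot (r k) ^ 2
  rw [Fin.sum_univ_four] at hS hS2
  simp only [Equiv.ofBijective_apply, Matrix.cons_val_zero, Matrix.cons_val_one,
    Matrix.cons_val] at hS hS2
  have ya := hy a
  have yb := hy b
  have yc := hy c
  have yd := hy d
  have hAB : hypCot (r a) + hypCot (r b) ≠ 0 := by linarith
  have hw := lorentz_tangent_self hr hp hab
  have hw0 : lorentz (tangentTo (p a) (p b)) (tangentTo (p a) (p b)) ≠ 0 := by
    rw [hw]
    have := hsp a
    have := hsp b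
    positivity
  have huv := lorentz_orthPart hw0 (tangentTo (p a) (p c)) (tangentTo (p a) (p d))
  have huu := lorentz_orthPart hw0 (tangentTo (p a) (p c)) (tangentTo (p a) (p c))
  have hvv := lorentz_orthPart hw0 (tangentTo (p a) (p d)) (tangentTo (p a) (p d))
  rw [hw, lorentz_tangent_ne hr hp hac had hcd, lorentz_tangent_ne hr hp hac hab hbc.symm,
    lorentz_tangent_ne hr hp had hab hbd.symm,
    orthPart_aux_ne (sinh_sq_mul (hr a)) (hsp a).ne' (hsp b).ne' hAB] at huv
  rw [hw, lorentz_tangent_self hr hp hac, lorentz_tangent_ne hr hp hac hab hbc.symm,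
    orthPart_aux_self (sinh_sq_mul (hr a)) (hsp a).ne' (hsp b).ne' hAB] at huu
  rw [hw, lorentz_tangent_self hr hp had, lorentz_tangent_ne hr hp had hab hbd.symm,
    orthPart_aux_self (sinh_sq_mul (hr a)) (hsp a).ne' (hsp b).ne' hAB] at hvv
  have hAd : faceProd (fun k => hypCot (r k)) d = hypCot (r a) * hypCot (r b) +
      hypCot (r b) * hypCot (r c) + hypCot (r c) * hypCot (r a) + 1 := by
    simp only [faceProd, defect, disc, ← hS, ← hS2]; ring
  have hAc : faceProd (fun k => hypCot (r k)) c = hypCot (r a) * hypCot (r b) +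
      hypCot (r b) * hypCot (r d) + hypCot (r d) * hypCot (r a) + 1 := by
    simp only [faceProd, defect, disc, ← hS, ← hS2]; ring
  have hN : disc (fun k => hypCot (r k)) - defect (fun k => hypCot (r k)) c *
      defect (fun k => hypCot (r k)) d = 2 * ((hypCot (r a) + hypCot (r b)) *
        (hypCot (r c) + hypCot (r d)) - hypCot (r a) ^ 2 - hypCot (r b) ^ 2 + 2) := by
    simp only [defect, disc, ← hS, ← hS2]; ring
  have hcd0 : 0 ≤ defect (fun k => hypCot (r k)) c + defect (fun k => hypCot (r k)) d := by
    simp only [defect, ← hS]; linarith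
  rw [sub_sub, ← sub_sub, ← arccos_eq_midAngle hQ hcd0]
  rw [dihedralAngle, tangentAngle, huv, huu, hvv, ← hAd, ← hAc, hN]
  have sc := hsp c
  have sd := hsp d
  have p1 := faceProd_pos hy c
  have p2 := faceProd_pos hy d
  have q1 : 0 < √(faceProd (fun k => hypCot (r k)) c) := Real.sqrt_pos.2 (by linarith)
  have q2 : 0 < √(faceProd (fun k => hypCot (r k)) d) := Real.sqrt_pos.2 (by linarith)
  have hABp : 0 < hypCot (r a) + hypCot (r b) := by linarith
  rw [Real.sqrt_mul (by positivity), Real.sqrt_mul (by positivity), Real.sqrt_sq (by positivity),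
    Real.sqrt_sq (by positivity)]
  congr 1
  field_simp
  ring

theorem solidAngle_eq {r : Fin 4 → ℝ} {p : Fin 4 → HypSpace} (hr : ∀ i, 0 < r i)
    (hp : ∀ i j, i ≠ j → hypDist (p i) (p j) = r i + r j)
    (hQ : 0 < disc fun k => hypCot (r k)) (i : Fin 4) : solidAngle p i = ballAngle r i := by
  rw [solidAngle, dihedralAngle_eq hr hp hQ (by revert i; decide),
    dihedralAngle_eq hr hp hQ (by revert i; decide),
    dihedralAngle_eq hr hp hQ (by revert i; decide), ballAngle, linkArea,
    Fin.sum_univ_succAbove _ i, Fin.sum_univ_three]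
  ring

/-! ### Real tetrahedra are those of positive discriminant -/

theorem det_gram (y : Fin 4 → ℝ) :
    (Matrix.of fun i j => if i = j then 1 - y i ^ 2 else -(y i * y j + 1)).det = -4 * disc y := by
  rw [Matrix.det_succ_row_zero]
  simp [Fin.sum_univ_succ, Matrix.det_succ_row_zero, Fin.succAbove, disc]
  ring

/-- The Lorentzian Gram matrix of the vertices has determinant -(det P)² < 0. Factoring sinh r_i out
of its rows and columns leaves the matrix of `det_gram`, so this determinant is also -4Q (∏ sinh
r_i)². -/
theorem disc_pos_of_isTetrahedronOf {r : Fin 4 → ℝ} {p : Fin 4 → HypSpace} (hr : ∀ i, 0 < r i)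
    (h : IsTetrahedronOf r p) : 0 < disc fun k => hypCot (r k) := by
  obtain ⟨hli, hp⟩ := h
  have hsp : ∀ k, Real.sinh (r k) ≠ 0 := fun k => (Real.sinh_pos_iff.2 (hr k)).ne'
  set P : Matrix (Fin 4) (Fin 4) ℝ := Matrix.of fun i => (p i).1 with hP
  have hdet : P.det ≠ 0 := by
    have : IsUnit P := Matrix.linearIndependent_rows_iff_isUnit.1 hli
    exact ((Matrix.isUnit_iff_isUnit_det _).1 this).ne_zero
  have hG : Matrix.diagonal (fun k => (Real.sinh (r k))) *
      (Matrix.of fun i j => if i = j then 1 - hypCot (r i) ^ 2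
        else -(hypCot (r i) * hypCot (r j) + 1)) * Matrix.diagonal (fun k => (Real.sinh (r k))) =
      P * Matrix.diagonal (![-1, 1, 1, 1] : Fin 4 → ℝ) * P.transpose := by
    ext i j
    have hR : (P * Matrix.diagonal (![-1, 1, 1, 1] : Fin 4 → ℝ) * P.transpose) i j =
        lorentz (p i).1 (p j).1 := by
      simp [Matrix.mul_apply, Matrix.diagonal_apply, hP, lorentz, Fin.sum_univ_four]
    rw [hR, Matrix.mul_diagonal, Matrix.diagonal_mul, Matrix.of_apply]
    split_ifs with hij
    · subst hij
      rw [(p i).2.1]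
      linear_combination -sinh_sq_mul (hr i)
    · rw [lorentz_eq_of_hypDist (hp i j hij), cosh_add_eq (hr i) (hr j)]
      ring
  have hd := congrArg Matrix.det hG
  rw [Matrix.det_mul, Matrix.det_mul, Matrix.det_mul, Matrix.det_mul, Matrix.det_transpose,
    Matrix.det_diagonal, Matrix.det_diagonal, det_gram fun k => hypCot (r k)] at hd
  have h1 : ∏ i, (![-1, 1, 1, 1] : Fin 4 → ℝ) i = -1 := by simp [Fin.prod_univ_four]
  rw [h1] at hd
  have h2 : 0 < P.det ^ 2 := by positivity
  have h3 : 0 < (∏ k, Real.sinh (r k)) ^ 2 := by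
    have : ∏ k, Real.sinh (r k) ≠ 0 := Finset.prod_ne_zero_iff.2 fun k _ => hsp k
    positivity
  nlinarith

theorem isRealTetrahedron_of_lorentz {r : Fin 4 → ℝ} (hr : ∀ i, 0 < r i) (v : Fin 4 → Fin 4 → ℝ)
    (hli : LinearIndependent ℝ v) (hself : ∀ i, lorentz (v i) (v i) = -1) (h0 : ∀ i, 0 < v i 0)
    (hne : ∀ i j, i < j → lorentz (v i) (v j) = -Real.cosh (r i + r j)) : IsRealTetrahedron r := by
  refine ⟨fun i => ⟨v i, hself i, h0 i⟩, hli, fun i j hij => ?_⟩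
  have : lorentz (v i) (v j) = -Real.cosh (r i + r j) := by
    rcases lt_or_gt_of_ne hij with h | h
    · exact hne i j h
    · rw [add_comm (r i), ← hne j i h]
      simp only [lorentz]; ring
  change Real.arcosh (-lorentz (v i) (v j)) = _
  rw [this, neg_neg, Real.arcosh_cosh (by linarith [hr i, hr j])]

/-- Vertex 0 is placed at (1, 0, 0, 0) and the others in triangular position; the equations say that
a, …, f is a Cholesky factor of the Gram matrix of the tangent vectors at vertex 0. -/
theorem isRealTetrahedron_of_cholesky {r : Fin 4 → ℝ} (hr : ∀ i, 0 < r i) {a b c d e f : ℝ}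
    (ha : 0 < a) (hc : 0 < c) (hf : 0 < f)
    (h11 : a ^ 2 = Real.cosh (r 0 + r 1) ^ 2 - 1)
    (h22 : b ^ 2 + c ^ 2 = Real.cosh (r 0 + r 2) ^ 2 - 1)
    (h33 : d ^ 2 + e ^ 2 + f ^ 2 = Real.cosh (r 0 + r 3) ^ 2 - 1)
    (h12 : a * b = Real.cosh (r 0 + r 1) * Real.cosh (r 0 + r 2) - Real.cosh (r 1 + r 2))
    (h13 : a * d = Real.cosh (r 0 + r 1) * Real.cosh (r 0 + r 3) - Real.cosh (r 1 + r 3))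
    (h23 : b * d + c * e =
      Real.cosh (r 0 + r 2) * Real.cosh (r 0 + r 3) - Real.cosh (r 2 + r 3)) :
    IsRealTetrahedron r := by
  refine isRealTetrahedron_of_lorentz hr ![![1, 0, 0, 0], ![Real.cosh (r 0 + r 1), a, 0, 0],
    ![Real.cosh (r 0 + r 2), b, c, 0], ![Real.cosh (r 0 + r 3), d, e, f]] ?_ ?_ ?_ ?_
  · refine Matrix.linearIndependent_rows_of_det_ne_zero (A := !![1, 0, 0, 0;
      Real.cosh (r 0 + r 1), a, 0, 0; Real.cosh (r 0 + r 2), b, c, 0;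
      Real.cosh (r 0 + r 3), d, e, f]) ?_
    have : Matrix.det !![1, 0, 0, 0; Real.cosh (r 0 + r 1), a, 0, 0;
        Real.cosh (r 0 + r 2), b, c, 0; Real.cosh (r 0 + r 3), d, e, f] = a * c * f := by
      rw [Matrix.det_succ_row_zero]
      simp [Fin.sum_univ_succ, Matrix.det_succ_row_zero, Fin.succAbove]
      ring
    rw [this]
    positivity
  · intro i
    fin_cases i <;> simp [lorentz] <;> linarith
  · intro i
    fin_cases i <;> simp [Real.cosh_pos]
  · intro i j hij
    fin_cases i <;> fin_cases j <;> first
      | exact absurd hij (by decide)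
      | (simp [lorentz] <;> linarith)

theorem isRealTetrahedron_of_disc_pos {r : Fin 4 → ℝ} (hr : ∀ i, 0 < r i)
    (hQ : 0 < disc fun k => hypCot (r k)) : IsRealTetrahedron r := by
  have hsp : ∀ k, 0 < Real.sinh (r k) := fun k => Real.sinh_pos_iff.2 (hr k)
  have hy : ∀ k, 1 < hypCot (r k) := fun k => hypCot_gt_one (hr k)
  have hA3 := faceProd_eq (fun k => hypCot (r k)) 3
  have p3 := faceProd_pos hy 3
  have hQ' : disc (fun k => hypCot (r k)) =
      (hypCot (r 0) + hypCot (r 1) + hypCot (r 2) + hypCot (r 3)) ^ 2 - 2 * (hypCot (r 0) ^ 2 +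
        hypCot (r 1) ^ 2 + hypCot (r 2) ^ 2 + hypCot (r 3) ^ 2) + 4 := by
    simp only [disc, Fin.sum_univ_four]
  simp [Fin.succAbove] at hA3
  generalize faceProd (fun k => hypCot (r k)) 3 = A3 at *
  generalize disc (fun k => hypCot (r k)) = Q at *
  have hy0 := hy 0
  have hy1 := hy 1
  have hS0 := sinh_sq_mul (hr 0)
  have hS1 := sinh_sq_mul (hr 1)
  have hS2 := sinh_sq_mul (hr 2)
  have hS3 := sinh_sq_mul (hr 3)
  have s0 := hsp 0
  have s1 := hsp 1
  have s2 := hsp 2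
  have s3 := hsp 3
  have hab : 0 < hypCot (r 0) + hypCot (r 1) := by linarith
  have hq3 : 0 < √A3 := Real.sqrt_pos.2 (by linarith)
  have hq : 0 < √Q := Real.sqrt_pos.2 hQ
  have hq3' : √A3 ^ 2 = A3 := Real.sq_sqrt (by linarith)
  have hq' : √Q ^ 2 = Q := Real.sq_sqrt hQ.le
  -- The explicit Cholesky factor. Positivity of Q enters only through the last diagonal entry.
  apply isRealTetrahedron_of_cholesky hr
    (a := Real.sinh (r 0) * Real.sinh (r 1) * (hypCot (r 0) + hypCot (r 1)))
    (b := Real.sinh (r 0) * Real.sinh (r 2) * (A3 - (hypCot (r 0) ^ 2 - 1)) /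
      (hypCot (r 0) + hypCot (r 1)))
    (c := Real.sinh (r 2) * (2 * √A3) / (hypCot (r 0) + hypCot (r 1)))
    (d := Real.sinh (r 0) * Real.sinh (r 3) * (hypCot (r 0) * hypCot (r 1) +
      hypCot (r 0) * hypCot (r 3) + hypCot (r 1) * hypCot (r 3) + 1 - (hypCot (r 0) ^ 2 - 1)) /
      (hypCot (r 0) + hypCot (r 1)))
    (e := Real.sinh (r 3) * ((hypCot (r 0) + hypCot (r 1)) *
      (hypCot (r 2) + hypCot (r 3)) - hypCot (r 0) ^ 2 - hypCot (r 1) ^ 2 + 2) /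
      ((hypCot (r 0) + hypCot (r 1)) * √A3))
    (f := Real.sinh (r 3) * √Q / √A3)
  any_goals positivity
  all_goals
    try rw [cosh_add_eq (hr 0) (hr 1)]
    try rw [cosh_add_eq (hr 0) (hr 2)]
    try rw [cosh_add_eq (hr 0) (hr 3)]
    try rw [cosh_add_eq (hr 1) (hr 2)]
    try rw [cosh_add_eq (hr 1) (hr 3)]
    try rw [cosh_add_eq (hr 2) (hr 3)]
  all_goals
    generalize hypCot (r 0) = A at *
    generalize hypCot (r 1) = B at *
    generalize hypCot (r 2) = C at *
    generalize hypCot (r 3) = D at *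
    generalize Real.sinh (r 0) = S at *
    generalize Real.sinh (r 1) = T at *
    generalize Real.sinh (r 2) = U at *
    generalize Real.sinh (r 3) = V at *
    generalize √A3 = g at *
    generalize √Q = q at *
    subst hA3 hQ'
  · linear_combination -T ^ 2 * (B ^ 2 - 1) * hS0 - hS1
  · field_simp
    linear_combination 4 * U ^ 2 * hq3' - 4 * U ^ 2 * (A * B + B * C + C * A + 1) * hS0 -
      (A + B) ^ 2 * (U ^ 2 * (C ^ 2 - 1) * hS0 + hS2)
  · field_simp
    linear_combination (S ^ 2 * V ^ 2 * (A * B + A * D + B * D + 1 - (A ^ 2 - 1)) ^ 2 -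
      (A + B) ^ 2 * (S ^ 2 * V ^ 2 * (A * D + 1) ^ 2 - 1)) * hq3' + V ^ 2 * (A + B) ^ 2 * hq' -
      4 * V ^ 2 * (A * B + A * D + B * D + 1) * (A * B + B * C + C * A + 1) * hS0 -
      (A + B) ^ 2 * (A * B + B * C + C * A + 1) * (V ^ 2 * (D ^ 2 - 1) * hS0 + hS3)
  · field_simp
    linear_combination -(B * C + 1) * hS0
  · field_simp
    linear_combination -(B * D + 1) * hS0
  · field_simp
    linear_combination -2 * ((A + B) * (C + D) - A ^ 2 - B ^ 2 + 2) * hS0 -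
      (A + B) ^ 2 * (C * D + 1) * hS0

theorem isRealTetrahedron_iff {r : Fin 4 → ℝ} (hr : ∀ i, 0 < r i) :
    IsRealTetrahedron r ↔ 0 < disc fun k => hypCot (r k) :=
  ⟨fun ⟨_, h⟩ => disc_pos_of_isTetrahedronOf hr h, isRealTetrahedron_of_disc_pos hr⟩

theorem inVirtualSpace_iff (r : Fin 4 → ℝ) (i : Fin 4) :
    InVirtualSpace r i ↔ defect (fun k => hypCot (r k)) i ≤
      -(2 * √(faceProd (fun k => hypCot (r k)) i)) := by
  rw [InVirtualSpace, faceProd_eq, defect, Fin.sum_univ_succAbove _ i, Fin.sum_univ_three]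
  constructor <;> intro h <;> linarith

/-- The chosen realization is immaterial, as `solidAngle_eq` holds for every one. In the last case
some index is dominant and it is not i, so the formula gives 0. -/
theorem extSolidAngle_eq {r : Fin 4 → ℝ} (hr : ∀ i, 0 < r i) (i : Fin 4) :
    extSolidAngle r i = ballAngle r i := by
  unfold extSolidAngle
  split_ifs with h hv
  · exact solidAngle_eq hr h.choose_spec.2 ((isRealTetrahedron_iff hr).1 h) i
  · exact (linkArea_of_dominant (fun k => hypCot_gt_one (hr k))
      ((inVirtualSpace_iff r i).1 hv)).1.symm
  · rw [isRealTetrahedron_iff hr, not_lt] at h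
    obtain ⟨k, hk, -⟩ := exists_dominant (fun k => hypCot_gt_one (hr k)) h
    refine ((linkArea_of_dominant (fun k => hypCot_gt_one (hr k)) hk).2 i ?_).symm
    rintro rfl
    exact hv ((inVirtualSpace_iff r i).2 hk)

end TetraPacking

/-! ### Peano's existence theorem by Euler's scheme -/

section Peano

variable {E : Type*} [NormedAddCommGroup E] [NormedSpace ℝ E]

/-- Euler's scheme with step `h`. -/
noncomputable def eulerStep (f : E → E) (h : ℝ) (x₀ : E) : ℕ → E
  | 0 => x₀
  | k + 1 => eulerStep f h x₀ k + h • f (eulerStep f h x₀ k)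

theorem norm_eulerStep_sub_le {f : E → E} {h : ℝ} (hh : 0 ≤ h) {x₀ w : E} {ε : ℝ} {k l : ℕ}
    (hkl : k ≤ l) (hf : ∀ i, k ≤ i → i < l → ‖f (eulerStep f h x₀ i) - w‖ ≤ ε) :
    ‖eulerStep f h x₀ l - eulerStep f h x₀ k - ((l - k : ℝ) * h) • w‖ ≤ ε * ((l - k : ℝ) * h) := by
  induction l, hkl using Nat.le_induction with
  | base => simp
  | succ l hl ih =>
    have h1 := ih fun i hi hil => hf i hi (by omega)
    have h2 := hf l hl (by omega)
    have e : eulerStep f h x₀ (l + 1) - eulerStep f h x₀ k - (((l + 1 : ℕ) - k : ℝ) * h) • w =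
        (eulerStep f h x₀ l - eulerStep f h x₀ k - ((l - k : ℝ) * h) • w) +
          h • (f (eulerStep f h x₀ l) - w) := by
      rw [eulerStep]
      push_cast
      module
    rw [e]
    refine (norm_add_le _ _).trans ?_
    rw [norm_smul, Real.norm_of_nonneg hh]
    have h3 := mul_le_mul_of_nonneg_left h2 hh
    push_cast
    linarith

/-- **Peano's theorem** for bounded continuous autonomous vector fields, on `[0, ∞)`. -/
theorem exists_hasDerivWithinAt_of_continuous_of_bounded [ProperSpace E] {f : E → E}
    (hf : Continuous f) {C : ℝ} (hC : ∀ x, ‖f x‖ ≤ C) (x₀ : E) :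
    ∃ x : ℝ → E, x 0 = x₀ ∧ ∀ t, 0 ≤ t → HasDerivWithinAt x (f (x t)) (Set.Ici 0) t := by
  have hC0 : 0 ≤ C := (norm_nonneg _).trans (hC x₀)
  set h : ℕ → ℝ := fun n => 1 / ((n : ℝ) + 1) with hh
  have hpos : ∀ n, 0 < h n := fun n => by positivity
  set N : ℕ → ℝ → ℕ := fun n t => ⌊t * ((n : ℝ) + 1)⌋₊ with hN
  set X : ℕ → ℝ → E := fun n t => eulerStep f (h n) x₀ (N n t) with hX
  have hstep : ∀ n k l, k ≤ l → ‖eulerStep f (h n) x₀ l - eulerStep f (h n) x₀ k‖ ≤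
      C * ((l - k : ℝ) * h n) := fun n k l hkl => by
    simpa using norm_eulerStep_sub_le (f := f) (x₀ := x₀) (w := 0) (ε := C) (hpos n).le hkl
      (fun i _ _ => by simpa using hC _)
  have hNh : ∀ t, 0 ≤ t → Tendsto (fun n => (N n t : ℝ) * h n) atTop (𝓝 t) := by
    intro t ht
    have h1 := (tendsto_nat_floor_mul_div_atTop ht).comp
      (tendsto_atTop_add_const_right atTop (1 : ℝ) (tendsto_natCast_atTop_atTop (R := ℝ)))
    refine h1.congr fun n => ?_
    simp only [Function.comp_apply, hN, hh]
    ring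
  have hbdd : ∀ n t, X n t ∈ Metric.closedBall x₀ (C * |t|) := by
    intro n t
    rw [Metric.mem_closedBall, dist_eq_norm]
    have h1 := hstep n 0 (N n t) (Nat.zero_le _)
    refine h1.trans (mul_le_mul_of_nonneg_left ?_ hC0)
    simp only [Nat.cast_zero, sub_zero, hN, hh]
    rw [mul_one_div, div_le_iff₀ (by positivity)]
    rcases le_total 0 t with ht | ht
    · rw [abs_of_nonneg ht]
      exact Nat.floor_le (by positivity)
    · rw [Nat.floor_of_nonpos (mul_nonpos_of_nonpos_of_nonneg ht (by positivity))]
      simp only [Nat.cast_zero]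
      positivity
  -- Limits along a nonprincipal ultrafilter exist at all times simultaneously, by compactness of
  -- balls; no equicontinuous subsequence has to be extracted.
  set U : Ultrafilter ℕ := hyperfilter ℕ with hU
  have hUle : (U : Filter ℕ) ≤ atTop := Nat.hyperfilter_le_atTop
  have hlim : ∀ t, ∃ y, Tendsto (fun n => X n t) U (𝓝 y) := by
    intro t
    obtain ⟨y, -, hy⟩ := (isCompact_closedBall x₀ (C * |t|)).ultrafilter_le_nhds
      (U.map fun n => X n t) (by
        rw [Ultrafilter.coe_map, le_principal_iff]
        exact Filter.mem_map.2 (Filter.univ_mem' fun n => hbdd n t))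
    exact ⟨y, hy⟩
  choose x hx using hlim
  refine ⟨x, ?_, fun s hs => ?_⟩
  · refine tendsto_nhds_unique (hx 0) ?_
    have : (fun n => X n 0) = fun _ => x₀ := by
      funext n
      simp [hX, hN, eulerStep]
    rw [this]
    exact tendsto_const_nhds
  -- Over a short time the Euler points stay near x s, so every step uses a vector within ε of f (x
  -- s); this estimate passes to the limit.
  have hmain : ∀ ε > 0, ∃ δ > 0, ∀ t, 0 ≤ t → C * |t - s| < δ →
      ‖x t - x s - (t - s) • f (x s)‖ ≤ ε * |t - s| := by
    intro ε hε
    obtain ⟨δ, hδ, hfδ⟩ := Metric.continuous_iff.1 hf (x s) ε hε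
    refine ⟨δ / 2, by positivity, fun t ht hts => ?_⟩
    have hNts : Tendsto (fun n => ((N n t : ℝ) - N n s) * h n) U (𝓝 (t - s)) := by
      refine (((hNh t ht).sub (hNh s hs)).mono_left hUle).congr fun n => ?_
      ring
    have ev1 : ∀ᶠ n in (U : Filter ℕ), ‖X n s - x s‖ < δ / 2 := by
      have := (Metric.tendsto_nhds.1 (hx s)) (δ / 2) (by positivity)
      simpa [dist_eq_norm] using this
    have ev2 : ∀ᶠ n in (U : Filter ℕ), C * |((N n t : ℝ) - N n s) * h n| < δ / 2 :=
      (hNts.abs.const_mul C).eventually_lt_const hts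
    have hclose : ∀ n, ‖X n s - x s‖ < δ / 2 → C * |((N n t : ℝ) - N n s) * h n| < δ / 2 →
        ∀ i, ‖eulerStep f (h n) x₀ i - X n s‖ ≤ C * |((N n t : ℝ) - N n s) * h n| →
        ‖f (eulerStep f (h n) x₀ i) - f (x s)‖ ≤ ε := by
      intro n h1 h2 i h3
      rw [← dist_eq_norm]
      refine (hfδ _ ?_).le
      rw [dist_eq_norm]
      calc ‖eulerStep f (h n) x₀ i - x s‖
          = ‖(eulerStep f (h n) x₀ i - X n s) + (X n s - x s)‖ := by congr 1; abel
        _ ≤ _ := norm_add_le _ _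
        _ < δ := by linarith
    have hfin : ∀ᶠ n in (U : Filter ℕ),
        ‖X n t - X n s - (((N n t : ℝ) - N n s) * h n) • f (x s)‖ ≤
          ε * |((N n t : ℝ) - N n s) * h n| := by
      filter_upwards [ev1, ev2] with n h1 h2
      rcases le_total s t with hst | hst
      · have hle : N n s ≤ N n t := Nat.floor_le_floor (by gcongr)
        have hle' : (N n s : ℝ) ≤ N n t := by exact_mod_cast hle
        have hnn : 0 ≤ ((N n t : ℝ) - N n s) * h n :=
          mul_nonneg (sub_nonneg.2 hle') (hpos n).le
        have := norm_eulerStep_sub_le (f := f) (x₀ := x₀) (w := f (x s)) (ε := ε) (hpos n).le hle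
          (fun i hi hil => hclose n h1 h2 i (by
            refine (hstep n _ i hi).trans ?_
            rw [abs_of_nonneg hnn]
            have hil' : (i : ℝ) ≤ N n t := by exact_mod_cast hil.le
            have := (hpos n).le
            gcongr))
        rwa [abs_of_nonneg hnn]
      · have hle : N n t ≤ N n s := Nat.floor_le_floor (by gcongr)
        have hle' : (N n t : ℝ) ≤ N n s := by exact_mod_cast hle
        have hnn : ((N n t : ℝ) - N n s) * h n ≤ 0 :=
          mul_nonpos_of_nonpos_of_nonneg (sub_nonpos.2 hle') (hpos n).le
        have := norm_eulerStep_sub_le (f := f) (x₀ := x₀) (w := f (x s)) (ε := ε) (hpos n).le hle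
          (fun i hi hil => hclose n h1 h2 i (by
            rw [norm_sub_rev]
            refine (hstep n i _ hil.le).trans ?_
            rw [abs_of_nonpos hnn, ← neg_mul, neg_sub]
            have hi' : (N n t : ℝ) ≤ i := by exact_mod_cast hi
            have := (hpos n).le
            gcongr))
        rw [abs_of_nonpos hnn, ← neg_mul, neg_sub, ← norm_neg (X n t - X n s - _)]
        refine le_of_eq_of_le (congrArg norm ?_) this
        module
    refine le_of_tendsto_of_tendsto ?_ ?_ hfin
    · exact (((hx t).sub (hx s)).sub (hNts.smul_const _)).norm
    · exact hNts.abs.const_mul ε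
  rw [hasDerivWithinAt_iff_isLittleO, Asymptotics.isLittleO_iff]
  intro ε hε
  obtain ⟨δ, hδ, hmain⟩ := hmain ε hε
  have hcont : Tendsto (fun t => C * |t - s|) (𝓝[Set.Ici 0] s) (𝓝 0) := by
    have : Tendsto (fun t => C * |t - s|) (𝓝 s) (𝓝 (C * |s - s|)) :=
      Continuous.tendsto (by fun_prop) s
    simpa using this.mono_left nhdsWithin_le_nhds
  filter_upwards [hcont.eventually_lt_const hδ, self_mem_nhdsWithin] with t ht ht0
  exact hmain t ht0 ht

end Peano

/-! ### Zeros of monotone fields on a box -/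

section MonotoneZero

variable {ι : Type*}

/-- The projected Euler scheme for the field `-K` on the box `[a, b]^ι`. -/
noncomputable def projStep (K : (ι → ℝ) → ι → ℝ) (a b h : ℝ) : ℕ → ι → ℝ
  | 0 => fun _ => a
  | k + 1 => fun i =>
      max a (min b (projStep K a b h k i - h * K (projStep K a b h k) i))

theorem projStep_mem {K : (ι → ℝ) → ι → ℝ} {a b h : ℝ} (hab : a ≤ b) (k : ℕ) (i : ι) :
    projStep K a b h k i ∈ Set.Icc a b := by
  cases k with
  | zero => exact ⟨le_rfl, hab⟩
  | succ k => exact ⟨le_max_left _ _, max_le hab (min_le_left _ _)⟩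

theorem clamp_sub_sq_le {a b x y : ℝ} (hy : y ∈ Set.Icc a b) :
    (max a (min b x) - y) ^ 2 ≤ (x - y) ^ 2 := by
  have h1 := hy.1
  have h2 := hy.2
  rcases max_cases a (min b x) with h | h <;> rcases min_cases b x with g | g <;>
    rw [h.1] <;> (try rw [g.1]) <;> nlinarith

/-- Projection onto the box does not increase the distance to y. Expanding the squared distance
after one step, monotonicity replaces K x by K y, and the inequalities telescope. -/
theorem projStep_le [Fintype ι] {K : (ι → ℝ) → ι → ℝ} {a b h C : ℝ} (hab : a ≤ b) (hh : 0 ≤ h)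
    (hC : ∀ x, (∀ i, x i ∈ Set.Icc a b) → ∑ i, K x i ^ 2 ≤ C)
    (hmono : ∀ x y, (∀ i, x i ∈ Set.Icc a b) → (∀ i, y i ∈ Set.Icc a b) →
      0 ≤ ∑ i, (K x i - K y i) * (x i - y i))
    {y : ι → ℝ} (hy : ∀ i, y i ∈ Set.Icc a b) (n : ℕ) :
    2 * h * ∑ k ∈ range n, ∑ i, K y i * (projStep K a b h k i - y i) ≤
      ∑ i, (a - y i) ^ 2 - ∑ i, (projStep K a b h n i - y i) ^ 2 + n * (h ^ 2 * C) := by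
  induction n with
  | zero => simp [projStep]
  | succ n ih =>
    rw [Finset.sum_range_succ, mul_add]
    set x := projStep K a b h n with hx
    have hxm : ∀ i, x i ∈ Set.Icc a b := projStep_mem hab n
    have h1 : ∑ i, (projStep K a b h (n + 1) i - y i) ^ 2 ≤
        ∑ i, (x i - h * K x i - y i) ^ 2 := Finset.sum_le_sum fun i _ => clamp_sub_sq_le (hy i)
    have h2 : ∑ i, (x i - h * K x i - y i) ^ 2 = ∑ i, (x i - y i) ^ 2 -
        2 * h * ∑ i, (K x i - K y i) * (x i - y i) - 2 * h * ∑ i, K y i * (x i - y i) +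
        h ^ 2 * ∑ i, K x i ^ 2 := by
      simp only [Finset.mul_sum, ← Finset.sum_sub_distrib, ← Finset.sum_add_distrib]
      refine Finset.sum_congr rfl fun i _ => ?_
      ring
    have h3 := hmono x y hxm hy
    have h4 := mul_le_mul_of_nonneg_left (hC x hxm) (sq_nonneg h)
    have h5 : 0 ≤ 2 * h * ∑ i, (K x i - K y i) * (x i - y i) := by positivity
    push_cast
    linarith

/-- A continuous monotone field on a box that points outwards at the boundary has a zero. -/
theorem exists_zero_of_monotone [Fintype ι] {K : (ι → ℝ) → ι → ℝ} {a b : ℝ} (hab : a < b)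
    (hcont : ContinuousOn K {x | ∀ i, x i ∈ Set.Icc a b})
    (hmono : ∀ x y, (∀ i, x i ∈ Set.Icc a b) → (∀ i, y i ∈ Set.Icc a b) →
      0 ≤ ∑ i, (K x i - K y i) * (x i - y i))
    (hlow : ∀ x, (∀ i, x i ∈ Set.Icc a b) → ∀ i, x i = a → K x i < 0)
    (hup : ∀ x, (∀ i, x i ∈ Set.Icc a b) → ∀ i, x i = b → 0 < K x i) :
    ∃ x, (∀ i, x i ∈ Set.Icc a b) ∧ ∀ i, K x i = 0 := by
  have hB : {x : ι → ℝ | ∀ i, x i ∈ Set.Icc a b} = Set.univ.pi fun _ => Set.Icc a b := by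
    ext x
    exact ⟨fun h i _ => h i, fun h i => h i trivial⟩
  have hBc : IsCompact {x : ι → ℝ | ∀ i, x i ∈ Set.Icc a b} := by
    rw [hB]; exact isCompact_univ_pi fun _ => isCompact_Icc
  have hcoord : ∀ i, ContinuousOn (fun x => K x i) {x | ∀ i, x i ∈ Set.Icc a b} := fun i =>
    (continuous_apply i).comp_continuousOn hcont
  obtain ⟨C, hC⟩ := hBc.bddAbove_image (f := fun x => ∑ i, K x i ^ 2)
    (continuousOn_finsetSum _ fun i _ => (hcoord i).pow 2)
  have hC' : ∀ x, (∀ i, x i ∈ Set.Icc a b) → ∑ i, K x i ^ 2 ≤ C := fun x hx =>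
    hC ⟨x, hx, rfl⟩
  set M := ∑ _i : ι, (b - a) ^ 2 + C with hM
  have happrox : ∀ m : ℕ, ∃ x : ι → ℝ, (∀ i, x i ∈ Set.Icc a b) ∧ ∀ y,
      (∀ i, y i ∈ Set.Icc a b) → ∑ i, K y i * (x i - y i) ≤ M / (2 * ((m : ℝ) + 1)) := by
    intro m
    set h : ℝ := 1 / ((m : ℝ) + 1) with hh
    have hh0 : 0 < h := by positivity
    -- With h = 1/(m + 1) and n = (m + 1)² steps, n h² = 1 keeps the error bounded while n h = m + 1
    -- tends to infinity; the average of the iterates is the approximate solution.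
    set n := (m + 1) ^ 2 with hn
    have hn0 : (0 : ℝ) < n := by positivity
    refine ⟨fun i => (∑ k ∈ range n, projStep K a b h k i) / n, fun i => ⟨?_, ?_⟩, fun y hy => ?_⟩
    · rw [le_div_iff₀ hn0]
      have := Finset.card_nsmul_le_sum (range n) (fun k => projStep K a b h k i) a
        fun k _ => (projStep_mem hab.le k i).1
      rw [card_range, nsmul_eq_mul] at this
      linarith
    · rw [div_le_iff₀ hn0]
      have := Finset.sum_le_card_nsmul (range n) (fun k => projStep K a b h k i) b
        fun k _ => (projStep_mem hab.le k i).2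
      rw [card_range, nsmul_eq_mul] at this
      linarith
    · have h1 := projStep_le hab.le hh0.le hC' hmono hy n
      have h2 : ∑ k ∈ range n, ∑ i, K y i * (projStep K a b h k i - y i) =
          n * ∑ i, K y i * ((∑ k ∈ range n, projStep K a b h k i) / n - y i) := by
        rw [Finset.sum_comm, Finset.mul_sum]
        refine Finset.sum_congr rfl fun i _ => ?_
        rw [← Finset.mul_sum, Finset.sum_sub_distrib, Finset.sum_const, card_range, nsmul_eq_mul]
        field_simp
      rw [h2] at h1
      have h3 : ∑ i, (a - y i) ^ 2 ≤ ∑ _i : ι, (b - a) ^ 2 := Finset.sum_le_sum fun i _ => by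
        have := (hy i).1
        have := (hy i).2
        nlinarith
      have h4 : 0 ≤ ∑ i, (projStep K a b h n i - y i) ^ 2 := Finset.sum_nonneg fun i _ => sq_nonneg _
      have h5 : (n : ℝ) * (h ^ 2 * C) = C := by
        rw [hn, hh]; push_cast; field_simp
      have h6 : 2 * h * n = 2 * ((m : ℝ) + 1) := by
        rw [hn, hh]; push_cast; field_simp
      rw [le_div_iff₀ (by positivity), ← h6]
      linarith
  choose x hxB hx using happrox
  obtain ⟨z, hz, φ, hφ, hlim⟩ := hBc.tendsto_subseq hxB
  -- The limit solves the weak (Minty) variational inequality, with K evaluated at y rather than at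
  -- z. Letting y tend to z transfers it to K z.
  have hvar : ∀ y, (∀ i, y i ∈ Set.Icc a b) → ∑ i, K y i * (z i - y i) ≤ 0 := by
    intro y hy
    have h1 : Tendsto (fun m => ∑ i, K y i * (x (φ m) i - y i)) atTop
        (𝓝 (∑ i, K y i * (z i - y i))) := by
      refine tendsto_finsetSum _ fun i _ => ?_
      exact (((tendsto_pi_nhds.1 hlim) i).sub_const _).const_mul _
    have h2 : Tendsto (fun m : ℕ => M / (2 * ((m : ℝ) + 1))) atTop (𝓝 0) := by
      refine Tendsto.div_atTop tendsto_const_nhds ?_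
      exact (tendsto_atTop_add_const_right _ _ tendsto_natCast_atTop_atTop).const_mul_atTop two_pos
    exact le_of_tendsto_of_tendsto' h1 (h2.comp hφ.tendsto_atTop) fun m => hx (φ m) y hy
  refine ⟨z, hz, fun i => ?_⟩
  classical
  -- the variational inequality along the `i`-th coordinate direction
  have hdir : ∀ σ : ℝ, (∃ s₀ > 0, ∀ s ∈ Set.Ioo 0 s₀, z i + s * σ ∈ Set.Icc a b) →
      0 ≤ K z i * σ := by
    rintro σ ⟨s₀, hs₀, hs⟩
    have hmem : ∀ s ∈ Set.Ioo 0 s₀, ∀ j, Function.update z i (z i + s * σ) j ∈ Set.Icc a b := by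
      intro s hs' j
      by_cases hj : j = i
      · subst hj; rw [Function.update_self]; exact hs s hs'
      · rw [Function.update_of_ne hj]; exact hz j
    have hne : (𝓝[Set.Ioo 0 s₀] (0 : ℝ)).NeBot := left_nhdsWithin_Ioo_neBot hs₀
    have hupd : Continuous fun s : ℝ => Function.update z i (z i + s * σ) :=
      continuous_const.update i (by fun_prop)
    have h1 : Tendsto (fun s : ℝ => Function.update z i (z i + s * σ)) (𝓝[Set.Ioo 0 s₀] 0)
        (𝓝[{x | ∀ i, x i ∈ Set.Icc a b}] z) := by
      refine tendsto_nhdsWithin_iff.2 ⟨?_, ?_⟩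
      · have := hupd.tendsto 0
        simp only [zero_mul, add_zero, Function.update_eq_self] at this
        exact this.mono_left nhdsWithin_le_nhds
      · filter_upwards [self_mem_nhdsWithin] with s hs' using hmem s hs'
    have h2 := ((hcoord i z hz).tendsto.comp h1).mul_const σ
    refine ge_of_tendsto h2 ?_
    filter_upwards [self_mem_nhdsWithin] with s hs'
    have h3 := hvar _ (hmem s hs')
    rw [Finset.sum_eq_single i (fun j _ hj => by rw [Function.update_of_ne hj]; ring) (by simp),
      Function.update_self] at h3
    have h4 := hs'.1
    simp only [Function.comp_apply]
    by_contra hcon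
    push Not at hcon
    nlinarith
  by_contra hne
  -- The boundary conditions make the direction opposite to the sign of K z i admissible at z, which
  -- contradicts the inequality.
  rcases lt_or_gt_of_ne hne with hlt | hgt
  · have hzb : z i < b := lt_of_le_of_ne (hz i).2 fun h => by linarith [hup z hz i h]
    have := hdir 1 ⟨b - z i, by linarith, fun s hs => ⟨by linarith [hs.1, (hz i).1], by
      linarith [hs.2]⟩⟩
    linarith
  · have hza : a < z i := lt_of_le_of_ne (hz i).1 fun h => by linarith [hlow z hz i h.symm]
    have := hdir (-1) ⟨z i - a, by linarith, fun s hs => ⟨by linarith [hs.2], by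
      linarith [hs.1, (hz i).2]⟩⟩
    linarith

end MonotoneZero

/-! ### The flow on an invariant box -/

section Flow

variable {ι : Type*}

/-- A box whose boundary the field `K` crosses outwards is invariant under `r' = -K(r) sinh r`. -/
theorem flow_mem_box [Finite ι] {K : (ι → ℝ) → ι → ℝ} {a b : ℝ} (ha : 0 < a) (hab : a ≤ b)
    (hlow : ∀ x, (∀ i, x i ∈ Set.Icc a b) → ∀ i, x i = a → K x i < 0)
    (hup : ∀ x, (∀ i, x i ∈ Set.Icc a b) → ∀ i, x i = b → 0 < K x i) {r : ℝ → ι → ℝ}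
    (h0 : ∀ i, r 0 i ∈ Set.Icc a b) (hc : ∀ i, ContinuousOn (fun t => r t i) (Set.Ici 0))
    (hd : ∀ t, 0 ≤ t → (∀ i, r t i ∈ Set.Icc a b) → ∀ i, HasDerivWithinAt (fun s => r s i)
      (-K (r t) i * Real.sinh (r t i)) (Set.Ici 0) t) {t : ℝ} (ht : 0 ≤ t) (i : ι) :
    r t i ∈ Set.Icc a b := by
  have hci : ∀ i, ContinuousOn (fun t => r t i) (Set.Icc 0 t) := fun i =>
    (hc i).mono Set.Icc_subset_Ici_self
  have key := forall_nonpos_of_barrier (ι := ι ⊕ ι) (a := 0) (b := t)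
    (g := fun s => Sum.elim (fun i => a - r s i) (fun i => r s i - b))
    (by
      rintro (i | i)
      · exact continuousOn_const.sub (hci i)
      · exact (hci i).sub continuousOn_const)
    (by
      rintro (i | i)
      · simpa using (h0 i).1
      · simpa using (h0 i).2)
    (by
      intro s hs hle i hi
      have hbox : ∀ i, r s i ∈ Set.Icc a b := fun i =>
        ⟨sub_nonpos.1 (hle (Sum.inl i)), sub_nonpos.1 (hle (Sum.inr i))⟩
      rcases i with i | i
      · have heq : r s i = a := by simp only [Sum.elim_inl] at hi; linarith
        have hder := (hd s hs.1 hbox i).mono (Set.Ici_subset_Ici.2 hs.1)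
        refine ⟨_, ?_, hder.const_sub a⟩
        have h1 := hlow _ hbox i heq
        have h2 : 0 < Real.sinh (r s i) := Real.sinh_pos_iff.2 (by linarith)
        nlinarith
      · have heq : r s i = b := by simp only [Sum.elim_inr] at hi; linarith
        have hder := (hd s hs.1 hbox i).mono (Set.Ici_subset_Ici.2 hs.1)
        refine ⟨_, ?_, hder.sub_const b⟩
        have h1 := hup _ hbox i heq
        have h2 : 0 < Real.sinh (r s i) := Real.sinh_pos_iff.2 (by linarith)
        nlinarith)
    t ⟨ht, le_rfl⟩
  exact ⟨sub_nonpos.1 (key (Sum.inl i)), sub_nonpos.1 (key (Sum.inr i))⟩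

theorem exists_flow [Fintype ι] {K : (ι → ℝ) → ι → ℝ} {a b : ℝ} (ha : 0 < a) (hab : a ≤ b)
    (hcont : ContinuousOn K {x | ∀ i, x i ∈ Set.Icc a b})
    (hlow : ∀ x, (∀ i, x i ∈ Set.Icc a b) → ∀ i, x i = a → K x i < 0)
    (hup : ∀ x, (∀ i, x i ∈ Set.Icc a b) → ∀ i, x i = b → 0 < K x i) {r₀ : ι → ℝ}
    (h0 : ∀ i, r₀ i ∈ Set.Icc a b) :
    ∃ r : ℝ → ι → ℝ, r 0 = r₀ ∧ (∀ t, 0 ≤ t → ∀ i, r t i ∈ Set.Icc a b) ∧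
      ∀ t, 0 ≤ t → ∀ i, HasDerivWithinAt (fun s => r s i)
        (-K (r t) i * Real.sinh (r t i)) (Set.Ici 0) t := by
  -- Composing with the retraction onto the box makes the field continuous and bounded everywhere. A
  -- solution starting in the box never leaves it, so it solves the original equation.
  set cl : (ι → ℝ) → ι → ℝ := fun x i => max a (min b (x i)) with hcl
  have hclc : Continuous cl := by fun_prop
  have hclB : ∀ x i, cl x i ∈ Set.Icc a b := fun x i =>
    ⟨le_max_left _ _, max_le hab (min_le_left _ _)⟩
  have hclid : ∀ x, (∀ i, x i ∈ Set.Icc a b) → cl x = x := fun x hx => by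
    funext i
    simp only [hcl]
    rw [min_eq_right (hx i).2, max_eq_right (hx i).1]
  have hBc : IsCompact {x : ι → ℝ | ∀ i, x i ∈ Set.Icc a b} := by
    have hB : {x : ι → ℝ | ∀ i, x i ∈ Set.Icc a b} = Set.univ.pi fun _ => Set.Icc a b := by
      ext x
      exact ⟨fun h i _ => h i, fun h i => h i trivial⟩
    rw [hB]; exact isCompact_univ_pi fun _ => isCompact_Icc
  set F : (ι → ℝ) → ι → ℝ := fun x i => -K x i * Real.sinh (x i) with hF
  have hFc : ContinuousOn F {x | ∀ i, x i ∈ Set.Icc a b} := by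
    refine continuousOn_pi.2 fun i => ?_
    exact ((continuous_apply i).comp_continuousOn hcont).neg.mul
      (Real.continuous_sinh.comp (continuous_apply i)).continuousOn
  obtain ⟨C, hC⟩ := hBc.exists_bound_of_continuousOn hFc
  obtain ⟨r, hr0, hr⟩ := exists_hasDerivWithinAt_of_continuous_of_bounded (f := F ∘ cl)
    (hFc.comp_continuous hclc hclB) (C := C) (fun x => hC _ (hclB x)) r₀
  have hri : ∀ t, 0 ≤ t → ∀ i, HasDerivWithinAt (fun s => r s i) (F (cl (r t)) i) (Set.Ici 0) t :=
    fun t ht i => (hasDerivWithinAt_pi.1 (hr t ht)) i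
  have hbox : ∀ t, 0 ≤ t → ∀ i, r t i ∈ Set.Icc a b := fun t ht i =>
    flow_mem_box ha hab hlow hup (by rw [hr0]; exact h0)
      (fun i s hs => (hri s hs i).continuousWithinAt)
      (fun s hs hb i => by
        have := hri s hs i
        rwa [hclid _ hb] at this) ht i
  refine ⟨r, hr0, hbox, fun t ht i => ?_⟩
  have := hri t ht i
  rwa [hclid _ (hbox t ht)] at this

/-- If the derivative of `h` is `(x - z) k(x)` with `k ≥ 0`, then `h` is minimal at `z`. -/
theorem le_of_hasDerivAt_sub_mul {h k : ℝ → ℝ} {a b z x : ℝ} (hz : z ∈ Set.Icc a b)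
    (hx : x ∈ Set.Icc a b) (hd : ∀ u, HasDerivAt h ((u - z) * k u) u)
    (hk : ∀ u ∈ Set.Icc a b, 0 ≤ k u) : h z ≤ h x := by
  have hcont : Continuous h := continuous_iff_continuousAt.2 fun u => (hd u).continuousAt
  rcases lt_trichotomy x z with hlt | rfl | hgt
  · obtain ⟨c, hc, hc'⟩ := exists_hasDerivAt_eq_slope h _ hlt hcont.continuousOn fun u _ => hd u
    rw [eq_div_iff (by linarith)] at hc'
    have h1 := hk c ⟨hx.1.trans hc.1.le, hc.2.le.trans hz.2⟩
    have h2 : (c - z) * k c * (z - x) ≤ 0 :=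
      mul_nonpos_of_nonpos_of_nonneg
        (mul_nonpos_of_nonpos_of_nonneg (by linarith [hc.2]) h1) (by linarith)
    linarith
  · exact le_rfl
  · obtain ⟨c, hc, hc'⟩ := exists_hasDerivAt_eq_slope h _ hgt hcont.continuousOn fun u _ => hd u
    rw [eq_div_iff (by linarith)] at hc'
    have h1 := hk c ⟨hz.1.trans hc.1.le, hc.2.le.trans hx.2⟩
    have h2 : 0 ≤ (c - z) * k c * (x - z) :=
      mul_nonneg (mul_nonneg (by linarith [hc.1]) h1) (by linarith)
    linarith

/-- A primitive of `(x - z) / sinh x`, which is comparable with `(x - z)²`. -/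
theorem exists_energy {a b : ℝ} (ha : 0 < a) (hab : a ≤ b) {z : ℝ} (hz : z ∈ Set.Icc a b) :
    ∃ G : ℝ → ℝ, (∀ x ∈ Set.Icc a b, HasDerivAt G ((x - z) / Real.sinh x) x) ∧
      ∀ x ∈ Set.Icc a b, (x - z) ^ 2 / (2 * Real.sinh b) ≤ G x ∧
        G x ≤ (x - z) ^ 2 / (2 * Real.sinh a) := by
  have hsa : 0 < Real.sinh a := Real.sinh_pos_iff.2 ha
  have hsb : 0 < Real.sinh b := Real.sinh_pos_iff.2 (ha.trans_le hab)
  have hsm : ∀ x, 0 < Real.sinh (max x a) := fun x =>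
    Real.sinh_pos_iff.2 (ha.trans_le (le_max_right _ _))
  -- The maximum with a keeps sinh away from 0, so the integrand is continuous on the whole line; it
  -- changes nothing on [a, b].
  set φ : ℝ → ℝ := fun x => (x - z) * (1 / Real.sinh (max x a)) with hφ
  have hφc : Continuous φ := by
    refine (continuous_id.sub continuous_const).mul (continuous_const.div ?_ fun x => (hsm x).ne')
    exact Real.continuous_sinh.comp (continuous_id.max continuous_const)
  have hG : ∀ x, HasDerivAt (fun x => ∫ u in z..x, φ u) (φ x) x := fun x =>
    intervalIntegral.integral_hasDerivAt_right (hφc.intervalIntegrable _ _)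
      (hφc.stronglyMeasurableAtFilter _ _) hφc.continuousAt
  have hsq : ∀ (c x : ℝ), HasDerivAt (fun x => (x - z) ^ 2 / (2 * c)) ((x - z) / c) x := by
    intro c x
    refine ((((hasDerivAt_id x).sub_const z).fun_pow 2).div_const (2 * c)).congr_deriv ?_
    simp only [id]
    rcases eq_or_ne c 0 with rfl | hc
    · simp
    · field_simp
      push_cast
      ring
  refine ⟨fun x => ∫ u in z..x, φ u, fun x hx => ?_, fun x hx => ⟨?_, ?_⟩⟩
  · refine (hG x).congr_deriv ?_
    simp only [hφ, max_eq_left hx.1, mul_one_div]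
  · have := le_of_hasDerivAt_sub_mul (k := fun u => 1 / Real.sinh (max u a) - 1 / Real.sinh b)
      (h := fun x => (∫ u in z..x, φ u) - (x - z) ^ 2 / (2 * Real.sinh b)) hz hx
      (fun u => ((hG u).fun_sub (hsq (Real.sinh b) u)).congr_deriv (by simp only [hφ]; ring))
      (fun u hu => by
        rw [max_eq_left hu.1, sub_nonneg]
        exact one_div_le_one_div_of_le (by have := hsm u; rwa [max_eq_left hu.1] at this)
          (Real.sinh_le_sinh.2 hu.2))
    simp at this
    linarith
  · have := le_of_hasDerivAt_sub_mul (k := fun u => 1 / Real.sinh a - 1 / Real.sinh (max u a))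
      (h := fun x => (x - z) ^ 2 / (2 * Real.sinh a) - (∫ u in z..x, φ u)) hz hx
      (fun u => ((hsq (Real.sinh a) u).fun_sub (hG u)).congr_deriv (by simp only [hφ]; ring))
      (fun u hu => by
        rw [max_eq_left hu.1, sub_nonneg]
        exact one_div_le_one_div_of_le hsa (Real.sinh_le_sinh.2 hu.1))
    simp at this
    linarith

theorem exp_decay_of_deriv_le {L L' : ℝ → ℝ} {κ : ℝ}
    (hd : ∀ t, 0 ≤ t → HasDerivWithinAt L (L' t) (Set.Ici 0) t)
    (hle : ∀ t, 0 ≤ t → L' t ≤ -κ * L t) {t : ℝ} (ht : 0 ≤ t) :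
    L t ≤ L 0 * Real.exp (-κ * t) := by
  have hexp : ∀ t, HasDerivAt (fun t => Real.exp (κ * t)) (Real.exp (κ * t) * κ) t := fun t => by
    simpa using ((hasDerivAt_id t).const_mul κ).exp
  have hprod : ∀ t, 0 ≤ t → HasDerivWithinAt (fun t => L t * Real.exp (κ * t))
      (L' t * Real.exp (κ * t) + L t * (Real.exp (κ * t) * κ)) (Set.Ici 0) t := fun t ht =>
    (hd t ht).fun_mul (hexp t).hasDerivWithinAt
  have hanti : AntitoneOn (fun t => L t * Real.exp (κ * t)) (Set.Ici 0) := by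
    refine antitoneOn_of_hasDerivWithinAt_nonpos
      (f' := fun t => L' t * Real.exp (κ * t) + L t * (Real.exp (κ * t) * κ)) (convex_Ici 0)
      (fun t ht => (hprod t ht).continuousWithinAt) ?_ ?_
    · intro t ht
      exact (hprod t (interior_subset ht)).mono interior_subset
    · intro t ht
      have h1 := hle t (interior_subset ht)
      have h2 := Real.exp_pos (κ * t)
      nlinarith
  have := hanti (Set.mem_Ici.2 le_rfl) ht ht
  simp only [mul_zero, Real.exp_zero, mul_one] at this
  rw [neg_mul, Real.exp_neg, ← div_eq_mul_inv, le_div_iff₀ (Real.exp_pos _)]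
  exact this

/-- Solutions of `r' = -K(r) sinh r` in a box converge exponentially to a point `z` where `K` is
strongly monotone relative to `z` and vanishes. -/
theorem flow_exp_convergence [Fintype ι] {K : (ι → ℝ) → ι → ℝ} {a b c : ℝ} (ha : 0 < a)
    (hab : a ≤ b) (hc : 0 < c) {z : ι → ℝ} (hz : ∀ i, z i ∈ Set.Icc a b)
    (hstrong : ∀ x, (∀ i, x i ∈ Set.Icc a b) →
      c * ∑ i, (x i - z i) ^ 2 ≤ ∑ i, K x i * (x i - z i))
    {r : ℝ → ι → ℝ} (hbox : ∀ t, 0 ≤ t → ∀ i, r t i ∈ Set.Icc a b)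
    (hd : ∀ t, 0 ≤ t → ∀ i, HasDerivWithinAt (fun s => r s i)
        (-K (r t) i * Real.sinh (r t i)) (Set.Ici 0) t) :
    ∃ C > (0 : ℝ), ∃ κ > (0 : ℝ), ∀ t, 0 ≤ t → ∀ i, |r t i - z i| ≤ C * Real.exp (-κ * t) := by
  have hsa : 0 < Real.sinh a := Real.sinh_pos_iff.2 ha
  have hsb : 0 < Real.sinh b := Real.sinh_pos_iff.2 (ha.trans_le hab)
  choose G hG hGb using fun i => exists_energy ha hab (hz i)
  set L : ℝ → ℝ := fun t => ∑ i, G i (r t i) with hL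
  -- The factor sinh of the flow cancels the denominator in the derivative of the energy.
  have hLd : ∀ t, 0 ≤ t → HasDerivWithinAt L (-∑ i, K (r t) i * (r t i - z i)) (Set.Ici 0) t := by
    intro t ht
    have h1 : ∀ i, HasDerivWithinAt (fun s => G i (r s i))
        ((r t i - z i) / Real.sinh (r t i) * (-K (r t) i * Real.sinh (r t i))) (Set.Ici 0) t :=
      fun i => (hG i _ (hbox t ht i)).comp_hasDerivWithinAt t (hd t ht i)
    refine (HasDerivWithinAt.fun_sum fun i _ => h1 i).congr_deriv ?_
    rw [← Finset.sum_neg_distrib]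
    refine Finset.sum_congr rfl fun i _ => ?_
    have : Real.sinh (r t i) ≠ 0 :=
      (Real.sinh_pos_iff.2 (ha.trans_le (hbox t ht i).1)).ne'
    field_simp
  -- The energy is at most Σ (r_i - z_i)²/(2 sinh a), which converts strong monotonicity into L' ≤
  -- -κ L. Distances are square roots of energies, hence the rate κ/2 below.
  set κ := c * (2 * Real.sinh a) with hκ
  have hκ0 : 0 < κ := by positivity
  have hdecay := fun t (ht : 0 ≤ t) => exp_decay_of_deriv_le (κ := κ) hLd (fun t ht => by
    have h1 := hstrong _ (hbox t ht)
    have h2 : L t ≤ (∑ i, (r t i - z i) ^ 2) / (2 * Real.sinh a) := by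
      rw [Finset.sum_div]
      exact Finset.sum_le_sum fun i _ => (hGb i _ (hbox t ht i)).2
    have h3 : κ * L t ≤ c * ∑ i, (r t i - z i) ^ 2 := by
      calc κ * L t ≤ κ * ((∑ i, (r t i - z i) ^ 2) / (2 * Real.sinh a)) := by gcongr
        _ = _ := by rw [hκ]; field_simp
    linarith) ht
  have hGnn : ∀ t, 0 ≤ t → ∀ i, 0 ≤ G i (r t i) := fun t ht i =>
    (by positivity : 0 ≤ (r t i - z i) ^ 2 / (2 * Real.sinh b)).trans (hGb i _ (hbox t ht i)).1
  have hL0 : 0 ≤ L 0 := Finset.sum_nonneg fun i _ => hGnn 0 le_rfl i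
  -- The summand 1 makes the constant positive even if the flow starts at z.
  refine ⟨√(2 * Real.sinh b * L 0) + 1, by positivity, κ / 2, by positivity, fun t ht i => ?_⟩
  have h1 : (r t i - z i) ^ 2 / (2 * Real.sinh b) ≤ L 0 * Real.exp (-κ * t) :=
    ((hGb i _ (hbox t ht i)).1.trans (Finset.single_le_sum
      (f := fun i => G i (r t i)) (fun j _ => hGnn t ht j) (Finset.mem_univ i))).trans
      (hdecay t ht)
  rw [div_le_iff₀ (by positivity)] at h1
  have hE : Real.exp (-(κ / 2) * t) ^ 2 = Real.exp (-κ * t) := by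
    rw [← Real.exp_nat_mul]
    congr 1
    push_cast
    ring
  have h2 : (r t i - z i) ^ 2 ≤ (√(2 * Real.sinh b * L 0) * Real.exp (-(κ / 2) * t)) ^ 2 := by
    rw [mul_pow, Real.sq_sqrt (by positivity), hE]
    linarith
  refine (abs_le_of_sq_le_sq h2 (by positivity)).trans ?_
  have := Real.exp_pos (-(κ / 2) * t)
  gcongr
  linarith

end Flow

/-! ### Curvature of a triangulation -/

namespace Triangulation

open TetraPacking

variable {M : Type*} [TopologicalSpace M] (T : Triangulation M)

instance : Finite T.Vertex := by
  have : Finite T.complex.faces := T.finite_faces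
  refine Finite.of_injective (β := T.complex.faces) (fun v => ⟨{v.1}, v.2⟩) fun v w h => ?_
  exact Subtype.ext (Finset.singleton_injective (congrArg Subtype.val h))

theorem exists_corner_eq (s : T.Tetra) (i : T.Vertex) (h : i.1 ∈ s.1) : ∃ m, T.corner s m = i :=
  ⟨s.1.equivFinOfCardEq s.2.2 ⟨i.1, h⟩, Subtype.ext (by simp [corner])⟩

open Classical in
theorem tetraDegree_le_card (i : T.Vertex) :
    T.tetraDegree i ≤ #{c : T.Tetra × Fin 4 | T.corner c.1 c.2 = i} := by
  choose m hm using fun s : {s : T.Tetra // i.1 ∈ s.1} => T.exists_corner_eq s.1 i s.2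
  rw [tetraDegree, Nat.card_eq_fintype_card, ← Finset.card_univ]
  refine Finset.card_le_card_of_injOn (fun s => (s.1, m s)) (fun s _ => ?_) fun s _ t _ h => ?_
  · simpa using hm s
  · exact Subtype.ext (congrArg Prod.fst h)

theorem exists_corner_eq_of_degree {i : T.Vertex} (h : 0 < T.tetraDegree i) :
    ∃ s m, T.corner s m = i := by
  obtain ⟨s⟩ := (Nat.card_pos_iff.1 h).1
  exact ⟨s.1, T.exists_corner_eq s.1 i s.2⟩

open Classical in
theorem extCurvature_eq {r : T.Vertex → ℝ} (hr : T.IsBallPacking r) (i : T.Vertex) :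
    T.extCurvature r i = 4 * Real.pi - ∑ c : T.Tetra × Fin 4 with T.corner c.1 c.2 = i,
      ballAngle (fun m => r (T.corner c.1 m)) c.2 := by
  rw [extCurvature]
  congr 1
  exact Finset.sum_congr rfl fun c _ => extSolidAngle_eq (fun m => hr _) _

theorem continuousOn_extCurvature : ContinuousOn T.extCurvature {r | T.IsBallPacking r} := by
  classical
  intro r hr
  have key : ContinuousAt (fun (r : T.Vertex → ℝ) i => 4 * Real.pi -
      ∑ c : T.Tetra × Fin 4 with T.corner c.1 c.2 = i,
        ballAngle (fun m => r (T.corner c.1 m)) c.2) r := by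
    refine continuousAt_pi.2 fun i => continuousAt_const.sub (tendsto_finsetSum _ fun c _ => ?_)
    have hg : Continuous fun (r : T.Vertex → ℝ) (m : Fin 4) => r (T.corner c.1 m) := by fun_prop
    exact ContinuousAt.comp (f := fun (r : T.Vertex → ℝ) (m : Fin 4) => r (T.corner c.1 m))
      (g := fun r => ballAngle r c.2) (continuousAt_ballAngle (fun m => hr _) c.2) hg.continuousAt
  exact key.continuousWithinAt.congr (fun s hs => funext fun i => T.extCurvature_eq hs i)
    (funext fun i => T.extCurvature_eq hr i)

/-- The constants 4π cancel, and exchanging the sums regroups the vertex contributions by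
tetrahedra, reducing everything to one tetrahedron. -/
theorem sum_extCurvature_sub [Fintype T.Vertex] {r s : T.Vertex → ℝ} (hr : T.IsBallPacking r)
    (hs : T.IsBallPacking s) :
    ∑ i, (T.extCurvature s i - T.extCurvature r i) * (s i - r i) =
      -∑ t, ∑ m, (ballAngle (fun m => s (T.corner t m)) m -
        ballAngle (fun m => r (T.corner t m)) m) * (s (T.corner t m) - r (T.corner t m)) := by
  classical
  simp_rw [T.extCurvature_eq hr, T.extCurvature_eq hs, sub_sub_sub_cancel_left,
    ← Finset.sum_sub_distrib, Finset.sum_mul, Finset.sum_filter]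
  rw [Finset.sum_comm, Fintype.sum_prod_type, ← Finset.sum_neg_distrib]
  refine Finset.sum_congr rfl fun t _ => ?_
  rw [← Finset.sum_neg_distrib]
  refine Finset.sum_congr rfl fun m _ => ?_
  rw [Finset.sum_ite_eq]
  simp only [Finset.mem_univ, if_true]
  ring

theorem sum_extCurvature_monotone [Fintype T.Vertex] {r s : T.Vertex → ℝ}
    (hr : T.IsBallPacking r) (hs : T.IsBallPacking s) :
    0 ≤ ∑ i, (T.extCurvature s i - T.extCurvature r i) * (s i - r i) := by
  rw [T.sum_extCurvature_sub hr hs, Left.nonneg_neg_iff]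
  exact Finset.sum_nonpos fun t _ => sum_ballAngle_antitone (fun m => hr _) fun m => hs _

/-- Near a real packing the curvature is strongly monotone, uniformly on bounded sets. -/
theorem sum_extCurvature_strict [Fintype T.Vertex] (hdeg : ∀ i, 0 < T.tetraDegree i)
    {r : T.Vertex → ℝ} (hr : T.IsRealBallPacking r) {D : ℝ} (hD : 0 < D) :
    ∃ c > 0, ∀ s, T.IsBallPacking s → (∀ i, |s i - r i| ≤ D) →
      c * ∑ i, (s i - r i) ^ 2 ≤
        ∑ i, (T.extCurvature s i - T.extCurvature r i) * (s i - r i) := by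
  choose c hc hcs using fun t => sum_ballAngle_strict (fun m => hr.1 (T.corner t m))
    ((isRealTetrahedron_iff fun m => hr.1 (T.corner t m)).1 (hr.2 t)) hD
  choose t m htm using fun i => T.exists_corner_eq_of_degree (hdeg i)
  obtain ⟨c₀, hc₀, hle⟩ : ∃ c₀ > 0, ∀ t, c₀ ≤ c t := by
    rcases isEmpty_or_nonempty T.Tetra with h | h
    · exact ⟨1, one_pos, fun t => h.elim t⟩
    · obtain ⟨t₀, ht₀⟩ := Finite.exists_min c
      exact ⟨c t₀, hc t₀, ht₀⟩
  have hN : (0 : ℝ) < Fintype.card T.Vertex + 1 := by positivity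
  refine ⟨c₀ / (Fintype.card T.Vertex + 1), div_pos hc₀ hN, fun s hs hsD => ?_⟩
  set S := ∑ t, ‖(fun m => s (T.corner t m)) - fun m => r (T.corner t m)‖ ^ 2 with hS
  have hS0 : 0 ≤ S := Finset.sum_nonneg fun _ _ => sq_nonneg _
  -- Every vertex is a corner of some tetrahedron, so each coordinate difference is controlled by S.
  have h1 : ∑ i, (s i - r i) ^ 2 ≤ Fintype.card T.Vertex * S := by
    rw [← nsmul_eq_mul]
    refine Finset.sum_le_card_nsmul _ _ _ fun i _ => ?_
    refine le_trans ?_ (Finset.single_le_sum (fun _ _ => sq_nonneg _) (Finset.mem_univ (t i)))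
    rw [← sq_abs]
    refine pow_le_pow_left₀ (abs_nonneg _) ?_ 2
    have := norm_le_pi_norm
      ((fun m => s (T.corner (t i) m)) - fun m => r (T.corner (t i) m)) (m i)
    simpa only [Pi.sub_apply, htm, Real.norm_eq_abs] using this
  have h2 : c₀ * S ≤ ∑ i, (T.extCurvature s i - T.extCurvature r i) * (s i - r i) := by
    rw [T.sum_extCurvature_sub hr.1 hs, ← Finset.sum_neg_distrib, hS, Finset.mul_sum]
    refine Finset.sum_le_sum fun t _ => ?_
    have h3 := hcs t (fun m => s (T.corner t m)) (fun m => hs _)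
      ((pi_norm_le_iff_of_nonneg hD.le).2 fun m => hsD _)
    have h4 := mul_le_mul_of_nonneg_right (hle t)
      (sq_nonneg ‖(fun m => s (T.corner t m)) - fun m => r (T.corner t m)‖)
    linarith
  refine le_trans ?_ h2
  calc c₀ / (Fintype.card T.Vertex + 1) * ∑ i, (s i - r i) ^ 2
      ≤ c₀ / (Fintype.card T.Vertex + 1) * ((Fintype.card T.Vertex + 1) * S) := by
        gcongr
        linarith
    _ = c₀ * S := by field_simp

/-- At a vertex of degree at least `23` carrying the smallest ball, if that ball is small enough,
the curvature is negative. -/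
theorem exists_extCurvature_neg : ∃ ε > 0, ∀ r, T.IsBallPacking r → ∀ i, 23 ≤ T.tetraDegree i →
    r i ≤ ε → (∀ j, r i ≤ r j) → T.extCurvature r i < 0 := by
  classical
  obtain ⟨ε, hε, h⟩ := exists_lt_ballAngle
  refine ⟨ε, hε, fun r hr i hi hri hmin => ?_⟩
  have hcard := hi.trans (T.tetraDegree_le_card i)
  rw [T.extCurvature_eq hr, sub_neg]
  set F : Finset (T.Tetra × Fin 4) := {c | T.corner c.1 c.2 = i} with hF
  have hlt : ∀ c ∈ F, 4 * Real.pi / 23 < ballAngle (fun m => r (T.corner c.1 m)) c.2 := by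
    intro c hc
    have hc : T.corner c.1 c.2 = i := by simpa [hF] using hc
    exact h _ (fun m => hr _) c.2 (by rwa [hc]) fun j => by rw [hc]; exact hmin _
  have hne : F.Nonempty := Finset.card_pos.1 (by omega)
  calc 4 * Real.pi = (23 : ℕ) * (4 * Real.pi / 23) := by push_cast; ring
    _ ≤ #F * (4 * Real.pi / 23) := by
        have : (0 : ℝ) ≤ 4 * Real.pi / 23 := by positivity
        gcongr
    _ = ∑ c ∈ F, 4 * Real.pi / 23 := by rw [Finset.sum_const, nsmul_eq_mul]
    _ < _ := Finset.sum_lt_sum_of_nonempty hne hlt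

/-- The curvature is positive at a large ball. -/
theorem exists_extCurvature_pos : ∃ R > 0, ∀ r, T.IsBallPacking r → ∀ i, R ≤ r i →
    0 < T.extCurvature r i := by
  classical
  -- The total number of corners bounds the number of angles at any vertex.
  set N : ℕ := Fintype.card (T.Tetra × Fin 4)
  have hN : (0 : ℝ) < N + 1 := by positivity
  obtain ⟨R, hR, h⟩ := exists_ballAngle_le (ε := 4 * Real.pi / (N + 1)) (by positivity)
  refine ⟨R, hR, fun r hr i hi => ?_⟩
  rw [T.extCurvature_eq hr, sub_pos]
  set F : Finset (T.Tetra × Fin 4) := {c | T.corner c.1 c.2 = i} with hF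
  have hle : ∀ c ∈ F, ballAngle (fun m => r (T.corner c.1 m)) c.2 ≤ 4 * Real.pi / (N + 1) := by
    intro c hc
    have hc : T.corner c.1 c.2 = i := by simpa [hF] using hc
    exact h _ (fun m => hr _) c.2 (by rwa [hc])
  calc _ ≤ #F • (4 * Real.pi / (N + 1)) := Finset.sum_le_card_nsmul _ _ _ hle
    _ ≤ N * (4 * Real.pi / (N + 1)) := by
        rw [nsmul_eq_mul]
        gcongr
        exact Finset.card_le_univ F
    _ < 4 * Real.pi := by
        rw [mul_div_assoc', div_lt_iff₀ hN]
        nlinarith [Real.pi_pos]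

end Triangulation

/-! ### A common box, and the conclusion -/

theorem exists_forall_mem_Icc {ι : Type*} [Finite ι] {r s : ι → ℝ} (hr : ∀ i, 0 < r i)
    (hs : ∀ i, 0 < s i) {ε R : ℝ} (hε : 0 < ε) :
    ∃ a b, 0 < a ∧ a < b ∧ a ≤ ε ∧ R ≤ b ∧ (∀ i, r i ∈ Set.Icc a b) ∧ ∀ i, s i ∈ Set.Icc a b := by
  obtain ⟨B, hB⟩ := (Set.finite_range fun i => max (r i) (s i)).bddAbove
  rcases isEmpty_or_nonempty ι with h | h
  · exact ⟨ε, max (ε + 1) R, hε, lt_max_of_lt_left (by linarith), le_rfl, le_max_right _ _,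
      fun i => h.elim i, fun i => h.elim i⟩
  · obtain ⟨i₀, hi₀⟩ := Finite.exists_min fun i => min (r i) (s i)
    have ha : 0 < min ε (min (r i₀) (s i₀)) := lt_min hε (lt_min (hr _) (hs _))
    refine ⟨min ε (min (r i₀) (s i₀)), max (ε + 1) (max R B), ha,
      lt_max_of_lt_left ((min_le_left _ _).trans_lt (by linarith)), min_le_left _ _,
      le_max_of_le_right (le_max_left _ _), fun i => ⟨?_, ?_⟩, fun i => ⟨?_, ?_⟩⟩
    · exact (min_le_right _ _).trans ((hi₀ i).trans (min_le_left _ _))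
    · exact le_max_of_le_right (le_max_of_le_right ((le_max_left _ _).trans (hB ⟨i, rfl⟩)))
    · exact (min_le_right _ _).trans ((hi₀ i).trans (min_le_right _ _))
    · exact le_max_of_le_right (le_max_of_le_right ((le_max_right _ _).trans (hB ⟨i, rfl⟩)))

end

theorem theorem1p2 {M : Type*} [TopologicalSpace M] [T2Space M] [CompactSpace M]
    [ChartedSpace (EuclideanSpace ℝ (Fin 3)) M] (T : Triangulation M)
    (hdeg : ∀ i : T.Vertex, 23 ≤ T.tetraDegree i) :
    (∃ r : T.Vertex → ℝ, T.IsBallPacking r ∧ ∀ i, T.extCurvature r i = 0) ∧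
    ∀ rbar : T.Vertex → ℝ, T.IsRealBallPacking rbar → (∀ i, T.extCurvature rbar i = 0) →
      ∀ r₀ : T.Vertex → ℝ, T.IsBallPacking r₀ →
        (∃ r : ℝ → T.Vertex → ℝ, T.IsExtYamabeFlow r₀ r) ∧
        ∀ r : ℝ → T.Vertex → ℝ, T.IsExtYamabeFlow r₀ r →
          ∃ C > (0 : ℝ), ∃ c > (0 : ℝ), ∀ t, 0 ≤ t → ∀ i,
            |r t i - rbar i| ≤ C * Real.exp (-c * t) := by
  have := Fintype.ofFinite T.Vertex
  obtain ⟨ε, hε, hneg⟩ := T.exists_extCurvature_neg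
  obtain ⟨R, -, hpos⟩ := T.exists_extCurvature_pos
  have hpack : ∀ {a b : ℝ} {x : T.Vertex → ℝ}, 0 < a → (∀ i, x i ∈ Set.Icc a b) →
      T.IsBallPacking x := fun ha hx i => ha.trans_le (hx i).1
  have hlow : ∀ {a b : ℝ}, 0 < a → a ≤ ε → ∀ x : T.Vertex → ℝ, (∀ i, x i ∈ Set.Icc a b) →
      ∀ i, x i = a → T.extCurvature x i < 0 := fun ha haε x hx i hi =>
    hneg x (hpack ha hx) i (hdeg i) (hi.trans_le haε) fun j => hi.trans_le (hx j).1
  have hup : ∀ {a b : ℝ}, 0 < a → R ≤ b → ∀ x : T.Vertex → ℝ, (∀ i, x i ∈ Set.Icc a b) →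
      ∀ i, x i = b → 0 < T.extCurvature x i := fun ha hRb x hx i hi =>
    hpos x (hpack ha hx) i (hRb.trans_eq hi.symm)
  have hcont : ∀ {a b : ℝ}, 0 < a →
      ContinuousOn T.extCurvature {x | ∀ i, x i ∈ Set.Icc a b} := fun ha =>
    T.continuousOn_extCurvature.mono fun x hx => hpack ha hx
  refine ⟨?_, fun rbar hbar hzero r₀ hr₀ => ?_⟩
  -- Only the size of the box matters here; the constant packings 1 are placeholders.
  · obtain ⟨a, b, ha, hab, haε, hRb, -⟩ := exists_forall_mem_Icc (ι := T.Vertex) (R := R)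
      (r := fun _ => 1) (s := fun _ => 1) (fun _ => one_pos) (fun _ => one_pos) hε
    obtain ⟨x, hx, hx0⟩ := exists_zero_of_monotone hab (hcont ha)
      (fun x y hx hy => T.sum_extCurvature_monotone (hpack ha hy) (hpack ha hx))
      (hlow ha haε) (hup ha hRb)
    exact ⟨x, hpack ha hx, hx0⟩
  -- The box contains both the initial packing and the limit, so strong monotonicity with D = b - a
  -- applies along the whole trajectory.
  · obtain ⟨a, b, ha, hab, haε, hRb, hz, h0⟩ :=
      exists_forall_mem_Icc (R := R) hbar.1 hr₀ hε
    refine ⟨?_, fun r hr => ?_⟩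
    · obtain ⟨r, hr0, hbox, hd⟩ := exists_flow ha hab.le (hcont ha) (hlow ha haε) (hup ha hRb) h0
      exact ⟨r, hr0, fun t ht => hpack ha (hbox t ht), hd⟩
    · have hbox : ∀ t, 0 ≤ t → ∀ i, r t i ∈ Set.Icc a b := fun t ht i =>
        flow_mem_box ha hab.le (hlow ha haε) (hup ha hRb) (by rw [hr.initial]; exact h0)
          (fun i t ht => (hr.hasDeriv t ht i).continuousWithinAt)
          (fun t ht _ => hr.hasDeriv t ht) ht i
      obtain ⟨c, hc, hstrong⟩ := T.sum_extCurvature_strict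
        (fun i => lt_of_lt_of_le (by norm_num) (hdeg i)) hbar (sub_pos.2 hab)
      refine flow_exp_convergence ha hab.le hc hz (fun x hx => ?_) hbox hr.hasDeriv
      have := hstrong x (hpack ha hx) fun i =>
        abs_sub_le_iff.2 ⟨by linarith [(hx i).2, (hz i).1], by linarith [(hx i).1, (hz i).2]⟩
      simpa only [hzero, sub_zero] using this
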